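/- Let $K$ be a field of characteristic $0$, let $t\in K$ be nonzero and not a root of unity, and let $u_1,u_2\in K$ be nonzero (for instance independent parameters). For a partition $\lambda=(\lambda_1\ge\lambda_2\ge\cdots)$ with multiplicities $m_i=m_i(\lambda)$ write $|\lambda|=\sum_i\lambda_i$, $\ell(\lambda)$ for the number of parts, $n(\lambda)=\sum_{i\ge1}(i-1)\lambda_i$ and $b_\lambda(t)=\prod_{i\ge1}\prod_{k=1}^{m_i}(1-t^k)$. Let $\Lambda=K[p_1,p_2,\dots]$ be the ring of symmetric functions, with $p_n$ the power sums, and let $\langle-,-\rangle_{0,t}$ be the bilinear form with $\langle p_\lambda,p_\mu\rangle_{0,t}=\delta_{\lambda,\mu}\prod_{i}i^{m_i}m_i!\,(1-t^i)^{-m_i}$. There is exactly one family $P_\lambda(p_n;t)\in\Lambda$ (the Hall–Littlewood functions) that is pairwise orthogonal for this form and satisfies $P_\lambda=m_\lambda+\sum_{\mu<\lambda}c_{\lambda\mu}m_\mu$, where $m_\mu$ are the monomial symmetric functions and $<$ is the dominance order. Put $Q_\lambda(p_n;t)=b_\lambda(t)P_\lambda(p_n;t)$, and let $Q_\lambda(-p_n;t)$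 be obtained from it by $p_n\mapsto-p_n$ for all $n\geq 1$. **(1)** For every partition $\lambda$ and $s=|\lambda|$, $$\big\langle Q_{(s)}(-p_n;t),\,Q_\lambda(p_n;t)\big\rangle_{0,t}=t^{|\lambda|+n(\lambda)}\prod_{k=1}^{\ell(\lambda)}(1-t^{-k}),$$ where $(0)$ means the empty partition. **(2)** Let $b^{(i)}_n$ ($i=1,2$, $n\in\mathbb Z\setminus\{0\}$) be bosons with $[b^{(i)}_n,b^{(j)}_m]=\frac{n}{1-t^{|n|}}\delta_{i,j}\delta_{n+m,0}$, acting on the Fock space generated by $|\vec u\rangle$ with $b^{(i)}_n|\vec u\rangle=0$ for $n>0$; let $\langle\vec u|$ be the dual vacuum, with $\langle\vec u|b^{(i)}_{-n}=0$ for $n>0$ and $\langle \vec u|\vec u\rangle=1$, and let $U_i$ act as the scalar $u_i$. Define the crystallized generators by their free field representations: put $$\tilde\Lambda^1(z)=e^{\sum_{n>0}\frac{1-t^{-n}}nz^nb^{(1)}_{-n}}e^{-\sum_{n>0}\frac{1-t^n}nz^{-n}b^{(1)}_n}U_1,\qquad \tilde\Lambda^2(z)=e^{-\sum_{n>0}\frac{1-t^{-n}}nz^nb^{(1)}_{-n}}e^{\sum_{n>0}\frac{1-t^{-n}}nz^nb^{(2)}_{-n}}e^{-\sum_{n>0}\frac{1-t^n}nz^{-n}b^{(2)}_n}U_2,$$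 let $\tilde X^{(1)}_m$ be the coefficient of $z^{-m}$ in $\tilde\Lambda^1(z)$ if $m>0$, in $\tilde\Lambda^2(z)$ if $m<0$, and in $\tilde\Lambda^1(z)+\tilde\Lambda^2(z)$ if $m=0$, and let $\tilde X^{(2)}_m$ be the coefficient of $z^{-m}$ in $$e^{\sum_{n>0}\frac{1-t^{-n}}nz^nb^{(2)}_{-n}}e^{-\sum_{n>0}\frac{1-t^n}nz^{-n}b^{(1)}_n}e^{-\sum_{n>0}\frac{1-t^n}nz^{-n}b^{(2)}_n}U_1U_2.$$ For pairs of partitions $\vec\lambda=(\lambda^{(1)},\lambda^{(2)})$ and $\vec\mu=(\mu^{(1)},\mu^{(2)})$ the Shapovalov matrix is $$S_{\vec\lambda,\vec\mu}=\langle\vec u|\cdots\tilde X^{(1)}_{\lambda^{(1)}_2}\tilde X^{(1)}_{\lambda^{(1)}_1}\cdots\tilde X^{(2)}_{\lambda^{(2)}_2}\tilde X^{(2)}_{\lambda^{(2)}_1}\;\tilde X^{(2)}_{-\mu^{(2)}_1}\tilde X^{(2)}_{-\mu^{(2)}_2}\cdots\tilde X^{(1)}_{-\mu^{(1)}_1}\tilde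 X^{(1)}_{-\mu^{(1)}_2}\cdots|\vec u\rangle .$$ Then $S_{\vec\lambda,\vec\mu}=0$ unless $|\lambda^{(1)}|+|\lambda^{(2)}|=|\mu^{(1)}|+|\mu^{(2)}|$; each of the resulting finite blocks is invertible; and the entries $S^{\vec\lambda,\vec\mu}$ of the inverse matrix satisfy, for every partition $\lambda$ and $s=|\lambda|$, $$S^{(\emptyset,\lambda),(\emptyset,(s))}=S^{(\emptyset,(s)),(\emptyset,\lambda)}=\frac{(u_1u_2)^{-\ell(\lambda)-\ell((s))}}{b_\lambda(t^{-1})\,b_{(s)}(t^{-1})}\;t^{-|\lambda|-n(\lambda)}\prod_{k=1}^{\ell(\lambda)}(1-t^k).$$ -/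

import Mathlib

namespace HallLittlewood

/-! ### Partitions -/

/-- The parts `λ₁ ≥ λ₂ ≥ ⋯` of a partition, as a weakly decreasing list. -/
def rows {n : ℕ} (lam : n.Partition) : List ℕ :=
  lam.parts.sort (fun a b => a ≥ b)

/-- The length `ℓ(λ)`: the number of (positive) parts. -/
def length {n : ℕ} (lam : n.Partition) : ℕ :=
  lam.parts.card

/-- `n(λ) = ∑_{i ≥ 1} (i - 1) λ_i` (the list is indexed from `0`). -/
def nStat {n : ℕ} (lam : n.Partition) : ℕ :=
  ∑ i ∈ Finset.range (length lam), i * (rows lam).getD i 0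

/-- The dominance order `λ ≥ μ` on partitions of the same integer. -/
def Dominates {n : ℕ} (lam mu : n.Partition) : Prop :=
  ∀ k : ℕ, ((rows mu).take k).sum ≤ ((rows lam).take k).sum

/-- The one-row partition `(s)`; for `s = 0` it is the empty partition. -/
def oneRow (s : ℕ) : s.Partition :=
  Nat.Partition.indiscrete s

/-! ### Symmetric functions as polynomials in the power sums -/

section Sym

variable {K : Type*} [Field K]

/-- The ring of symmetric functions `Λ = K[p₁, p₂, …]`; the variable `X n` is the power sum
`p_n`, `n ≥ 1`. -/
abbrev SymFun (K : Type*) [Field K] : Type _ := MvPolynomial ℕ+ K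

/-- The image of a symmetric function in `N` variables: `p_n ↦ x₁ⁿ + ⋯ + x_Nⁿ`. -/
noncomputable def toVars (N : ℕ) : SymFun K →ₐ[K] MvPolynomial (Fin N) K :=
  MvPolynomial.aeval fun n : ℕ+ => MvPolynomial.psum (Fin N) K n

/-- The substitution `p_n ↦ -p_n`, i.e. `f(p_n) ↦ f(-p_n)`. -/
noncomputable def negP : SymFun K →ₐ[K] SymFun K :=
  MvPolynomial.aeval fun n : ℕ+ => -MvPolynomial.X n

/-- The inner product `⟨-,-⟩_{q,t}`: the bilinear form for which the monomials
`p_λ = ∏ p_i^{m_i}` are orthogonal and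
`⟨p_λ, p_λ⟩ = ∏_i i^{m_i} m_i! ((1 - q^i)/(1 - t^i))^{m_i}`. -/
noncomputable def innerQT (q t : K) (f g : SymFun K) : K :=
  ∑ m ∈ f.support, f.coeff m * g.coeff m *
    m.prod fun i k => (i : K) ^ k * (k.factorial : K) * ((1 - q ^ (i : ℕ)) / (1 - t ^ (i : ℕ))) ^ k

/-- The conditions defining the Macdonald functions `P_λ(p_n; q, t)`: they are pairwise orthogonal
for `⟨-,-⟩_{q,t}`, and `P_λ = m_λ + ∑_{μ < λ} c_{λμ} m_μ` with `m_μ` the monomial symmetric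
functions (the identity in `Λ` is the identity in `N` variables for every `N`). -/
def IsMacdonald (q t : K) (P : ∀ n : ℕ, n.Partition → SymFun K) : Prop :=
  (∀ x y : Σ n : ℕ, n.Partition, x ≠ y → innerQT q t (P x.1 x.2) (P y.1 y.2) = 0) ∧
  ∀ (n : ℕ) (lam : n.Partition), ∃ c : n.Partition → K,
    (∀ mu, c mu ≠ 0 → Dominates lam mu ∧ mu ≠ lam) ∧
    ∀ N : ℕ, toVars N (P n lam) =
      MvPolynomial.msymm (Fin N) K lam + ∑ mu, c mu • MvPolynomial.msymm (Fin N) K mu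

/-- The conditions defining the Hall-Littlewood functions `P_λ(p_n; t) = P_λ(p_n; 0, t)`. -/
def IsHallLittlewood (t : K) (P : ∀ n : ℕ, n.Partition → SymFun K) : Prop :=
  IsMacdonald 0 t P

/-- `b_λ(t) = ∏_{i ≥ 1} ∏_{k=1}^{m_i(λ)} (1 - t^k)`. -/
def b (t : K) {n : ℕ} (lam : n.Partition) : K :=
  ∏ i ∈ lam.parts.toFinset, ∏ k ∈ Finset.Icc 1 (lam.parts.count i), (1 - t ^ k)

/-- `Q_λ(p_n; t) = b_λ(t) P_λ(p_n; t)`, for a given family `P` of Hall-Littlewood functions. -/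
noncomputable def Q (t : K) (P : ∀ n : ℕ, n.Partition → SymFun K) {n : ℕ}
    (lam : n.Partition) : SymFun K :=
  b t lam • P n lam

end Sym

/-! ### The Fock space and the crystallized generators -/

section Fock

variable {K : Type*} [Field K]

/-- The Fock space `F_u` of the two bosons `b^{(1)}, b^{(2)}`: polynomials in the creation
operators `b^{(i)}_{-n}`, `n ≥ 1`, acting on the vacuum `|u⟩ = 1`.
The index `0` stands for `i = 1` and the index `1` for `i = 2`. -/
abbrev Fock (K : Type*) [Field K] : Type _ := MvPolynomial (Fin 2 × ℕ+) K

/-- The creation operator `b^{(i)}_{-n}`, `n ≥ 1`. -/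
noncomputable def cre (i : Fin 2) (n : ℕ+) : Module.End K (Fock K) :=
  LinearMap.mulLeft K (MvPolynomial.X (i, n))

/-- The annihilation operator `b^{(i)}_{n} = n / (1 - t^n) ∂/∂b^{(i)}_{-n}`, `n ≥ 1`, so that
`[b^{(i)}_n, b^{(j)}_m] = n / (1 - t^{|n|}) δ_{i,j} δ_{n+m,0}`. -/
noncomputable def ann (t : K) (i : Fin 2) (n : ℕ+) : Module.End K (Fock K) :=
  ((n : K) / (1 - t ^ (n : ℕ))) • (MvPolynomial.pderiv (i, n)).toLinearMap

/-- The coefficient of `x^k` in `exp (∑_{n ≥ 1} a_n x^n) = ∑_m (∑_{n ≥ 1} a_n x^n)^m / m!`;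
the terms with `m > k` do not contribute. -/
noncomputable def expCoeff (a : ℕ+ → Module.End K (Fock K)) (k : ℕ) : Module.End K (Fock K) :=
  ∑ m ∈ Finset.range (k + 1), ((m.factorial : K)⁻¹) •
    PowerSeries.coeff k
      ((PowerSeries.mk fun n : ℕ => if h : 0 < n then a ⟨n, h⟩ else 0) ^ m)

/-- For `V(z) = exp (∑_{n≥1} α_n z^n) exp (∑_{n≥1} β_n z^{-n})`, the action on a vector of the
mode `V_m` in `V(z) = ∑_m V_m z^{-m}`, that is `V_m f = ∑_{k ≥ 0, j ≥ 0, j - k = m} A_k B_j f`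
with `A_k`, `B_j` the coefficients of `z^k`, `z^{-j}` in the two exponentials.  When the `β_n` are
combinations of annihilation operators, only finitely many terms are nonzero. -/
noncomputable def mode (al be : ℕ+ → Module.End K (Fock K)) (m : ℤ) (f : Fock K) : Fock K :=
  ∑ᶠ kj : ℕ × ℕ, if (kj.2 : ℤ) - (kj.1 : ℤ) = m then expCoeff al kj.1 (expCoeff be kj.2 f) else 0

/-- `(1 - t^{-n}) / n`. -/
noncomputable def cMinus (t : K) (n : ℕ+) : K := (1 - (t ^ (n : ℕ))⁻¹) / (n : K)

/-- `(1 - t^n) / n`. -/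
noncomputable def cPlus (t : K) (n : ℕ+) : K := (1 - t ^ (n : ℕ)) / (n : K)

/-- The mode `Λ̃¹_m` of
`Λ̃¹(z) = exp{∑ (1-t^{-n})/n z^n b¹_{-n}} exp{-∑ (1-t^n)/n z^{-n} b¹_n} U₁`. -/
noncomputable def Lam1 (t u₁ : K) (m : ℤ) (f : Fock K) : Fock K :=
  u₁ • mode (fun n => cMinus t n • cre 0 n) (fun n => -(cPlus t n • ann t 0 n)) m f

/-- The mode `Λ̃²_m` of
`Λ̃²(z) = exp{-∑ (1-t^{-n})/n z^n b¹_{-n}} exp{∑ (1-t^{-n})/n z^n b²_{-n}}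
  exp{-∑ (1-t^n)/n z^{-n} b²_n} U₂`
(the two creation exponentials commute and are merged). -/
noncomputable def Lam2 (t u₂ : K) (m : ℤ) (f : Fock K) : Fock K :=
  u₂ • mode (fun n => -(cMinus t n • cre 0 n) + cMinus t n • cre 1 n)
    (fun n => -(cPlus t n • ann t 1 n)) m f

/-- The crystallized generator `X̃^{(1)}_m = θ[m ≥ 0] Λ̃¹_m + θ[m ≤ 0] Λ̃²_m`. -/
noncomputable def X1 (t u₁ u₂ : K) (m : ℤ) (f : Fock K) : Fock K :=
  (if 0 ≤ m then Lam1 t u₁ m f else 0) + (if m ≤ 0 then Lam2 t u₂ m f else 0)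

/-- The crystallized generator `X̃^{(2)}_m`, the mode of
`X̃²(z) = exp{∑ (1-t^{-n})/n z^n b²_{-n}} exp{-∑ (1-t^n)/n z^{-n} b¹_n}
  exp{-∑ (1-t^n)/n z^{-n} b²_n} U₁ U₂` (the two annihilation exponentials are merged). -/
noncomputable def X2 (t u₁ u₂ : K) (m : ℤ) (f : Fock K) : Fock K :=
  (u₁ * u₂) • mode (fun n => cMinus t n • cre 1 n)
    (fun n => -(cPlus t n • ann t 0 n) + -(cPlus t n • ann t 1 n)) m f

/-- The vector `X̃²_{-μ₁} X̃²_{-μ₂} ⋯ X̃¹_{-λ₁} X̃¹_{-λ₂} ⋯ |u⟩` for the pair `(λ, μ)`. -/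
noncomputable def ket (t u₁ u₂ : K) {a c : ℕ} (lam : a.Partition) (mu : c.Partition) : Fock K :=
  (rows mu).foldr (fun (r : ℕ) f => X2 t u₁ u₂ (-(r : ℤ)) f)
    ((rows lam).foldr (fun (r : ℕ) f => X1 t u₁ u₂ (-(r : ℤ)) f) 1)

/-- The functional `⟨u| ⋯ X̃¹_{λ₂} X̃¹_{λ₁} ⋯ X̃²_{μ₂} X̃²_{μ₁}` for the pair `(λ, μ)`; the dual
vacuum `⟨u|` is the constant coefficient. -/
noncomputable def bra (t u₁ u₂ : K) {a c : ℕ} (lam : a.Partition) (mu : c.Partition)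
    (f : Fock K) : K :=
  MvPolynomial.constantCoeff
    ((rows lam).foldl (fun f (r : ℕ) => X1 t u₁ u₂ (r : ℤ) f)
      ((rows mu).foldl (fun f (r : ℕ) => X2 t u₁ u₂ (r : ℤ) f) f))

/-- Pairs of partitions `(λ^{(1)}, λ^{(2)})` with `|λ^{(1)}| + |λ^{(2)}| = s`. -/
abbrev Bipartition (s : ℕ) : Type :=
  Σ ij : {ij : ℕ × ℕ // ij ∈ Finset.HasAntidiagonal.antidiagonal s}, ij.1.1.Partition × ij.1.2.Partition

/-- The pair `(∅, λ)`. -/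
def emptyPair {s : ℕ} (lam : s.Partition) : Bipartition s :=
  ⟨⟨(0, s), by simp⟩, (Nat.Partition.indiscrete 0, lam)⟩

/-- The entry `S_{x,y}` of the Shapovalov matrix, for pairs of partitions `x`, `y` of
possibly different total sizes. -/
noncomputable def shapovalovEntry (t u₁ u₂ : K) {r s : ℕ} (x : Bipartition r)
    (y : Bipartition s) : K :=
  bra t u₁ u₂ x.2.1 x.2.2 (ket t u₁ u₂ y.2.1 y.2.2)

/-- The block of the Shapovalov matrix on pairs of partitions of total size `s`. -/
noncomputable def shapovalov (t u₁ u₂ : K) (s : ℕ) : Matrix (Bipartition s) (Bipartition s) K :=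
  Matrix.of fun x y => shapovalovEntry t u₁ u₂ x y

end Fock

end HallLittlewood

/-! Everything rests on Jing's vertex operator H(z) = q(z) exp(-∑ z^{-n} ∂/∂p_n), where q(z) = exp(∑
(1-t^n)/n p_n z^n). For ⟨-,-⟩_{0,t} the multiplication by (1-t^n)/n p_n is adjoint to ∂/∂p_n, so the
adjoint of H_m is H_{-m} conjugated by p_n ↦ -p_n (`form_jing`, `jingAdj_eq`). Both products of H
with its adjoint are expansions, in opposite directions, of (1-tx)/(1-x) times one normally ordered
product. Comparing them gives the relations `jingAdj_jing_add` and `jing_jingAdj_sub`, from which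
the vectors H_{λ_1}H_{λ_2}⋯1 (`jingQ`) are orthogonal with squared norm b_λ(t) (`form_jingVec`).

These vectors are unitriangular in the products q_μ (`jingVec_sub_qMul`), and the q_μ are dual to
the monomial functions m_μ (`coeff_toVars`). Hence b_λ^{-1} times them satisfies the definition of
P_λ (`isHallLittlewood_hallP`). Uniqueness is the Gram-Schmidt argument of
`IsHallLittlewood.eq_hallP`, so the vectors are the Q_λ.

For (1), Q_(s) = q_s, and pairing with q_s(-p_n) extracts the z^s coefficient of the specialization
p_n ↦ -z^n. Under p_n ↦ -(1+t^n+⋯+t^{(r-1)n}) z^n, each H_m with m > 0 becomes a scalar monomial and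
raises r by one (`negSpec_jing`). So Q_λ specializes to an explicit product (`form_rf_jingVec`).

For (2), each vertex operator that contributes is a copy of H with parameter t⁻¹, creating along a
vector c and annihilating along a vector d of K². The pairings ∑ c_i d_i are 0 or 1 where they are
needed. The Shapovalov entry therefore factors, up to powers of u_1 and u_2, as ⟨Q_{λ¹},
Q_{μ¹}⟩⟨Q_{λ²}(p_n), Q_{μ²}(-p_n)⟩ at t⁻¹ (`shapovalovEntry_eq`). Since p_n ↦ -p_n is a self-adjoint
involution, Parseval's identity inverts such a matrix by dividing its entries by the norms
(`sum_pairForm`). The required entries of the inverse are then (1) at t⁻¹. -/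

namespace HallLittlewood

open Finset

/-! ### Exponentials of generating series -/

section Exponential

open PowerSeries

variable {K : Type*} [Field K]

section Noncomm

variable {A : Type*} [Ring A] [Algebra K A]

/-- The generating series `∑_{n ≥ 1} a_n z^n`. -/
noncomputable def genSeries (a : ℕ+ → A) : PowerSeries A :=
  PowerSeries.mk fun n : ℕ => if n = 0 then 0 else a n.toPNat'

/-- The coefficient of `z^k` in `exp (∑_{n ≥ 1} a_n z^n)`. -/
noncomputable def expSum (K : Type*) [Field K] {A : Type*} [Ring A] [Algebra K A]
    (a : ℕ+ → A) (k : ℕ) : A :=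
  ∑ m ∈ range (k + 1), ((m.factorial : K)⁻¹) • coeff k (genSeries a ^ m)

/-- The Euler operator `z d/dz`. -/
noncomputable def euler (F : PowerSeries A) : PowerSeries A :=
  PowerSeries.mk fun k => k • coeff k F

@[simp] lemma coeff_euler (F : PowerSeries A) (k : ℕ) : coeff k (euler F) = k • coeff k F := by
  simp [euler]

lemma euler_mul (F G : PowerSeries A) : euler (F * G) = euler F * G + F * euler G := by
  ext k
  simp only [coeff_euler, map_add, coeff_mul, smul_sum, ← sum_add_distrib]
  refine sum_congr rfl fun p hp => ?_
  rw [← mem_antidiagonal.1 hp, add_smul, smul_mul_assoc, mul_smul_comm]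

@[simp] lemma euler_one : euler (1 : PowerSeries A) = 0 := by
  ext k
  rcases eq_or_ne k 0 with rfl | hk <;> simp [coeff_one, *]

@[simp] lemma coeff_zero_genSeries (a : ℕ+ → A) : coeff 0 (genSeries a) = 0 := by
  simp [genSeries]

lemma coeff_genSeries (a : ℕ+ → A) (n : ℕ+) : coeff n (genSeries a) = a n := by
  simp [genSeries]

lemma euler_pow {F : PowerSeries A} (h : Commute (euler F) F) (m : ℕ) :
    euler (F ^ m) = m • (euler F * F ^ (m - 1)) := by
  induction m with
  | zero => simp
  | succ m ih =>
    rcases m with _ | m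
    · simp
    · have h2 := (h.pow_right (m + 1)).eq
      rw [pow_succ, euler_mul, ih]
      simp only [Nat.add_sub_cancel]
      rw [smul_mul_assoc, mul_assoc, ← pow_succ, ← h2, ← succ_nsmul]

/-- The series has no constant term, so its m-th power starts at z^m. This is why the truncated sum
in `expSum` is the full exponential. -/
lemma coeff_genSeries_pow (a : ℕ+ → A) {k m : ℕ} (h : k < m) : coeff k (genSeries a ^ m) = 0 := by
  induction m generalizing k with
  | zero => omega
  | succ m ih =>
    rw [pow_succ', coeff_mul]
    refine sum_eq_zero fun p hp => ?_
    have hp' := mem_antidiagonal.1 hp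
    rcases Nat.eq_zero_or_pos p.1 with h0 | h0
    · rw [h0, coeff_zero_genSeries, zero_mul]
    · rw [ih (by omega), mul_zero]

lemma expSum_eq (a : ℕ+ → A) {k M : ℕ} (h : k < M) :
    expSum K a k = ∑ m ∈ range M, ((m.factorial : K)⁻¹) • coeff k (genSeries a ^ m) := by
  refine sum_subset (range_subset_range.2 h) fun m _ hm => ?_
  rw [coeff_genSeries_pow a (by simpa using hm), smul_zero]

/-- `F` is the exponential of `∑_{n ≥ 1} a_n z^n`: it has constant term `1` and satisfies the
differential equation of the exponential. -/
def IsExp (a : ℕ+ → A) (F : PowerSeries A) : Prop :=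
  coeff 0 F = 1 ∧ euler F = euler (genSeries a) * F

lemma commute_euler_genSeries {a : ℕ+ → A} (h : ∀ i j, Commute (a i) (a j)) :
    Commute (euler (genSeries a)) (genSeries a) := by
  have hc : ∀ i j, Commute (coeff i (genSeries a)) (coeff j (genSeries a)) := by
    intro i j
    simp only [genSeries, coeff_mk]
    split_ifs <;> simp [h]
  change _ = _
  ext k
  rw [coeff_mul, coeff_mul, ← Finset.Nat.sum_antidiagonal_swap]
  refine sum_congr rfl fun p _ => ?_
  simp only [coeff_euler, Prod.fst_swap, Prod.snd_swap]
  exact ((hc p.2 p.1).smul_left p.2).eq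

/-- Since the series S commutes with its Euler derivative, the derivative of S^m/m! is that of S
times S^{m-1}/(m-1)!, even in a noncommutative algebra. All later identities between exponentials
compare solutions of this equation. -/
lemma isExp_expSum [CharZero K] {a : ℕ+ → A} (h : ∀ i j, Commute (a i) (a j)) :
    IsExp a (PowerSeries.mk (expSum K a)) := by
  refine ⟨by simp [expSum], ?_⟩
  ext k
  have hS := commute_euler_genSeries h
  rw [coeff_euler, coeff_mk, expSum_eq (K := K) a (show k < k + 1 + 1 by omega), sum_range_succ',
    coeff_mul]
  have : ∀ p ∈ antidiagonal k, coeff p.1 (euler (genSeries a)) *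
      coeff p.2 (PowerSeries.mk (expSum K a)) = ∑ m ∈ range (k + 1), ((m.factorial : K)⁻¹) •
        (coeff p.1 (euler (genSeries a)) * coeff p.2 (genSeries a ^ m)) := by
    intro p hp
    have hp' := mem_antidiagonal.1 hp
    rw [coeff_mk, expSum_eq (K := K) a (show p.2 < k + 1 by omega), mul_sum]
    simp only [mul_smul_comm]
  rw [sum_congr rfl this, sum_comm, smul_add, smul_sum]
  -- The term m = 0 is the constant series 1, which the Euler operator kills.
  rw [show k • ((Nat.factorial 0 : K)⁻¹ • coeff k (genSeries a ^ 0)) = 0 by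
    rcases eq_or_ne k 0 with rfl | hk <;> simp [coeff_one, *], add_zero]
  refine sum_congr rfl fun m _ => ?_
  rw [← smul_sum, ← coeff_mul, smul_comm, ← coeff_euler, euler_pow hS, Nat.add_sub_cancel,
    map_nsmul, ← Nat.cast_smul_eq_nsmul K, smul_smul]
  congr 1
  rw [Nat.factorial_succ, Nat.cast_mul, mul_inv, mul_comm, ← mul_assoc, mul_inv_cancel₀, one_mul]
  exact_mod_cast Nat.succ_ne_zero m

/-- Uniqueness for the inhomogeneous exponential equation. -/
lemma eq_of_euler_eq (K : Type*) [Field K] [CharZero K] [Algebra K A]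
    {a : ℕ+ → A} {B F G : PowerSeries A} (h0 : coeff 0 F = coeff 0 G)
    (hF : euler F = euler (genSeries a) * F + B) (hG : euler G = euler (genSeries a) * G + B) :
    F = G := by
  ext k
  induction k using Nat.strong_induction_on with
  | _ k ih =>
    rcases eq_or_ne k 0 with rfl | hk
    · exact h0
    · have h1 := congrArg (coeff k) hF
      have h2 := congrArg (coeff k) hG
      rw [coeff_euler, map_add, coeff_mul] at h1 h2
      have h3 : k • coeff k F = k • coeff k G := by
        rw [h1, h2]
        congr 1
        refine sum_congr rfl fun p hp => ?_
        have hp' := mem_antidiagonal.1 hp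
        rcases Nat.eq_zero_or_pos p.1 with h0 | h0
        · simp [h0]
        · rw [ih p.2 (by omega)]
      rw [← Nat.cast_smul_eq_nsmul K, ← Nat.cast_smul_eq_nsmul K] at h3
      exact (smul_right_injective A (r := (k : K)) (by exact_mod_cast hk)) h3

lemma IsExp.unique (K : Type*) [Field K] [CharZero K] [Algebra K A]
    {a : ℕ+ → A} {F G : PowerSeries A} (hF : IsExp a F) (hG : IsExp a G) :
    F = G :=
  eq_of_euler_eq K (a := a) (B := 0) (hF.1.trans hG.1.symm) (by simpa using hF.2)
    (by simpa using hG.2)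

lemma euler_map {B : Type*} [Ring B] (φ : A →+* B) (F : PowerSeries A) :
    euler (PowerSeries.map φ F) = PowerSeries.map φ (euler F) := by
  ext k; simp

lemma genSeries_map {B : Type*} [Ring B] (φ : A →+* B) (a : ℕ+ → A) :
    PowerSeries.map φ (genSeries a) = genSeries fun n => φ (a n) := by
  ext k
  simp only [genSeries, coeff_map, coeff_mk]
  split_ifs <;> simp

lemma IsExp.map {B : Type*} [Ring B] (φ : A →+* B) {a : ℕ+ → A} {F : PowerSeries A}
    (hF : IsExp a F) : IsExp (fun n => φ (a n)) (PowerSeries.map φ F) := by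
  refine ⟨by rw [coeff_map, hF.1, map_one], ?_⟩
  rw [euler_map, hF.2, map_mul, ← euler_map, genSeries_map]

end Noncomm

section Comm

variable {A : Type*} [CommRing A] [Algebra K A]

lemma genSeries_add (a b : ℕ+ → A) : genSeries (a + b) = genSeries a + genSeries b := by
  ext k
  simp only [genSeries, map_add, coeff_mk]
  split_ifs <;> simp

lemma euler_add (F G : PowerSeries A) : euler (F + G) = euler F + euler G := by
  ext k; simp

lemma IsExp.mul {a b : ℕ+ → A} {F G : PowerSeries A} (hF : IsExp a F) (hG : IsExp b G) :
    IsExp (a + b) (F * G) := by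
  refine ⟨by rw [coeff_mul]; simp [hF.1, hG.1], ?_⟩
  rw [euler_mul, hF.2, hG.2, genSeries_add, euler_add]
  ring

lemma euler_rescale (c : A) (F : PowerSeries A) : euler (rescale c F) = rescale c (euler F) := by
  ext k; simp [mul_left_comm]

lemma IsExp.rescale (c : A) {a : ℕ+ → A} {F : PowerSeries A} (hF : IsExp a F) :
    IsExp (fun n => c ^ (n : ℕ) * a n) (PowerSeries.rescale c F) := by
  refine ⟨by simpa using hF.1, ?_⟩
  have h : PowerSeries.rescale c (genSeries a) = genSeries fun n => c ^ (n : ℕ) * a n := by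
    ext k
    simp only [genSeries, coeff_rescale, coeff_mk]
    rcases k with _ | k <;> simp
  rw [euler_rescale, hF.2, map_mul, ← euler_rescale, h]

lemma isExp_zero_iff (K : Type*) [Field K] [CharZero K] [Algebra K A]
    {F : PowerSeries A} : IsExp (0 : ℕ+ → A) F ↔ F = 1 := by
  have h : IsExp (0 : ℕ+ → A) 1 := by
    refine ⟨by simp, ?_⟩
    have : genSeries (0 : ℕ+ → A) = 0 := by ext k; simp [genSeries]
    rw [this]; ext k; simp
  exact ⟨fun hF => hF.unique K h, fun hF => hF ▸ h⟩

/-- The coefficients of `(1 - a z) / (1 - b z)`. -/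
def ratioCoeff (a b : A) (k : ℕ) : A := if k = 0 then 1 else (b - a) * b ^ (k - 1)

@[simp] lemma ratioCoeff_zero (a b : A) : ratioCoeff a b 0 = 1 := by simp [ratioCoeff]

lemma one_sub_mul_mk_ratioCoeff (a b : A) :
    (1 - C b * X) * PowerSeries.mk (ratioCoeff a b) = 1 - C a * X := by
  ext k
  rcases k with _ | k
  · simp
  · rw [sub_mul, one_mul, mul_assoc, map_sub, coeff_C_mul, coeff_succ_X_mul, map_sub, coeff_C_mul,
      coeff_X, coeff_mk, coeff_mk, coeff_one]
    rcases k with _ | k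
    · simp [ratioCoeff]
    · simp [ratioCoeff, pow_succ]; ring

end Comm

/-- This is log((1-az)/(1-bz)) = ∑ (b^n - a^n)/n z^n. The differential equation is checked after
multiplication by (1-bz)(1-az), which can be cancelled in the domain of power series. -/
lemma isExp_ratioCoeff [CharZero K] (a b : K) :
    IsExp (fun n : ℕ+ => (b ^ (n : ℕ) - a ^ (n : ℕ)) / n) (PowerSeries.mk (ratioCoeff a b)) := by
  refine ⟨by simp, ?_⟩
  set F := PowerSeries.mk (ratioCoeff a b) with hF
  set L := euler (genSeries fun n : ℕ+ => (b ^ (n : ℕ) - a ^ (n : ℕ)) / (n : K)) with hL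
  have hL' : (1 - C b * X) * (1 - C a * X) * L = (C b - C a) * X := by
    have h1 : L = PowerSeries.mk (fun k => b ^ k) - PowerSeries.mk (fun k => a ^ k) := by
      ext k
      rcases k with _ | k
      · simp [hL]
      · have : ((k : K) + 1) ≠ 0 := by exact_mod_cast Nat.succ_ne_zero k
        simp [hL, genSeries]
        field_simp
    have h2 : ∀ c : K, (1 - C c * X) * PowerSeries.mk (fun k => c ^ k) = 1 := by
      intro c
      ext k
      rcases k with _ | k
      · simp
      · rw [sub_mul, one_mul, mul_assoc, map_sub, coeff_C_mul, coeff_succ_X_mul]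
        simp [coeff_one, pow_succ, mul_comm]
    rw [h1]
    linear_combination (1 - C a * X) * h2 b - (1 - C b * X) * h2 a
  have h := one_sub_mul_mk_ratioCoeff a b
  rw [← hF] at h
  have hX : ∀ c : K, euler (1 - C c * X : PowerSeries K) = - (C c * X) := by
    intro c
    ext k
    rw [coeff_euler, map_sub, map_neg, coeff_C_mul, coeff_X, coeff_one]
    rcases k with _ | _ | k <;> simp
  have h' := congrArg euler h
  rw [euler_mul, hX, hX] at h'
  have hne : ∀ c : K, (1 - C c * X : PowerSeries K) ≠ 0 := by
    intro c hc
    simpa using congrArg (coeff 0) hc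
  apply mul_left_cancel₀ (mul_ne_zero (hne b) (hne a))
  linear_combination (1 - C a * X) * h' - F * hL' + C a * X * h

end Exponential

end HallLittlewood

namespace HallLittlewood

open Finset

/-! ### Shifts of polynomial rings and their Taylor expansion -/

section Shift

variable {K : Type*} [Field K] {σ : Type*}

/-- The substitution `x_i ↦ x_i + d_i z^{w_i}`. -/
noncomputable def shift (w : σ → ℕ+) (d : σ → K) :
    MvPolynomial σ K →ₐ[K] Polynomial (MvPolynomial σ K) :=
  MvPolynomial.aeval fun i =>
    Polynomial.C (MvPolynomial.X i) + Polynomial.monomial (w i) (MvPolynomial.C (d i))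

lemma shift_X (w : σ → ℕ+) (d : σ → K) (i : σ) :
    shift w d (MvPolynomial.X i) =
      Polynomial.C (MvPolynomial.X i) + Polynomial.monomial (w i) (MvPolynomial.C (d i)) := by
  simp [shift]

/-- The derivation `∑_{w_i = n} d_i ∂/∂x_i`. -/
noncomputable def dirDeriv (w : σ → ℕ+) (d : σ → K) (n : ℕ+) :
    Derivation K (MvPolynomial σ K) (MvPolynomial σ K) :=
  MvPolynomial.mkDerivation K fun i => if w i = n then MvPolynomial.C (d i) else 0

lemma dirDeriv_X (w : σ → ℕ+) (d : σ → K) (n : ℕ+) (i : σ) :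
    dirDeriv w d n (MvPolynomial.X i) = if w i = n then MvPolynomial.C (d i) else 0 := by
  simp [dirDeriv]

/-- `∑_{w_i = n} d_i ∂/∂x_i` as an endomorphism. -/
noncomputable def dirDerivEnd (w : σ → ℕ+) (d : σ → K) (n : ℕ+) :
    Module.End K (MvPolynomial σ K) :=
  (dirDeriv w d n).toLinearMap

@[simp] lemma dirDerivEnd_apply (w : σ → ℕ+) (d : σ → K) (n : ℕ+) (f : MvPolynomial σ K) :
    dirDerivEnd w d n f = dirDeriv w d n f := rfl

/-- The commutator is again a derivation, and it vanishes on the variables because each first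
derivative of a variable is a constant. -/
lemma commute_dirDerivEnd (w : σ → ℕ+) (d : σ → K) (m n : ℕ+) :
    Commute (dirDerivEnd w d m) (dirDerivEnd w d n) := by
  have h : ⁅dirDeriv w d m, dirDeriv w d n⁆ = 0 := by
    apply MvPolynomial.derivation_ext
    intro i
    rw [Derivation.commutator_apply, dirDeriv_X, dirDeriv_X]
    split_ifs <;> simp
  change _ = _
  refine LinearMap.ext fun f => ?_
  have h' := congrArg (fun D => D f) h
  simp only [Derivation.commutator_apply] at h'
  simpa [sub_eq_zero] using h'

section

open PowerSeries

variable [CharZero K]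

/-- In generating form this says E(z) x_i = (x_i + d_i z^{w_i}) E(z) for the exponential E(z) of the
derivations. It is the induction step of Taylor's formula. -/
lemma expSum_dirDeriv_X_mul (w : σ → ℕ+) (d : σ → K) (k : ℕ) (i : σ) (f : MvPolynomial σ K) :
    expSum K (dirDerivEnd w d) k (MvPolynomial.X i * f) =
      MvPolynomial.X i * expSum K (dirDerivEnd w d) k f +
        if (w i : ℕ) ≤ k then d i • expSum K (dirDerivEnd w d) (k - w i) f else 0 := by
  set E := PowerSeries.mk (expSum K (dirDerivEnd w d)) with hE
  obtain ⟨hE0, hE1⟩ := isExp_expSum (K := K) (commute_dirDerivEnd w d)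
  rw [← hE] at hE0 hE1
  set L := euler (genSeries (dirDerivEnd w d)) with hL
  set M : Module.End K (MvPolynomial σ K) := LinearMap.mulLeft K (MvPolynomial.X i) with hM
  set D : Module.End K (MvPolynomial σ K) := d i • 1 with hD
  -- The commutator of L with x_i is the scalar series w_i d_i z^{w_i}.
  have hcomm : L * C M = C M * L + (w i : ℕ) • (C D * X ^ (w i : ℕ)) := by
    ext1 k
    rw [map_add, map_nsmul, coeff_mul_C, coeff_C_mul, coeff_C_mul, coeff_X_pow, hL, coeff_euler]
    rcases k with _ | k
    · have : 0 ≠ (w i : ℕ) := (w i).pos.ne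
      simp [this]
    · have hk : coeff (k + 1) (genSeries (dirDerivEnd w d)) = dirDerivEnd w d k.succPNat := by
        simp only [genSeries, coeff_mk]
        rfl
      rw [hk]
      refine LinearMap.ext fun f => ?_
      simp only [Module.End.mul_apply, LinearMap.smul_apply, LinearMap.add_apply, hM, hD,
        LinearMap.mulLeft_apply, dirDerivEnd_apply, Derivation.leibniz, dirDeriv_X, smul_eq_mul,
        mul_smul_comm]
      rw [smul_add]
      congr 1
      by_cases h : w i = k.succPNat
      · have h' : k + 1 = (w i : ℕ) := by rw [h]; rfl
        simp [h, MvPolynomial.smul_eq_C_mul, mul_comm]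
      · have h' : k + 1 ≠ (w i : ℕ) := fun h' => h (PNat.coe_injective h'.symm)
        simp [h, h']
  -- Both sides solve the same first-order equation with the same constant term; `hcomm` makes the
  -- right side a solution.
  have key : E * C M = (C M + C D * X ^ (w i : ℕ)) * E := by
    refine eq_of_euler_eq K (a := dirDerivEnd w d) (B := 0) ?_ ?_ ?_
    · have : (w i : ℕ) ≠ 0 := (w i).pos.ne'
      rw [coeff_mul_C, add_mul, map_add, coeff_C_mul, hE0, mul_assoc, coeff_C_mul, coeff_X_pow_mul']
      simp
    · rw [euler_mul, hE1, ← hL, add_zero]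
      have : euler (C M) = 0 := by
        ext1 k
        rcases k with _ | k <;> simp [coeff_C]
      rw [this, mul_zero, add_zero, mul_assoc]
    · have h1 : euler (C M + C D * X ^ (w i : ℕ)) = (w i : ℕ) • (C D * X ^ (w i : ℕ)) := by
        ext1 k
        rw [coeff_euler, map_add, map_nsmul, coeff_C_mul, coeff_X_pow, coeff_C]
        rcases eq_or_ne k (w i : ℕ) with h | h
        · have : k ≠ 0 := by rw [h]; exact (w i).pos.ne'
          simp [h]
        · rcases eq_or_ne k 0 with rfl | h0
          · simp [h]
          · simp [h, h0]
      have h2 : L * (C D * X ^ (w i : ℕ)) = C D * X ^ (w i : ℕ) * L := by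
        have hDc : L * C D = C D * L := by
          ext1 k
          rw [coeff_mul_C, coeff_C_mul]
          simp [hD]
        rw [← mul_assoc, hDc, mul_assoc, mul_assoc]
        congr 1
        ext1 k
        rw [coeff_X_pow_mul', coeff_mul_X_pow']
      rw [euler_mul, h1, hE1, ← hL, add_zero, ← mul_assoc, ← mul_assoc, ← add_mul]
      congr 1
      rw [mul_add, hcomm, h2, add_mul]
      abel
  have := congrArg (fun P => (coeff k P) f) key
  simp only [coeff_mul_C, add_mul, map_add, mul_assoc, coeff_C_mul, coeff_X_pow_mul', hE,
    coeff_mk, Module.End.mul_apply, LinearMap.add_apply, hM, hD] at this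
  rw [LinearMap.mulLeft_apply] at this
  rw [this, LinearMap.mulLeft_apply]
  congr 1
  split_ifs <;> simp

/-- Taylor's formula: the exponential of the derivations is the shift. -/
lemma expSum_dirDeriv (w : σ → ℕ+) (d : σ → K) (k : ℕ) (f : MvPolynomial σ K) :
    expSum K (dirDerivEnd w d) k f = (shift w d f).coeff k := by
  induction f using MvPolynomial.induction_on generalizing k with
  | C c =>
    have hs : shift w d (MvPolynomial.C c) = Polynomial.C (MvPolynomial.C c) := by
      rw [← MvPolynomial.algebraMap_eq, AlgHom.commutes]; rfl
    rw [hs]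
    rcases k with _ | k
    · simp [expSum]
    · have hj : ∀ j, coeff j (genSeries (dirDerivEnd w d)) (MvPolynomial.C c) = 0 := by
        intro j
        rcases j with _ | j
        · simp
        · simp only [genSeries, coeff_mk, Nat.add_one_ne_zero, if_false, dirDerivEnd_apply]
          rw [← MvPolynomial.algebraMap_eq]
          exact Derivation.map_algebraMap _ c
      rw [Polynomial.coeff_C_succ, expSum, LinearMap.sum_apply]
      refine sum_eq_zero fun m _ => ?_
      rw [LinearMap.smul_apply]
      rcases m with _ | m
      · simp [coeff_one]
      · rw [pow_succ, coeff_mul, LinearMap.sum_apply, sum_eq_zero, smul_zero]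
        intro p _
        rw [Module.End.mul_apply, hj, map_zero]
  | add f g hf hg => simp [hf, hg]
  | mul_X f i hf =>
    rw [mul_comm, expSum_dirDeriv_X_mul, map_mul, shift_X, add_mul, Polynomial.coeff_add,
      Polynomial.coeff_C_mul, hf, ← Polynomial.C_mul_X_pow_eq_monomial, mul_assoc,
      Polynomial.coeff_C_mul, Polynomial.coeff_X_pow_mul']
    congr 1
    split_ifs
    · rw [hf, MvPolynomial.smul_eq_C_mul]
    · simp

end

end Shift

end HallLittlewood

namespace HallLittlewood

open Finset

/-! ### Vertex operators -/

section Vertex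

variable {A : Type*} [CommRing A]

/-- Extension of a sequence by zero to negative indices. -/
def zext (q : ℕ → A) : ℤ → A
  | Int.ofNat k => q k
  | Int.negSucc _ => 0

@[simp] lemma zext_natCast (q : ℕ → A) (k : ℕ) : zext q (k : ℤ) = q k := rfl

lemma zext_of_neg (q : ℕ → A) {n : ℤ} (h : n < 0) : zext q n = 0 := by
  rcases n with n | n
  · simp at h; omega
  · rfl

lemma map_zext {B F : Type*} [CommRing B] [FunLike F A B] [ZeroHomClass F A B] (φ : F)
    (q : ℕ → A) (n : ℤ) : φ (zext q n) = zext (fun k => φ (q k)) n := by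
  rcases n with n | n
  · rfl
  · exact map_zero φ

/-- `∑_j c_{m+j} P_j` for a polynomial `P = ∑_j P_j z^j`. -/
noncomputable def pairCoeff (c : ℤ → A) (m : ℤ) (P : Polynomial A) : A :=
  P.sum fun j a => c (m + j) * a

lemma pairCoeff_eq_sum (c : ℤ → A) (m : ℤ) {P : Polynomial A} {B : ℕ} (h : P.natDegree < B) :
    pairCoeff c m P = ∑ j ∈ range B, c (m + j) * P.coeff j :=
  Polynomial.sum_over_range' _ (fun _ => mul_zero _) _ h

lemma pairCoeff_add (c : ℤ → A) (m : ℤ) (P Q : Polynomial A) :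
    pairCoeff c m (P + Q) = pairCoeff c m P + pairCoeff c m Q :=
  Polynomial.sum_add_index _ _ _ (fun _ => mul_zero _) fun _ _ _ => mul_add _ _ _

@[simp] lemma pairCoeff_zero (c : ℤ → A) (m : ℤ) : pairCoeff c m 0 = 0 := by
  simp [pairCoeff]

lemma pairCoeff_sum (c : ℤ → A) (m : ℤ) {ι : Type*} (s : Finset ι) (P : ι → Polynomial A) :
    pairCoeff c m (∑ i ∈ s, P i) = ∑ i ∈ s, pairCoeff c m (P i) := by
  classical
  induction s using Finset.induction_on with
  | empty => simp
  | insert i s hi ih => rw [sum_insert hi, sum_insert hi, pairCoeff_add, ih]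

lemma pairCoeff_C_mul (c : ℤ → A) (m : ℤ) (a : A) (P : Polynomial A) :
    pairCoeff c m (Polynomial.C a * P) = a * pairCoeff c m P := by
  have h : (Polynomial.C a * P).natDegree < P.natDegree + 1 :=
    Nat.lt_succ_of_le (Polynomial.natDegree_C_mul_le a P)
  rw [pairCoeff_eq_sum c m h, pairCoeff_eq_sum c m (Nat.lt_succ_self _), mul_sum]
  refine sum_congr rfl fun j _ => ?_
  rw [Polynomial.coeff_C_mul]
  ring

lemma pairCoeff_X_pow_mul (c : ℤ → A) (m : ℤ) (n : ℕ) (P : Polynomial A) :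
    pairCoeff c m (Polynomial.X ^ n * P) = pairCoeff c (m + n) P := by
  induction P using Polynomial.induction_on' with
  | add P Q hP hQ => rw [mul_add, pairCoeff_add, pairCoeff_add, hP, hQ]
  | monomial k a =>
    rw [Polynomial.X_pow_mul_monomial]
    unfold pairCoeff
    rw [Polynomial.sum_monomial_index a (fun j a => c (m + j) * a) (mul_zero _),
      Polynomial.sum_monomial_index a (fun j a => c (m + n + j) * a) (mul_zero _)]
    push_cast
    ring_nf

lemma pairCoeff_map {B : Type*} [CommRing B] (φ : A →+* B) (c : ℤ → A) (m : ℤ)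
    (P : Polynomial A) :
    pairCoeff (fun n => φ (c n)) m (P.map φ) = φ (pairCoeff c m P) := by
  rw [pairCoeff_eq_sum (B := P.natDegree + 1) _ _ (Nat.lt_succ_of_le (Polynomial.natDegree_map_le)),
    pairCoeff_eq_sum c m (Nat.lt_succ_self _), map_sum]
  simp

end Vertex

/-! ### Modes of a vertex operator as finite sums -/

section Modes

variable {K : Type*} [Field K]

lemma expCoeff_eq_expSum (a : ℕ+ → Module.End K (Fock K)) (k : ℕ) :
    expCoeff a k = expSum K a k := by
  unfold expCoeff expSum genSeries
  congr 1
  funext m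
  congr 5
  funext n
  rcases n with _ | n <;> rfl

/-- If annihilation acts as a polynomial shift and creation as multiplication, only finitely many
pairs (k, j) contribute: j is bounded by the degree of the shifted vector and k = j - m. The
`finsum` is then a genuine finite sum. -/
lemma mode_eq_pairCoeff {al be : ℕ+ → Module.End K (Fock K)} {q : ℕ → Fock K}
    {T : Fock K → Polynomial (Fock K)} (hal : ∀ k f, expCoeff al k f = q k * f)
    (hbe : ∀ k f, expCoeff be k f = (T f).coeff k) (m : ℤ) (f : Fock K) :
    mode al be m f = pairCoeff (zext q) (-m) (T f) := by
  rw [pairCoeff_eq_sum _ _ (Nat.lt_succ_self _)]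
  set B := (T f).natDegree + 1 with hB
  have hsub : (Function.support fun kj : ℕ × ℕ => if (kj.2 : ℤ) - (kj.1 : ℤ) = m then
      expCoeff al kj.1 (expCoeff be kj.2 f) else 0) ⊆ ↑(range (B + m.natAbs) ×ˢ range B) := by
    rintro ⟨k, j⟩ hkj
    rw [Function.mem_support] at hkj
    dsimp only at hkj
    split_ifs at hkj with h
    · have hj : j < B := by
        by_contra hj
        apply hkj
        rw [hal, hbe, Polynomial.coeff_eq_zero_of_natDegree_lt (by omega), mul_zero]
      simp only [coe_product, Set.mem_prod, mem_coe, mem_range]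
      omega
    · exact absurd rfl hkj
  rw [mode, finsum_eq_sum_of_support_subset _ hsub, sum_product_right]
  refine sum_congr rfl fun j hj => ?_
  have hj := mem_range.1 hj
  by_cases hjm : 0 ≤ -m + (j : ℤ)
  · obtain ⟨k, hk⟩ := Int.eq_ofNat_of_zero_le hjm
    rw [hk, zext_natCast, sum_eq_single k]
    · rw [if_pos (by omega), hal, hbe]
    · intro k' _ hk'
      rw [if_neg (by omega)]
    · intro hk'
      rw [mem_range] at hk'
      omega
  · rw [zext_of_neg _ (by omega), zero_mul]
    refine sum_eq_zero fun k _ => ?_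
    rw [if_neg (by omega)]

end Modes

/-! ### The series `q(z)` and the Hall-Littlewood vertex operator -/

section Jing

variable {K : Type*} [Field K]

open MvPolynomial

/-- The coefficients of `q(z) = exp (∑ (1 - t^n)/n p_n z^n)`. -/
noncomputable def qf (t : K) (k : ℕ) : SymFun K :=
  expSum K (fun n : ℕ+ => C ((1 - t ^ (n : ℕ)) / (n : K)) * X n) k

/-- The coefficients of `exp (-∑ (1 - t^n)/n p_n z^n)`. -/
noncomputable def rf (t : K) (k : ℕ) : SymFun K := negP (qf t k)

/-- The translation `p_n ↦ p_n + s z^n`. -/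
noncomputable def translate (s : K) : SymFun K →ₐ[K] Polynomial (SymFun K) :=
  shift id fun _ => s

lemma translate_X (s : K) (n : ℕ+) : translate s (X n) =
    Polynomial.C (X n) + Polynomial.monomial (n : ℕ) (C s) := shift_X _ _ _

/-- The vertex operator mode `H_m`, the coefficient of `z^m` in
`H(z) = exp (∑ (1 - t^n)/n p_n z^n) exp (-∑ z^{-n} ∂/∂p_n)`. -/
noncomputable def jing (t : K) (m : ℤ) (f : SymFun K) : SymFun K :=
  pairCoeff (zext (qf t)) m (translate (-1) f)

/-- The conjugate of `H_{-k}` by `p_n ↦ -p_n`. -/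
noncomputable def jingAdj (t : K) (k : ℤ) (f : SymFun K) : SymFun K :=
  pairCoeff (zext (rf t)) (-k) (translate 1 f)

lemma negP_negP (f : SymFun K) : negP (negP f) = f := by
  have : (negP : SymFun K →ₐ[K] SymFun K).comp negP = AlgHom.id K _ := by
    apply MvPolynomial.algHom_ext
    intro i
    simp [negP]
  exact congrArg (fun φ : SymFun K →ₐ[K] SymFun K => φ f) this

lemma negP_X (n : ℕ+) : negP (X n : SymFun K) = -X n := by simp [negP]

lemma translate_negP (s : K) (f : SymFun K) :
    translate s (negP f) = (translate (-s) f).map (negP : SymFun K →ₐ[K] SymFun K).toRingHom := by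
  have : (translate s).comp negP =
      (Polynomial.mapAlgHom (negP : SymFun K →ₐ[K] SymFun K)).comp (translate (-s)) := by
    apply MvPolynomial.algHom_ext
    intro i
    simp [negP_X, translate_X]
    abel
  exact congrArg (fun φ : SymFun K →ₐ[K] Polynomial (SymFun K) => φ f) this

lemma jingAdj_eq (t : K) (k : ℤ) (f : SymFun K) :
    jingAdj t k f = negP (jing t (-k) (negP f)) := by
  have h := pairCoeff_map (negP : SymFun K →ₐ[K] SymFun K).toRingHom (zext (qf t)) (-k)
    (translate (-1) (negP f))
  rw [jing]
  change _ = (negP : SymFun K →ₐ[K] SymFun K).toRingHom _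
  rw [← h, ← translate_negP, negP_negP, jingAdj]
  congr 1
  funext n
  exact (map_zext (negP : SymFun K →ₐ[K] SymFun K).toRingHom (qf t) n).symm

variable [CharZero K]

lemma isExp_qf (t : K) : IsExp (fun n : ℕ+ => C ((1 - t ^ (n : ℕ)) / (n : K)) * X n)
    (PowerSeries.mk (qf t)) :=
  isExp_expSum (K := K) fun _ _ => Commute.all _ _

lemma isExp_map_qf (t : K) {B : Type*} [CommRing B] (φ : SymFun K →+* B) :
    IsExp (fun n : ℕ+ => φ (C ((1 - t ^ (n : ℕ)) / (n : K)) * X n))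
      (PowerSeries.mk fun k => φ (qf t k)) := by
  have := (isExp_qf t).map φ
  convert this using 1
  ext k; simp

@[simp] lemma qf_zero (t : K) : qf t 0 = 1 := by simpa using (isExp_qf t).1

/-- `q(z) exp (-∑ (1 - t^n)/n p_n z^n) = 1`. -/
lemma sum_qf_mul_rf (t : K) (k : ℕ) :
    ∑ p ∈ antidiagonal k, qf t p.1 * rf t p.2 = if k = 0 then 1 else 0 := by
  have h := (isExp_qf t).mul (isExp_map_qf t (negP : SymFun K →ₐ[K] SymFun K).toRingHom)
  rw [show ((fun n : ℕ+ => C ((1 - t ^ (n : ℕ)) / (n : K)) * X n) + fun n : ℕ+ =>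
      (negP : SymFun K →ₐ[K] SymFun K).toRingHom (C ((1 - t ^ (n : ℕ)) / (n : K)) * X n)) = 0 by
    funext n
    simp [negP]] at h
  have := congrArg (PowerSeries.coeff k) ((isExp_zero_iff K).1 h)
  rw [PowerSeries.coeff_mul, PowerSeries.coeff_one] at this
  simpa [rf] using this

/-- The effect of the translation `p_n ↦ p_n + s z^n` on `q(z)`. -/
lemma translate_qf (t s a b : K)
    (hs : ∀ n : ℕ+, (1 - t ^ (n : ℕ)) * s = b ^ (n : ℕ) - a ^ (n : ℕ)) (k : ℕ) :
    translate s (qf t k) = ∑ p ∈ antidiagonal k,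
      Polynomial.C (C (ratioCoeff a b p.1) * qf t p.2) * Polynomial.X ^ p.1 := by
  have h1 := isExp_map_qf t (translate s).toRingHom
  have h2 := ((isExp_ratioCoeff a b).map ((Polynomial.C : SymFun K →+* _).comp C)).rescale
    Polynomial.X
  have h3 := h2.mul (isExp_map_qf t (Polynomial.C : SymFun K →+* _))
  have h4 : (fun n : ℕ+ => (translate s).toRingHom (C ((1 - t ^ (n : ℕ)) / (n : K)) * X n)) =
      (fun n : ℕ+ => Polynomial.X ^ (n : ℕ) * ((Polynomial.C : SymFun K →+* _).comp C)
        ((b ^ (n : ℕ) - a ^ (n : ℕ)) / n)) + fun n : ℕ+ =>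
        (Polynomial.C : SymFun K →+* _) (C ((1 - t ^ (n : ℕ)) / (n : K)) * X n) := by
    funext n
    have hC : ∀ c : K, translate s (C c) = Polynomial.C (C c) := fun c => (translate s).commutes c
    simp only [AlgHom.toRingHom_eq_coe, RingHom.coe_coe, map_mul, translate_X, hC, Pi.add_apply,
      RingHom.comp_apply, ← hs n, ← Polynomial.C_mul_X_pow_eq_monomial, mul_div_right_comm]
    ring
  rw [h4] at h1
  have h := congrArg (PowerSeries.coeff k) (h1.unique K h3)
  rw [PowerSeries.coeff_mul, PowerSeries.coeff_mk] at h
  refine h.trans (sum_congr rfl fun p _ => ?_)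
  simp only [PowerSeries.coeff_rescale, PowerSeries.coeff_map, PowerSeries.coeff_mk,
    RingHom.comp_apply, map_mul]
  ring

end Jing

end HallLittlewood

namespace HallLittlewood

open Finset MvPolynomial

/-! ### The bilinear form -/

section Form

variable {K : Type*} [Field K]

/-- The squared norm of the monomial `p_λ` for `⟨-,-⟩_{0,t}`. -/
noncomputable def psumNorm (t : K) (m : ℕ+ →₀ ℕ) : K :=
  m.prod fun i k => (i : K) ^ k * (k.factorial : K) *
    ((1 - 0 ^ (i : ℕ)) / (1 - t ^ (i : ℕ))) ^ k

lemma innerQT_eq_sum (t : K) (f g : SymFun K) {s : Finset (ℕ+ →₀ ℕ)} (hs : f.support ⊆ s) :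
    innerQT 0 t f g = ∑ m ∈ s, f.coeff m * g.coeff m * psumNorm t m := by
  refine sum_subset hs fun m _ hm => ?_
  rw [notMem_support_iff.1 hm, zero_mul, zero_mul]

/-- The form `⟨-,-⟩_{0,t}` as a bilinear map. -/
noncomputable def form (t : K) : SymFun K →ₗ[K] SymFun K →ₗ[K] K :=
  LinearMap.mk₂ K (innerQT 0 t)
    (fun f f' g => by
      classical
      rw [innerQT_eq_sum t f g (subset_union_left (s₂ := f'.support)),
        innerQT_eq_sum t f' g (subset_union_right (s₁ := f.support)),
        innerQT_eq_sum t (f + f') g support_add, ← sum_add_distrib]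
      refine sum_congr rfl fun m _ => ?_
      rw [coeff_add]; ring)
    (fun c f g => by
      rw [innerQT_eq_sum t (c • f) g support_smul, innerQT_eq_sum t f g subset_rfl, smul_eq_mul,
        mul_sum]
      refine sum_congr rfl fun m _ => ?_
      rw [coeff_smul, smul_eq_mul]; ring)
    (fun f g g' => by
      simp only [innerQT_eq_sum t f _ subset_rfl, ← sum_add_distrib]
      refine sum_congr rfl fun m _ => ?_
      rw [coeff_add]; ring)
    (fun c f g => by
      simp only [innerQT_eq_sum t f _ subset_rfl, smul_eq_mul, mul_sum]
      refine sum_congr rfl fun m _ => ?_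
      rw [coeff_smul, smul_eq_mul]; ring)

lemma innerQT_eq_form (t : K) (f g : SymFun K) : innerQT 0 t f g = form t f g := rfl

lemma form_symm (t : K) (f g : SymFun K) : form t f g = form t g f := by
  classical
  rw [← innerQT_eq_form, ← innerQT_eq_form,
    innerQT_eq_sum t f g (subset_union_left (s₂ := g.support)),
    innerQT_eq_sum t g f (subset_union_right (s₁ := f.support))]
  refine sum_congr rfl fun m _ => ?_
  ring

lemma form_monomial (t : K) (m : ℕ+ →₀ ℕ) (c : K) (g : SymFun K) :
    form t (monomial m c) g = c * g.coeff m * psumNorm t m := by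
  classical
  rw [← innerQT_eq_form, innerQT_eq_sum t _ g (support_monomial_subset), sum_singleton,
    coeff_monomial, if_pos rfl]

lemma form_C (t c : K) (g : SymFun K) : form t (C c) g = c * constantCoeff g := by
  rw [C_apply, form_monomial, constantCoeff_eq]
  simp [psumNorm]

lemma form_one (t : K) (g : SymFun K) : form t 1 g = constantCoeff g := by
  rw [← C_1, form_C, one_mul]

/-- The ratio of consecutive norms is what makes multiplication by p_n adjoint to a multiple of
∂/∂p_n in `form_X_mul`. -/
lemma psumNorm_add_single (t : K) (m : ℕ+ →₀ ℕ) (n : ℕ+) :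
    psumNorm t (m + Finsupp.single n 1) =
      psumNorm t m * ((n : K) / (1 - t ^ (n : ℕ)) * (m n + 1)) := by
  classical
  set h : ℕ+ → ℕ → K := fun i k => (i : K) ^ k * (k.factorial : K) *
    ((1 - 0 ^ (i : ℕ)) / (1 - t ^ (i : ℕ))) ^ k with hh
  have h0 : ∀ i, h i 0 = 1 := fun i => by simp [hh]
  have hn : h n (m n + 1) = h n (m n) * ((n : K) / (1 - t ^ (n : ℕ)) * (m n + 1)) := by
    simp only [hh, pow_succ, Nat.factorial_succ, zero_pow n.pos.ne']
    push_cast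
    ring
  have e1 := Finsupp.mul_prod_erase' m n h h0
  have e2 := Finsupp.mul_prod_erase' (m + Finsupp.single n 1) n h h0
  have e3 : Finsupp.erase n (m + Finsupp.single n 1) = Finsupp.erase n m := by
    ext i
    rcases eq_or_ne i n with rfl | hi
    · simp
    · simp [Finsupp.erase_ne hi]
  rw [e3, Finsupp.add_apply, Finsupp.single_eq_same, hn] at e2
  change Finsupp.prod _ h = Finsupp.prod _ h * _
  rw [← e1, ← e2]
  ring

lemma coeff_pderiv_eq (m : ℕ+ →₀ ℕ) (n : ℕ+) (g : SymFun K) :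
    (pderiv n g).coeff m = (m n + 1) * g.coeff (m + Finsupp.single n 1) := by
  classical
  induction g using MvPolynomial.induction_on' with
  | monomial u a =>
    rw [pderiv_monomial, coeff_monomial, coeff_monomial]
    by_cases hu : u = m + Finsupp.single n 1
    · subst hu
      simp [mul_comm]
    · rw [if_neg hu, mul_zero]
      split_ifs with h
      · have : u n = 0 := by
          by_contra h0
          apply hu
          rw [← h, tsub_add_cancel_of_le]
          rw [Finsupp.single_le_iff]
          omega
        simp [this]
      · rfl
  | add p q hp hq => rw [map_add, coeff_add, coeff_add, hp, hq]; ring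

lemma form_X_mul (t : K) (n : ℕ+) (f g : SymFun K) :
    form t (X n * f) g = (n : K) / (1 - t ^ (n : ℕ)) * form t f (pderiv n g) := by
  induction f using MvPolynomial.induction_on' with
  | monomial m a =>
    rw [mul_comm, ← pow_one (X n), ← monomial_add_single, form_monomial, form_monomial,
      psumNorm_add_single, coeff_pderiv_eq]
    ring
  | add p q hp hq =>
    rw [mul_add, map_add, map_add, LinearMap.add_apply, LinearMap.add_apply, hp, hq, mul_add]

lemma pderiv_negP (n : ℕ+) (g : SymFun K) : pderiv n (negP g) = -negP (pderiv n g) := by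
  induction g using MvPolynomial.induction_on with
  | C a =>
    have h : negP (C a : SymFun K) = C a := (negP : SymFun K →ₐ[K] SymFun K).commutes a
    rw [h]; simp
  | add p q hp hq => simp only [map_add, hp, hq, neg_add]
  | mul_X p i hp =>
    rw [map_mul, negP_X, Derivation.leibniz, Derivation.leibniz, hp]
    simp only [map_neg, pderiv_X, smul_eq_mul, map_add, map_mul, negP_X]
    by_cases h : n = i
    · subst h; simp; ring
    · simp [Ne.symm h]

/-- On monomials the substitution is multiplication by a sign, so it is self-adjoint. The induction
uses that it anticommutes with both p_n and ∂/∂p_n. -/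
lemma form_negP (t : K) (f g : SymFun K) : form t (negP f) g = form t f (negP g) := by
  induction f using MvPolynomial.induction_on generalizing g with
  | C a =>
    have h : negP (C a : SymFun K) = C a := (negP : SymFun K →ₐ[K] SymFun K).commutes a
    have h' : constantCoeff (negP g) = constantCoeff g := by
      have : (aeval fun n : ℕ+ => (0 : K)).comp (negP : SymFun K →ₐ[K] SymFun K) =
          aeval fun n : ℕ+ => (0 : K) := by
        apply MvPolynomial.algHom_ext
        intro i
        simp [negP_X]
      have := congrArg (fun φ : SymFun K →ₐ[K] K => φ g) this
      simpa [MvPolynomial.aeval_zero'] using this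
    rw [h, form_C, form_C, h']
  | add p q hp hq => simp only [map_add, LinearMap.add_apply, hp, hq]
  | mul_X p i hp =>
    rw [map_mul, negP_X, mul_comm p, mul_neg, mul_comm _ (X i), map_neg, LinearMap.neg_apply,
      form_X_mul, form_X_mul, hp, pderiv_negP, map_neg]
    ring

end Form

/-! ### Adjoints -/

section Adjoint

variable {K : Type*} [Field K]

/-- Taking adjoints reverses products, but every factor in a power is a coefficient of one and the
same series. Reversal therefore only permutes the summands, and no commutativity is needed. -/
lemma expSum_adjoint {V : Type*} [AddCommGroup V] [Module K V] (B : V →ₗ[K] V →ₗ[K] K)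
    {a a' : ℕ+ → Module.End K V} (h : ∀ n f g, B (a n f) g = B f (a' n g)) (k : ℕ) (f g : V) :
    B (expSum K a k f) g = B f (expSum K a' k g) := by
  have h1 : ∀ i f g, B (PowerSeries.coeff i (genSeries a) f) g =
      B f (PowerSeries.coeff i (genSeries a') g) := by
    intro i f g
    simp only [genSeries, PowerSeries.coeff_mk]
    split_ifs
    · simp
    · exact h _ _ _
  have h2 : ∀ (m k : ℕ) (f g : V), B (PowerSeries.coeff k (genSeries a ^ m) f : V) g =
      B f (PowerSeries.coeff k (genSeries a' ^ m) g) := by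
    intro m
    induction m with
    | zero =>
      intro k f g
      rcases k with _ | k <;> simp [PowerSeries.coeff_one]
    | succ m ih =>
      intro k f g
      rw [pow_succ', pow_succ, PowerSeries.coeff_mul, PowerSeries.coeff_mul,
        ← Finset.Nat.sum_antidiagonal_swap (n := k)]
      simp only [LinearMap.sum_apply, map_sum, Module.End.mul_apply]
      refine sum_congr rfl fun p _ => ?_
      rw [h1, ih]
      rfl
  simp only [expSum, LinearMap.sum_apply, map_sum, LinearMap.smul_apply, map_smul, h2]

variable [CharZero K] {t : K} (hroot : ∀ n : ℕ, 1 ≤ n → t ^ n ≠ 1)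

lemma expSum_mulLeft {A : Type*} [CommRing A] [Algebra K A] (a : ℕ+ → A) (k : ℕ) :
    expSum K (fun n => LinearMap.mulLeft K (a n)) k = LinearMap.mulLeft K (expSum K a k) := by
  have h := (isExp_expSum (K := K) (a := a) fun _ _ => Commute.all _ _).map
    (Algebra.lmul K A).toRingHom
  have h' := isExp_expSum (K := K) (a := fun n => LinearMap.mulLeft K (a n)) fun i j => by
    change _ = _
    refine LinearMap.ext fun f => ?_
    simp only [Module.End.mul_apply, LinearMap.mulLeft_apply]
    ring
  have := congrArg (PowerSeries.coeff k) (h'.unique K h)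
  simp only [PowerSeries.coeff_map, PowerSeries.coeff_mk] at this
  exact this

include hroot in
-- The adjoint of (1-t^n)/n p_n is exactly ∂/∂p_n; exponentiating turns it into the translation p_n
-- ↦ p_n + z^n. The root of unity hypothesis cancels 1-t^n.
lemma form_qf_mul (k : ℕ) (f g : SymFun K) :
    form t (qf t k * f) g = form t f ((translate 1 g).coeff k) := by
  have h1 : qf t k * f = expSum K (fun n : ℕ+ => LinearMap.mulLeft K
      (C ((1 - t ^ (n : ℕ)) / (n : K)) * X n : SymFun K)) k f := by
    rw [expSum_mulLeft]; rfl
  rw [h1, translate, ← expSum_dirDeriv]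
  refine expSum_adjoint _ (fun n f g => ?_) k f g
  rw [LinearMap.mulLeft_apply, mul_assoc, ← smul_eq_C_mul, map_smul, LinearMap.smul_apply,
    form_X_mul, smul_eq_mul, ← mul_assoc]
  have hn : (n : K) ≠ 0 := by exact_mod_cast n.pos.ne'
  have ht : 1 - t ^ (n : ℕ) ≠ 0 := sub_ne_zero.2 (hroot n n.pos).symm
  have hd : dirDeriv id (fun _ : ℕ+ => (1 : K)) n = pderiv n := by
    apply MvPolynomial.derivation_ext
    intro i
    rw [dirDeriv_X, pderiv_X, Pi.single_apply]
    simp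
  rw [div_mul_div_cancel₀ hn, div_self ht, one_mul, dirDerivEnd_apply, hd]

include hroot in
lemma form_rf_mul (k : ℕ) (f g : SymFun K) :
    form t (rf t k * f) g = form t f ((translate (-1) g).coeff k) := by
  have h : rf t k * f = negP (qf t k * negP f) := by rw [map_mul, negP_negP, rf]
  rw [h, form_negP, form_qf_mul hroot, form_negP, translate_negP, Polynomial.coeff_map]
  congr 1
  exact negP_negP _

include hroot in
-- Both factors of H(z) are replaced by their adjoints in reverse order. The two sides become the
-- same double sum over pairs (i, j) with i = m + j.
lemma form_jing (m : ℤ) (f g : SymFun K) : form t (jing t m f) g = form t f (jingAdj t m g) := by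
  set N := (translate 1 g).natDegree + 1 with hN
  -- The bound also covers every j = i - m with i < N, so that the two index rectangles match.
  set B := (translate (-1) f).natDegree + 1 + N + m.natAbs with hB
  rw [jing, jingAdj, pairCoeff_eq_sum (B := B) _ _ (by omega),
    pairCoeff_eq_sum (B := N) _ _ (by omega), map_sum, LinearMap.sum_apply, map_sum]
  have h1 : ∀ j : ℕ, form t (zext (qf t) (m + j) * (translate (-1) f).coeff j) g =
      ∑ i ∈ range N, if (i : ℤ) = m + j then
        form t ((translate (-1) f).coeff j) ((translate 1 g).coeff i) else 0 := by
    intro j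
    by_cases h : 0 ≤ m + (j : ℤ)
    · obtain ⟨n, hn⟩ := Int.eq_ofNat_of_zero_le h
      rw [hn, zext_natCast, form_qf_mul hroot]
      simp only [Nat.cast_inj, sum_ite_eq', mem_range]
      split_ifs with h'
      · rfl
      · rw [Polynomial.coeff_eq_zero_of_natDegree_lt (p := translate 1 g) (by omega), map_zero]
    · rw [zext_of_neg _ (by omega), zero_mul, map_zero, LinearMap.zero_apply, sum_eq_zero]
      intro i _
      rw [if_neg (by omega)]
  have h2 : ∀ i ∈ range N, form t f (zext (rf t) (-m + i) * (translate 1 g).coeff i) =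
      ∑ j ∈ range B, if (i : ℤ) = m + j then
        form t ((translate (-1) f).coeff j) ((translate 1 g).coeff i) else 0 := by
    intro i hi
    have hi := mem_range.1 hi
    by_cases h : 0 ≤ -m + (i : ℤ)
    · obtain ⟨n, hn⟩ := Int.eq_ofNat_of_zero_le h
      rw [hn, zext_natCast, form_symm, form_rf_mul hroot, form_symm]
      have : ∀ j : ℕ, (i : ℤ) = m + j ↔ j = n := by intro j; omega
      simp only [this, sum_ite_eq', mem_range]
      rw [if_pos (by omega)]
    · rw [zext_of_neg _ (by omega), zero_mul, map_zero, sum_eq_zero]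
      intro j _
      rw [if_neg (by omega)]
  rw [sum_congr rfl fun j _ => h1 j, sum_congr rfl h2, sum_comm]

end Adjoint

end HallLittlewood

namespace HallLittlewood

open Finset MvPolynomial

/-! ### Commutation relations of the vertex operators -/

section Relations

variable {K : Type*} [Field K]

lemma commute_expSum {A : Type*} [Ring A] [Algebra K A] {x : A} {a : ℕ+ → A}
    (h : ∀ i, Commute x (a i)) (k : ℕ) : Commute x (expSum K a k) := by
  have h1 : ∀ m k, Commute x (PowerSeries.coeff k (genSeries a ^ m)) := by
    intro m
    induction m with
    | zero => intro k; rcases k with _ | k <;> simp [PowerSeries.coeff_one]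
    | succ m ih =>
      intro k
      rw [pow_succ, PowerSeries.coeff_mul]
      refine Commute.sum_right _ _ _ fun p _ => (ih _).mul_right ?_
      simp only [genSeries, PowerSeries.coeff_mk]
      split_ifs <;> simp [h]
  exact Commute.sum_right _ _ _ fun m _ => (h1 m k).smul_right _

lemma jingAdj_sum (t : K) (k : ℤ) {ι : Type*} (s : Finset ι) (f : ι → SymFun K) :
    jingAdj t k (∑ i ∈ s, f i) = ∑ i ∈ s, jingAdj t k (f i) := by
  rw [jingAdj, map_sum, pairCoeff_sum]; rfl

@[simp] lemma jingAdj_zero (t : K) (k : ℤ) : jingAdj t k 0 = 0 := by simp [jingAdj]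

@[simp] lemma jing_zero (t : K) (m : ℤ) : jing t m 0 = 0 := by simp [jing]

lemma jing_smul (t : K) (m : ℤ) (c : K) (f : SymFun K) : jing t m (c • f) = c • jing t m f := by
  have h : translate (-1) (c • f) = Polynomial.C (C c) * translate (-1) f := by
    rw [smul_eq_C_mul, map_mul]
    congr 1
    exact (translate (-1 : K)).commutes c
  rw [jing, h, pairCoeff_C_mul, ← smul_eq_C_mul, jing]

lemma jing_add (t : K) (m : ℤ) (f g : SymFun K) :
    jing t m (f + g) = jing t m f + jing t m g := by
  rw [jing, map_add, pairCoeff_add]; rfl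

lemma jingAdj_eq_zero (t : K) {k : ℤ} {f : SymFun K} (h : ((translate 1 f).natDegree : ℤ) < k) :
    jingAdj t k f = 0 := by
  rw [jingAdj, pairCoeff_eq_sum _ _ (Nat.lt_succ_self _)]
  refine sum_eq_zero fun j hj => ?_
  rw [mem_range] at hj
  rw [zext_of_neg _ (by omega), zero_mul]

/-- The translations by -z^n and z^n compose to the identity; this compares the coefficients of z^n.
-/
lemma sum_translate_translate (f : SymFun K) (n : ℕ) :
    ∑ p ∈ antidiagonal n, (translate 1 ((translate (-1) f).coeff p.1)).coeff p.2 =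
      if n = 0 then f else 0 := by
  set Φ : Polynomial (SymFun K) →+* Polynomial (SymFun K) :=
    Polynomial.eval₂RingHom (translate (1 : K)).toRingHom Polynomial.X with hΦ
  have h : Φ.comp (translate (-1 : K)).toRingHom = Polynomial.C := by
    apply MvPolynomial.ringHom_ext
    · intro c
      have hC : ∀ s c : K, translate s (C c) = Polynomial.C (C c) :=
        fun s c => (translate s).commutes c
      simp [hΦ, hC]
    · intro i
      simp [hΦ, translate_X, Polynomial.eval₂_monomial]
      rw [← Polynomial.C_mul_X_pow_eq_monomial]
      simp
  have h1 := congrArg (fun φ : SymFun K →+* Polynomial (SymFun K) => (φ f).coeff n) h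
  simp only [RingHom.comp_apply, hΦ, Polynomial.coe_eval₂RingHom, Polynomial.coeff_C,
    AlgHom.toRingHom_eq_coe, RingHom.coe_coe] at h1
  rw [← h1, Polynomial.eval₂_eq_sum_range' _ (n := (translate (-1) f).natDegree + 1 + (n + 1))
    (by omega), Polynomial.finsetSum_coeff, Finset.Nat.sum_antidiagonal_eq_sum_range_succ_mk]
  rw [← sum_subset (range_subset_range.2 (show n + 1 ≤
    (translate (-1) f).natDegree + 1 + (n + 1) by omega))]
  · refine sum_congr rfl fun i hi => ?_
    rw [mem_range] at hi
    rw [Polynomial.coeff_mul_X_pow', if_pos (by omega)]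
    rfl
  · intro i _ hi
    rw [mem_range] at hi
    rw [Polynomial.coeff_mul_X_pow', if_neg (by omega)]

/-- The normally ordered product of `H_m` and the adjoint of `H_k`. -/
noncomputable def normOrd (t : K) (k m : ℤ) (f : SymFun K) : SymFun K :=
  ∑ i ∈ range ((translate (-1) f).natDegree + 1),
    zext (qf t) (m + i) * jingAdj t k ((translate (-1) f).coeff i)

lemma normOrd_eq_sum (t : K) (k m : ℤ) (f : SymFun K) {B : ℕ}
    (hB : (translate (-1) f).natDegree < B) :
    normOrd t k m f = ∑ i ∈ range B,
      zext (qf t) (m + i) * jingAdj t k ((translate (-1) f).coeff i) := by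
  refine sum_subset (range_subset_range.2 hB) fun i _ hi => ?_
  rw [mem_range] at hi
  rw [Polynomial.coeff_eq_zero_of_natDegree_lt (by omega), jingAdj_zero, mul_zero]

/-- A common bound for the degrees of all `D⁺_j D⁻_i f`. -/
lemma exists_natDegree_translate_lt (f : SymFun K) :
    ∃ B : ℕ, (translate (-1) f).natDegree < B ∧
      ∀ i, (translate 1 ((translate (-1) f).coeff i)).natDegree < B := by
  set d := (translate (-1) f).natDegree
  refine ⟨d + 1 + ∑ i ∈ range (d + 1), (translate 1 ((translate (-1) f).coeff i)).natDegree,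
    by omega, fun i => ?_⟩
  by_cases hi : i < d + 1
  · have := single_le_sum (f := fun i =>
      (translate 1 ((translate (-1) f).coeff i)).natDegree) (fun _ _ => Nat.zero_le _)
      (mem_range.2 hi)
    omega
  · rw [Polynomial.coeff_eq_zero_of_natDegree_lt (p := translate (-1) f) (by omega)]
    simp

lemma normOrd_eq_zero (t : K) (f : SymFun K) :
    ∃ B : ℕ, ∀ k m : ℤ, (B : ℤ) ≤ k → normOrd t k m f = 0 := by
  obtain ⟨B, hB1, hB2⟩ := exists_natDegree_translate_lt f
  refine ⟨B, fun k m hk => sum_eq_zero fun i _ => ?_⟩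
  have := hB2 i
  rw [jingAdj_eq_zero t (by omega), mul_zero]

variable [CharZero K]

/-- Translation coefficients are exponentials of constant-coefficient derivations, all of which
commute. -/
lemma translate_coeff_comm (s s' : K) (i j : ℕ) (f : SymFun K) :
    (translate s ((translate s' f).coeff i)).coeff j =
      (translate s' ((translate s f).coeff j)).coeff i := by
  simp only [translate, ← expSum_dirDeriv]
  have h : ∀ m n, Commute (dirDerivEnd id (fun _ : ℕ+ => s) m)
      (dirDerivEnd id (fun _ : ℕ+ => s') n) := by
    intro m n
    have hs : ∀ s n, dirDerivEnd id (fun _ : ℕ+ => s) n =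
        s • dirDerivEnd id (fun _ : ℕ+ => (1 : K)) n := by
      intro s n
      have : dirDeriv id (fun _ : ℕ+ => s) n = s • dirDeriv id (fun _ : ℕ+ => (1 : K)) n := by
        apply MvPolynomial.derivation_ext
        intro i
        rw [Derivation.smul_apply, dirDeriv_X, dirDeriv_X]
        split_ifs <;> simp [smul_eq_C_mul]
      refine LinearMap.ext fun f => ?_
      rw [dirDerivEnd_apply, this]
      rfl
    rw [hs s, hs s']
    exact ((commute_dirDerivEnd _ _ m n).smul_left s).smul_right s'
  have h2 := commute_expSum (K := K) (fun n => (commute_expSum (K := K) (h n) i).symm) j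
  exact (congrArg (fun φ : Module.End K (SymFun K) => φ f) h2.eq).symm

lemma coeff_translate_qf (t : K) (n : ℤ) (a : ℕ) :
    (translate 1 (zext (qf t) n)).coeff a = C (ratioCoeff t 1 a) * zext (qf t) (n - a) := by
  rcases lt_or_ge n 0 with hn | hn
  · rw [zext_of_neg _ hn, zext_of_neg _ (by omega)]; simp
  · obtain ⟨k, rfl⟩ := Int.eq_ofNat_of_zero_le hn
    rw [zext_natCast, translate_qf t 1 t 1 (by simp), Polynomial.finsetSum_coeff]
    simp only [Polynomial.coeff_C_mul_X_pow]
    rw [Finset.Nat.sum_antidiagonal_eq_sum_range_succ_mk]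
    simp only [sum_ite_eq, mem_range]
    split_ifs with h
    · rw [show (k : ℤ) - a = ((k - a : ℕ) : ℤ) by omega, zext_natCast]
    · rw [zext_of_neg _ (by omega), mul_zero]

lemma coeff_translate_rf (t : K) (n : ℤ) (a : ℕ) :
    (translate (-1) (zext (rf t) n)).coeff a = C (ratioCoeff t 1 a) * zext (rf t) (n - a) := by
  have h : ∀ n, zext (rf t) n = negP (zext (qf t) n) := fun n => (map_zext negP (qf t) n).symm
  rw [h, translate_negP, neg_neg, Polynomial.coeff_map, coeff_translate_qf, h]
  change negP _ = _
  rw [map_mul]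
  congr 1
  exact (negP : SymFun K →ₐ[K] SymFun K).commutes _

/-- Translation by z^n multiplies the series q by (1-tx)/(1-x), so moving q_n out of the adjoint
costs exactly the coefficients of this ratio. -/
lemma jingAdj_qf_mul (t : K) (k n : ℤ) (g : SymFun K) {A : ℕ} (hA : n < A) :
    jingAdj t k (zext (qf t) n * g) =
      ∑ a ∈ range A, C (ratioCoeff t 1 a) * (zext (qf t) (n - a) * jingAdj t (k - a) g) := by
  have hd : translate 1 (zext (qf t) n) =
      ∑ a ∈ range A, Polynomial.C (C (ratioCoeff t 1 a) * zext (qf t) (n - a)) *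
        Polynomial.X ^ a := by
    ext1 b
    rw [coeff_translate_qf, Polynomial.finsetSum_coeff]
    simp only [Polynomial.coeff_C_mul_X_pow, sum_ite_eq, mem_range]
    split_ifs with h
    · rfl
    · rw [zext_of_neg _ (by omega), mul_zero]
  rw [jingAdj, map_mul, hd, sum_mul, pairCoeff_sum]
  refine sum_congr rfl fun a _ => ?_
  rw [mul_assoc, pairCoeff_C_mul, pairCoeff_X_pow_mul, mul_assoc, jingAdj]
  congr 3
  ring

lemma coeff_translate_jingAdj (t : K) (k : ℤ) (f : SymFun K) (i : ℕ) :
    (translate (-1) (jingAdj t k f)).coeff i = ∑ p ∈ antidiagonal i,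
      C (ratioCoeff t 1 p.1) * jingAdj t (k + p.1) ((translate (-1) f).coeff p.2) := by
  set J := (translate 1 f).natDegree + 1 +
    ∑ p ∈ antidiagonal i, (translate 1 ((translate (-1) f).coeff p.2)).natDegree with hJ
  have hJ' : ∀ p ∈ antidiagonal i, (translate 1 ((translate (-1) f).coeff p.2)).natDegree < J := by
    intro p hp
    have := single_le_sum (f := fun p : ℕ × ℕ =>
      (translate 1 ((translate (-1) f).coeff p.2)).natDegree) (fun _ _ => Nat.zero_le _) hp
    omega
  rw [jingAdj, pairCoeff_eq_sum (B := J) _ _ (by omega), map_sum, Polynomial.finsetSum_coeff]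
  simp only [map_mul, Polynomial.coeff_mul, coeff_translate_rf]
  rw [sum_comm]
  refine sum_congr rfl fun p hp => ?_
  rw [jingAdj, pairCoeff_eq_sum _ _ (hJ' p hp), mul_sum]
  refine sum_congr rfl fun j _ => ?_
  rw [mul_assoc, translate_coeff_comm]
  congr 3
  ring

open Filter

/-- Normal ordering in this order expands (1-tx)/(1-x) with both mode indices lowered by a. The sum
is finite since q_n vanishes for n < 0, hence "for all large A". -/
lemma jingAdj_jing (t : K) (k m : ℤ) (f : SymFun K) :
    ∀ᶠ A : ℕ in atTop, jingAdj t k (jing t m f) =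
      ∑ a ∈ range A, C (ratioCoeff t 1 a) * normOrd t (k - a) (m - a) f := by
  set B := (translate (-1) f).natDegree + 1 with hB
  filter_upwards [eventually_ge_atTop (B + m.natAbs)] with A hA
  rw [jing, pairCoeff_eq_sum (B := B) _ _ (by omega), jingAdj_sum]
  rw [sum_congr rfl fun (i : ℕ) hi => jingAdj_qf_mul t k (m + i) _ (A := A)
    (by rw [mem_range] at hi; omega), sum_comm]
  refine sum_congr rfl fun a _ => ?_
  rw [← mul_sum, normOrd]
  congr 1
  refine sum_congr rfl fun i _ => ?_
  congr 2
  ring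

/-- A sum over all antidiagonals below `I` of a function supported in a small rectangle. -/
lemma sum_range_antidiagonal {M : Type*} [AddCommMonoid M] {A B I : ℕ} (hI : A + B ≤ I)
    (F : ℕ × ℕ → M) (h1 : ∀ b c, A ≤ b → F (b, c) = 0) (h2 : ∀ b c, B ≤ c → F (b, c) = 0) :
    ∑ i ∈ range I, ∑ p ∈ antidiagonal i, F p = ∑ b ∈ range A, ∑ c ∈ range B, F (b, c) := by
  rw [← sum_product (range A) (range B) F, ← sum_fiberwise_of_maps_to (t := range I)
    (g := fun p : ℕ × ℕ => p.1 + p.2)]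
  · refine sum_congr rfl fun i _ => (sum_subset ?_ ?_).symm
    · intro p hp
      simpa using (mem_filter.1 hp).2
    · rintro ⟨b, c⟩ hp hp'
      simp only [mem_filter, mem_product, mem_range, not_and] at hp' hp
      by_cases hb : b < A
      · by_cases hc : c < B
        · exact absurd (mem_antidiagonal.1 hp) (hp' ⟨hb, hc⟩)
        · exact h2 b c (not_lt.1 hc)
      · exact h1 b c (not_lt.1 hb)
  · rintro ⟨b, c⟩ hp
    simp only [mem_product, mem_range] at hp ⊢
    omega

/-- The same ratio appears as in `jingAdj_jing`, but expanded in the opposite direction: the mode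
indices increase. The sum is finite because the adjoint of H_k kills a given vector for large k. -/
lemma jing_jingAdj (t : K) (k m : ℤ) (f : SymFun K) :
    ∀ᶠ A : ℕ in atTop, jing t m (jingAdj t k f) =
      ∑ b ∈ range A, C (ratioCoeff t 1 b) * normOrd t (k + b) (m + b) f := by
  obtain ⟨B, hB1, hB2⟩ := exists_natDegree_translate_lt f
  filter_upwards [eventually_ge_atTop (B + k.natAbs)] with A hA
  rw [jing, pairCoeff_eq_sum (B := (translate (-1) (jingAdj t k f)).natDegree + 1 + (A + B))
    _ _ (by omega)]
  have h := sum_range_antidiagonal (A := A) (B := B)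
    (I := (translate (-1) (jingAdj t k f)).natDegree + 1 + (A + B)) (by omega)
    (fun p : ℕ × ℕ => C (ratioCoeff t 1 p.1) * (zext (qf t) (m + p.1 + p.2) *
      jingAdj t (k + p.1) ((translate (-1) f).coeff p.2)))
    (fun b c hb => by
      have := hB2 c
      simp only
      rw [jingAdj_eq_zero t (by omega), mul_zero, mul_zero])
    (fun b c hc => by
      simp only
      rw [Polynomial.coeff_eq_zero_of_natDegree_lt (p := translate (-1) f) (by omega),
        jingAdj_zero, mul_zero, mul_zero])
  refine Eq.trans (sum_congr rfl fun i _ => ?_) (h.trans (sum_congr rfl fun b _ => ?_))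
  · rw [coeff_translate_jingAdj, mul_sum]
    refine sum_congr rfl fun p hp => ?_
    rw [← mem_antidiagonal.1 hp]
    push_cast
    rw [← add_assoc]
    ring
  · rw [normOrd_eq_sum t _ _ f hB1, mul_sum]

/-- The two sums are the halves p ≤ x and p > x of ∑_p q_p r_{x+y-p}, a coefficient of q(z) r(z) =
1. The bounds on A and A' ensure that the whole support 0 ≤ p ≤ x + y is covered. -/
lemma sum_zext_qf_mul_rf (t : K) (x y : ℤ) {A : ℕ} (hA : x.natAbs + y.natAbs < A) {A' : ℕ}
    (hA' : x.natAbs + y.natAbs < A') :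
    (∑ a ∈ range A, zext (qf t) (x - a) * zext (rf t) (y + a)) +
      ∑ a ∈ range A', zext (qf t) (x + a + 1) * zext (rf t) (y - a - 1) =
      if x + y = 0 then 1 else 0 := by
  set F : ℤ → SymFun K := fun p => zext (qf t) p * zext (rf t) (x + y - p) with hF
  have h1 : ∑ a ∈ range A, zext (qf t) (x - a) * zext (rf t) (y + a) =
      ∑ p ∈ Ioc (x - A) x, F p := by
    refine sum_nbij' (fun a => x - a) (fun p => (x - p).toNat) ?_ ?_ ?_ ?_ ?_ <;> intro a ha
    · simp only [mem_range, mem_Ioc] at *; omega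
    · simp only [mem_range, mem_Ioc] at *; omega
    · simp
    · simp only [mem_Ioc] at ha; omega
    · simp only [hF]; congr 2; ring
  have h2 : ∑ a ∈ range A', zext (qf t) (x + a + 1) * zext (rf t) (y - a - 1) =
      ∑ p ∈ Ioc x (x + A'), F p := by
    refine sum_nbij' (fun a => x + a + 1) (fun p => (p - x - 1).toNat) ?_ ?_ ?_ ?_ ?_ <;>
      intro a ha
    · simp only [mem_range, mem_Ioc] at *; omega
    · simp only [mem_range, mem_Ioc] at *; omega
    · omega
    · simp only [mem_Ioc] at ha; omega
    · simp only [hF]; congr 2; ring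
  rw [h1, h2, ← sum_union (by
    rw [disjoint_left]; intro p hp hp'; simp only [mem_Ioc] at hp hp'; omega)]
  rcases lt_or_ge (x + y) 0 with hn | hn
  · rw [if_neg (by omega)]
    refine sum_eq_zero fun p _ => ?_
    rcases lt_or_ge p 0 with hp | hp
    · simp only [hF]; rw [zext_of_neg _ hp, zero_mul]
    · simp only [hF]; rw [zext_of_neg (rf t) (by omega), mul_zero]
  · obtain ⟨n, hn'⟩ := Int.eq_ofNat_of_zero_le hn
    have h3 : ∑ p ∈ Icc (0 : ℤ) n, F p = ∑ p ∈ antidiagonal n, qf t p.1 * rf t p.2 := by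
      refine sum_nbij' (fun a => (a.toNat, n - a.toNat)) (fun p => (p.1 : ℤ)) ?_ ?_ ?_ ?_ ?_ <;>
        intro a ha
      · simp only [HasAntidiagonal.mem_antidiagonal, mem_Icc] at *; omega
      · simp only [HasAntidiagonal.mem_antidiagonal, mem_Icc] at *; omega
      · simp only [mem_Icc] at ha; dsimp; omega
      · rw [HasAntidiagonal.mem_antidiagonal] at ha; ext <;> dsimp; omega
      · rw [mem_Icc] at ha
        obtain ⟨b, rfl⟩ := Int.eq_ofNat_of_zero_le ha.1
        simp only [hF, hn', zext_natCast]
        rw [show (n : ℤ) - b = ((n - b : ℕ) : ℤ) by omega]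
        rfl
    rw [sum_qf_mul_rf] at h3
    have h4 : (x + y = 0) ↔ n = 0 := by omega
    rw [if_congr h4 rfl rfl, ← h3]
    refine (sum_subset (fun p hp => ?_) fun p _ hp => ?_).symm
    · simp only [mem_union, mem_Icc, mem_Ioc] at *; omega
    · rw [mem_Icc, not_and_or] at hp
      rcases hp with hp | hp
      · simp only [hF]; rw [zext_of_neg _ (by omega), zero_mul]
      · simp only [hF]; rw [zext_of_neg (rf t) (by omega), mul_zero]

end Relations

end HallLittlewood

namespace HallLittlewood

open Finset MvPolynomial Filter

/-! ### Orthogonality of the vectors H_{λ_1} H_{λ_2} ⋯ 1 -/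

section Relations

variable {K : Type*} [Field K]

/-- The vector `H_{λ_1} H_{λ_2} ⋯ 1`. -/
noncomputable def jingVec (t : K) (L : List ℕ) : SymFun K :=
  L.foldr (fun r f => jing t (r : ℤ) f) 1

@[simp] lemma jingVec_nil (t : K) : jingVec t [] = 1 := rfl

@[simp] lemma jingVec_cons (t : K) (r : ℕ) (L : List ℕ) :
    jingVec t (r :: L) = jing t r (jingVec t L) := rfl

lemma jingAdj_one (t : K) {k : ℤ} (hk : 0 < k) : jingAdj t k 1 = 0 := by
  apply jingAdj_eq_zero
  simpa using hk

/-- `b_λ(t)` for the multiset of parts of `λ`. -/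
def bMul (t : K) (M : Multiset ℕ) : K :=
  ∏ i ∈ M.toFinset, ∏ k ∈ Icc 1 (M.count i), (1 - t ^ k)

lemma bMul_cons (t : K) (r : ℕ) (M : Multiset ℕ) :
    bMul t (r ::ₘ M) = (1 - t ^ (r ::ₘ M).count r) * bMul t M := by
  have h : ∀ M : Multiset ℕ, ∀ s : Finset ℕ, M.toFinset ⊆ s →
      bMul t M = ∏ i ∈ s, ∏ k ∈ Icc 1 (M.count i), (1 - t ^ k) := by
    intro M s hs
    refine prod_subset hs fun i _ hi => ?_
    rw [Multiset.mem_toFinset] at hi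
    simp [Multiset.count_eq_zero_of_notMem hi]
  have hr : r ∈ (r ::ₘ M).toFinset := by simp
  rw [h _ _ subset_rfl, h M (r ::ₘ M).toFinset (by simp [Multiset.toFinset_cons]),
    ← mul_prod_erase _ _ hr, ← mul_prod_erase _ (fun i => ∏ k ∈ Icc 1 (M.count i), (1 - t ^ k)) hr,
    Multiset.count_cons_self, prod_Icc_succ_top (by omega), ← mul_assoc,
    mul_comm (1 - t ^ (M.count r + 1))]
  congr 1
  refine prod_congr rfl fun i hi => ?_
  rw [Multiset.count_cons_of_ne (ne_of_mem_erase hi)]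

@[simp] lemma bMul_zero (t : K) : bMul t 0 = 1 := by simp [bMul]

lemma bMul_ne_zero {t : K} (hroot : ∀ n : ℕ, 1 ≤ n → t ^ n ≠ 1) (M : Multiset ℕ) :
    bMul t M ≠ 0 := by
  refine prod_ne_zero_iff.2 fun i _ => prod_ne_zero_iff.2 fun k hk => ?_
  exact sub_ne_zero.2 (hroot k (mem_Icc.1 hk).1).symm

variable [CharZero K]

/-- Summing over all simultaneous shifts of the two modes sets the two spectral parameters equal.
There the creation factors cancel (q r = 1), and so do the two translations, which leaves the
identity. -/
lemma sum_normOrd (t : K) (k m : ℤ) (f : SymFun K) :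
    ∀ᶠ A : ℕ in atTop, (∑ a ∈ range (A + 1), normOrd t (k - a) (m - a) f) +
      ∑ a ∈ range A, normOrd t (k + a + 1) (m + a + 1) f = if k = m then f else 0 := by
  obtain ⟨B, hB1, hB2⟩ := exists_natDegree_translate_lt f
  filter_upwards [eventually_ge_atTop (2 * B + m.natAbs + k.natAbs + 1)] with A hA
  set c : ℕ → ℕ → SymFun K := fun i j => (translate 1 ((translate (-1) f).coeff i)).coeff j with hc
  have hN : ∀ k m : ℤ, normOrd t k m f = ∑ i ∈ range B, ∑ j ∈ range B,
      zext (qf t) (m + i) * zext (rf t) (-k + j) * c i j := by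
    intro k m
    rw [normOrd_eq_sum t k m f hB1]
    refine sum_congr rfl fun i _ => ?_
    rw [jingAdj, pairCoeff_eq_sum _ _ (hB2 i), mul_sum]
    refine sum_congr rfl fun j _ => ?_
    rw [mul_assoc]
  have hswap : ∀ (n : ℕ) (u v : ℕ → ℤ), ∑ a ∈ range n, normOrd t (u a) (v a) f =
      ∑ i ∈ range B, ∑ j ∈ range B,
        (∑ a ∈ range n, zext (qf t) (v a + i) * zext (rf t) (-u a + j)) * c i j := by
    intro n u v
    simp only [hN, sum_mul]
    rw [sum_comm]
    exact sum_congr rfl fun i _ => sum_comm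
  rw [hswap, hswap, ← sum_add_distrib]
  -- The sum of the two indices does not depend on a, so the sum over shifts is a coefficient of
  -- q(z) r(z).
  have key : ∀ i ∈ range B, ∀ j ∈ range B,
      (∑ a ∈ range (A + 1), zext (qf t) (m - a + i) * zext (rf t) (-(k - a) + j)) +
        ∑ a ∈ range A, zext (qf t) (m + a + 1 + i) * zext (rf t) (-(k + a + 1) + j) =
      if (m + i) + (j - k) = 0 then 1 else 0 := by
    intro i hi j hj
    rw [mem_range] at hi hj
    rw [← sum_zext_qf_mul_rf t (m + i) (j - k) (A := A + 1) (by omega) (A' := A) (by omega)]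
    congr 1 <;> refine sum_congr rfl fun a _ => ?_ <;> congr 2 <;> ring
  have h1 : ∀ i ∈ range B, ((∑ j ∈ range B, (∑ a ∈ range (A + 1),
      zext (qf t) (m - a + i) * zext (rf t) (-(k - a) + j)) * c i j) +
        ∑ j ∈ range B, (∑ a ∈ range A,
          zext (qf t) (m + a + 1 + i) * zext (rf t) (-(k + a + 1) + j)) * c i j) =
      ∑ j ∈ range B, if (m + i) + (j - k) = 0 then c i j else 0 := by
    intro i hi
    rw [← sum_add_distrib]
    refine sum_congr rfl fun j hj => ?_
    rw [← add_mul, key i hi j hj]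
    split_ifs <;> simp
  rw [sum_congr rfl h1]
  have h2 := sum_range_antidiagonal (A := B) (B := B) (I := 2 * B + k.natAbs + m.natAbs + 1)
    (by omega)
    (fun p : ℕ × ℕ => if (m + p.1) + (p.2 - k) = 0 then c p.1 p.2 else 0)
    (fun b j hb => by
      have : c b j = 0 := by
        simp only [hc]
        rw [Polynomial.coeff_eq_zero_of_natDegree_lt (p := translate (-1) f) (by omega)]
        simp
      simp [this])
    (fun b j hb => by
      have : c b j = 0 := by
        have := hB2 b
        simp only [hc]
        rw [Polynomial.coeff_eq_zero_of_natDegree_lt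
          (p := translate 1 ((translate (-1) f).coeff b)) (by omega)]
      simp [this])
  rw [← h2]
  -- The surviving condition depends only on n = i + j, and for fixed n the two translations cancel
  -- unless n = 0.
  have h3 : ∀ n ∈ range (2 * B + k.natAbs + m.natAbs + 1), (∑ p ∈ antidiagonal n,
      if (m + p.1) + (p.2 - k) = 0 then c p.1 p.2 else 0) =
      if (n : ℤ) = k - m then (if n = 0 then f else 0) else 0 := by
    intro n _
    rw [← sum_translate_translate f n]
    split_ifs with h
    · refine sum_congr rfl fun p hp => ?_
      have := mem_antidiagonal.1 hp
      rw [if_pos (by omega)]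
    · refine sum_eq_zero fun p hp => ?_
      have := mem_antidiagonal.1 hp
      rw [if_neg (by omega)]
  rw [sum_congr rfl h3, sum_eq_single 0]
  · by_cases h : k = m
    · simp [h]
    · rw [if_neg (by omega), if_neg h]
  · intro n _ hn
    simp [hn]
  · intro h
    simp at h

/-- Together the two expansions run over all shifts with coefficient 1-t, except that the unshifted
term occurs twice with coefficient 1. Since 2 = (1+t) + (1-t), the excess is (1+t) times that term
and the rest is (1-t) times `sum_normOrd`. -/
lemma jingAdj_jing_add (t : K) (k m : ℤ) (f : SymFun K) :
    jingAdj t k (jing t m f) + jing t m (jingAdj t k f) =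
      (1 + t) • normOrd t k m f + (1 - t) • (if k = m then f else 0) := by
  -- One A serves all three expansions; the first two are used at A + 1 so that their zeroth terms
  -- can be split off.
  obtain ⟨A, h1, h2, h3⟩ := (((tendsto_add_atTop_nat 1).eventually (jingAdj_jing t k m f)).and
    (((tendsto_add_atTop_nat 1).eventually (jing_jingAdj t k m f)).and
      (sum_normOrd t k m f))).exists
  have e : ∀ a : ℕ, ratioCoeff t 1 (a + 1) = 1 - t := fun a => by simp [ratioCoeff]
  rw [h1, h2, ← h3, sum_range_succ', sum_range_succ', sum_range_succ' (fun a : ℕ =>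
    normOrd t (k - a) (m - a) f)]
  simp only [e, ← mul_sum, ratioCoeff_zero, smul_eq_C_mul, map_sub, map_add, C_1, Nat.cast_add,
    Nat.cast_one, Nat.cast_zero, sub_zero, add_zero, one_mul, add_assoc]
  ring

/-- The left side multiplies (1-tx)/(1-x) by 1-x, leaving 1-tx. Concretely, the tails with constant
coefficient 1-t cancel. -/
lemma jing_jingAdj_sub (t : K) (k m : ℤ) (f : SymFun K) :
    jing t m (jingAdj t k f) - jing t (m + 1) (jingAdj t (k + 1) f) =
      normOrd t k m f - t • normOrd t (k + 1) (m + 1) f := by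
  obtain ⟨B, hB⟩ := normOrd_eq_zero t f
  obtain ⟨A, h1, h2, h3⟩ := (((tendsto_add_atTop_nat 2).eventually (jing_jingAdj t k m f)).and
    (((tendsto_add_atTop_nat 1).eventually (jing_jingAdj t (k + 1) (m + 1) f)).and
      (eventually_ge_atTop (0 : ℕ)))).exists
  have e : ∀ a : ℕ, ratioCoeff t 1 (a + 1) = 1 - t := fun a => by simp [ratioCoeff]
  rw [h1, h2, sum_range_succ', sum_range_succ', sum_range_succ']
  simp only [e, ← mul_sum, ratioCoeff_zero, smul_eq_C_mul, map_sub, C_1, Nat.cast_add,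
    Nat.cast_one, Nat.cast_zero, add_zero, one_mul, zero_add]
  have h4 : ∀ a : ℕ, normOrd t (k + (a + 1 + 1)) (m + (a + 1 + 1)) f =
      normOrd t (k + 1 + (a + 1)) (m + 1 + (a + 1)) f := by
    intro a
    congr 1 <;> ring
  simp only [h4]
  ring

/-- If `v` is annihilated by the adjoints of `H_{k'}` for all `k' ≥ k`, the normally ordered
products vanish on it. -/
lemma normOrd_eq_zero_of_forall (t : K) {k : ℤ} {v : SymFun K}
    (hv : ∀ k', k ≤ k' → jingAdj t k' v = 0) {k' : ℤ} (hk : k ≤ k') (m : ℤ) :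
    normOrd t k' m v = 0 := by
  obtain ⟨B, hB⟩ := normOrd_eq_zero t v
  have h : ∀ n : ℕ, ∀ k' m : ℤ, k ≤ k' → (B : ℤ) ≤ k' + n → normOrd t k' m v = 0 := by
    intro n
    induction n with
    | zero => intro k' m _ h; exact hB k' m (by simpa using h)
    | succ n ih =>
      intro k' m hk h
      have h1 := jing_jingAdj_sub t k' m v
      -- With the adjoints zero, the difference relation reads N(k',m) = t N(k'+1,m+1). Vanishing
      -- thus descends from large k'.
      rw [hv k' hk, hv (k' + 1) (by omega), ih (k' + 1) (m + 1) (by omega) (by push_cast at h; omega)]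
        at h1
      simpa using h1.symm
  exact h (B + k'.natAbs) k' m hk (by omega)

lemma jingAdj_jing_of_forall (t : K) {k : ℤ} {v : SymFun K}
    (hv : ∀ k', k ≤ k' → jingAdj t k' v = 0) {k' : ℤ} (hk : k ≤ k') (m : ℤ) :
    jingAdj t k' (jing t m v) = if k' = m then (1 - t) • v else 0 := by
  have h := jingAdj_jing_add t k' m v
  rw [hv k' hk, normOrd_eq_zero_of_forall t hv hk, jing_zero, add_zero, smul_zero, zero_add] at h
  rw [h]
  split_ifs <;> simp

/-- One step above k everything vanishes, so `jing_jingAdj_sub` identifies the normally ordered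
product with H_k times its adjoint. Substituting this in the anticommutator-like relation replaces
the coefficient 1+t by t. -/
lemma jingAdj_jing_self (t : K) {k : ℤ} {v : SymFun K}
    (hv : ∀ k', k < k' → jingAdj t k' v = 0) :
    jingAdj t k (jing t k v) = t • jing t k (jingAdj t k v) + (1 - t) • v := by
  have h1 := jingAdj_jing_add t k k v
  have h2 := jing_jingAdj_sub t k k v
  have hv' : ∀ k', k + 1 ≤ k' → jingAdj t k' v = 0 := fun k' h => hv k' (by omega)
  rw [normOrd_eq_zero_of_forall t hv' le_rfl, hv' _ le_rfl, jing_zero] at h2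
  simp only [sub_zero, smul_zero] at h2
  rw [if_pos rfl, ← h2] at h1
  rw [eq_sub_of_add_eq h1, add_smul, one_smul]
  abel

lemma jingAdj_jingVec_of_lt (t : K) {L : List ℕ} {k : ℤ} (hk : 0 < k)
    (h : ∀ r ∈ L, (r : ℤ) < k) : jingAdj t k (jingVec t L) = 0 := by
  induction L generalizing k with
  | nil => exact jingAdj_one t hk
  | cons r L ih =>
    rw [jingVec_cons, jingAdj_jing_of_forall t (k := k) (fun k' hk' => ih (by omega) fun r hr =>
      lt_of_lt_of_le (h r (List.mem_cons_of_mem _ hr)) hk') le_rfl, if_neg]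
    exact (h r List.mem_cons_self).ne'

/-- Let c_m be the factor when k occurs m times. `jingAdj_jing_self` gives c_{m+1} = t c_m + (1-t),
so c_m = 1-t^m; the product of these factors is b_λ(t). -/
lemma jingAdj_jingVec_cons (t : K) {L : List ℕ} {k : ℕ} (hk : 0 < k)
    (hL : (k :: L).Pairwise (· ≥ ·)) :
    jingAdj t k (jingVec t (k :: L)) = (1 - t ^ (k :: L).count k) • jingVec t L := by
  induction L with
  | nil =>
    rw [jingVec_cons, jingVec_nil,
      jingAdj_jing_of_forall t (k := k) (fun k' hk' => jingAdj_one t (by omega)) le_rfl]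
    simp
  | cons r L ih =>
    have hr : r ≤ k := List.rel_of_pairwise_cons hL List.mem_cons_self
    have hkL : (k :: L).Pairwise (· ≥ ·) := by
      refine List.Pairwise.sublist ?_ hL
      exact (List.sublist_cons_self r L).cons_cons k
    have hrL : ∀ s ∈ L, s ≤ r := fun s hs => List.rel_of_pairwise_cons hL.of_cons hs
    rcases hr.lt_or_eq with hr | rfl
    · have hs : ∀ s ∈ r :: L, s < k := by
        intro s hs
        rcases List.mem_cons.1 hs with rfl | hs
        · exact hr
        · exact (hrL s hs).trans_lt hr
      rw [jingVec_cons, jingAdj_jing_of_forall t (k := k) (fun k' hk' =>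
        jingAdj_jingVec_of_lt t (by omega) fun s h' => by have := hs s h'; omega) le_rfl,
        if_pos rfl, List.count_cons_self, List.count_eq_zero_of_not_mem fun h' =>
          (hs k h').false]
      simp
    · rw [jingVec_cons, jingAdj_jing_self t (fun k' hk' => jingAdj_jingVec_of_lt t (by omega)
        fun s hs => ?_), ih hkL, jing_smul, smul_smul, ← jingVec_cons, ← add_smul,
        List.count_cons_self (l := r :: L)]
      · congr 1; ring
      · have : s ≤ r := List.rel_of_pairwise_cons hL hs
        omega

/-- Orthogonality of the vectors `H_{λ_1} H_{λ_2} ⋯ 1`. -/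
lemma form_jingVec {t : K} (hroot : ∀ n : ℕ, 1 ≤ n → t ^ n ≠ 1) {L M : List ℕ}
    (hL : L.Pairwise (· ≥ ·)) (hM : M.Pairwise (· ≥ ·)) (hL0 : ∀ r ∈ L, 0 < r)
    (hM0 : ∀ r ∈ M, 0 < r) :
    form t (jingVec t L) (jingVec t M) = if L = M then bMul t (L : Multiset ℕ) else 0 := by
  induction L generalizing M with
  | nil =>
    rcases M with _ | ⟨m, M⟩
    · simp [form_one]
    · rw [form_symm, jingVec_cons, form_jing hroot, jingVec_nil,
        jingAdj_one t (by exact_mod_cast hM0 m List.mem_cons_self)]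
      simp
  | cons k L ih =>
    have hk := hL0 k List.mem_cons_self
    have hle : ∀ {k : ℕ} {L : List ℕ}, (k :: L).Pairwise (· ≥ ·) → ∀ r ∈ k :: L, r ≤ k := by
      intro k L h r hr
      rcases List.mem_cons.1 hr with rfl | hr
      · exact le_rfl
      · exact List.rel_of_pairwise_cons h hr
    have hgt : ∀ {k m : ℕ} {L M : List ℕ}, 0 < k → (m :: M).Pairwise (· ≥ ·) → m < k →
        form t (jingVec t (k :: L)) (jingVec t (m :: M)) = 0 := by
      intro k m L M hk hM hkm
      rw [jingVec_cons t k, form_jing hroot, jingAdj_jingVec_of_lt t (by omega), map_zero]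
      intro r hr
      have := hle hM r hr
      omega
    rcases M with _ | ⟨m, M⟩
    · rw [jingVec_cons, form_jing hroot, jingVec_nil, jingAdj_one t (by omega)]
      simp
    · rcases lt_trichotomy m k with h | rfl | h
      · rw [hgt hk hM h, if_neg]
        rintro h'
        exact h.ne (List.cons.inj h').1.symm
      · rw [jingVec_cons t m L, form_jing hroot, jingAdj_jingVec_cons t hk hM, map_smul,
          ih hL.of_cons hM.of_cons (fun r hr => hL0 r (List.mem_cons_of_mem _ hr))
            (fun r hr => hM0 r (List.mem_cons_of_mem _ hr))]
        by_cases h : L = M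
        · subst h
          simp only [if_true, ← Multiset.cons_coe, bMul_cons, smul_eq_mul]
          rw [Multiset.cons_coe, Multiset.coe_count]
        · simp [h]
      · rw [form_symm, hgt (hM0 m List.mem_cons_self) hL h, if_neg]
        rintro h'
        exact h.ne (List.cons.inj h').1

end Relations

end HallLittlewood

namespace HallLittlewood

open Finset MvPolynomial

/-! ### Specialization at `p_n = -1` -/

section Specialization

variable {K : Type*} [Field K]

/-- The specialization `p_n ↦ -(1 + t^n + ⋯ + t^{(r-1)n}) z^n`. -/
noncomputable def negSpec (t : K) (r : ℕ) : SymFun K →ₐ[K] Polynomial K :=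
  aeval fun n : ℕ+ => Polynomial.monomial (n : ℕ) (-∑ i ∈ range r, t ^ (i * (n : ℕ)))

lemma negSpec_X (t : K) (r : ℕ) (n : ℕ+) : negSpec t r (X n) =
    Polynomial.C (-∑ i ∈ range r, t ^ (i * (n : ℕ))) * Polynomial.X ^ (n : ℕ) := by
  rw [negSpec, aeval_X, Polynomial.C_mul_X_pow_eq_monomial]

/-- Replacing p_n by p_n - (t^r z)^n adds one more term to the geometric sum. This is what increases
r. -/
lemma negSpec_translate (t : K) (r : ℕ) (f : SymFun K) {B : ℕ}
    (hB : (translate (-1) f).natDegree < B) :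
    ∑ j ∈ range B, negSpec t r ((translate (-1) f).coeff j) *
      (Polynomial.C (t ^ r) * Polynomial.X) ^ j = negSpec t (r + 1) f := by
  have h : (Polynomial.eval₂RingHom (negSpec t r).toRingHom
      (Polynomial.C (t ^ r) * Polynomial.X)).comp (translate (-1 : K)).toRingHom =
      (negSpec t (r + 1)).toRingHom := by
    apply MvPolynomial.ringHom_ext
    · intro c
      have hC : translate (-1 : K) (C c) = Polynomial.C (C c) := (translate (-1 : K)).commutes c
      have hN : ∀ r, negSpec t r (C c) = Polynomial.C c := fun r => (negSpec t r).commutes c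
      simp [hC, hN]
    · intro n
      have hN : ∀ c, negSpec t r (C c) = Polynomial.C c := fun c => (negSpec t r).commutes c
      simp only [RingHom.comp_apply, AlgHom.toRingHom_eq_coe, RingHom.coe_coe, translate_X,
        Polynomial.coe_eval₂RingHom, Polynomial.eval₂_add, Polynomial.eval₂_C,
        Polynomial.eval₂_monomial, negSpec_X, hN, sum_range_succ, mul_pow, neg_add,
        Polynomial.C_add, Polynomial.C_neg, Polynomial.C_1, Polynomial.C_pow, pow_mul]
      ring
  have h1 := congrArg (fun φ : SymFun K →+* Polynomial K => φ f) h
  simp only [RingHom.comp_apply, Polynomial.coe_eval₂RingHom, AlgHom.toRingHom_eq_coe,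
    RingHom.coe_coe] at h1
  rw [← h1, Polynomial.eval₂_eq_sum_range' _ hB]
  rfl

lemma map_constantCoeff_translate (t : K) (f : SymFun K) :
    (translate (-1) f).map constantCoeff = negSpec t 1 f := by
  have h : (Polynomial.mapRingHom (constantCoeff (R := K) (σ := ℕ+))).comp
      (translate (-1 : K)).toRingHom = (negSpec t 1).toRingHom := by
    apply MvPolynomial.ringHom_ext
    · intro c
      have hC : translate (-1 : K) (C c) = Polynomial.C (C c) := (translate (-1 : K)).commutes c
      have hN : ∀ r, negSpec t r (C c) = Polynomial.C c := fun r => (negSpec t r).commutes c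
      simp [hC, hN]
    · intro n
      simp [translate_X, negSpec_X, ← Polynomial.C_mul_X_pow_eq_monomial]
  exact congrArg (fun φ : SymFun K →+* Polynomial K => φ f) h

lemma jingVec_singleton (t : K) (s : ℕ) : jingVec t [s] = qf t s := by
  rw [jingVec_cons, jingVec_nil, jing, map_one, pairCoeff_eq_sum (B := 1) _ _ (by simp)]
  simp

variable [CharZero K]

/-- Multiplying the geometric sum by 1-t^n telescopes to t^{rn} - 1, so q specializes to
(1-x)/(1-t^r x). -/
lemma negSpec_qf (t : K) (r k : ℕ) : negSpec t r (qf t k) =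
    Polynomial.C (ratioCoeff 1 (t ^ r) k) * Polynomial.X ^ k := by
  have h1 := isExp_map_qf t (negSpec t r).toRingHom
  have h2 := ((isExp_ratioCoeff 1 (t ^ r)).map (Polynomial.C : K →+* _)).rescale Polynomial.X
  have h3 : (fun n : ℕ+ => (negSpec t r).toRingHom (C ((1 - t ^ (n : ℕ)) / (n : K)) * X n)) =
      fun n : ℕ+ => Polynomial.X ^ (n : ℕ) * (Polynomial.C : K →+* _)
        (((t ^ r) ^ (n : ℕ) - 1 ^ (n : ℕ)) / n) := by
    funext n
    have hN : ∀ c, negSpec t r (C c) = Polynomial.C c := fun c => (negSpec t r).commutes c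
    have hg := geom_sum_mul_neg (t ^ (n : ℕ)) r
    simp only [AlgHom.toRingHom_eq_coe, RingHom.coe_coe, map_mul, negSpec_X, hN]
    rw [← mul_assoc, ← Polynomial.C_mul, mul_comm]
    congr 2
    simp only [mul_comm _ (n : ℕ), pow_mul, one_pow, ← pow_mul t r]
    rw [div_mul_eq_mul_div]
    congr 1
    linear_combination -hg
  rw [h3] at h1
  have h := congrArg (PowerSeries.coeff k) (h1.unique K h2)
  simp only [PowerSeries.coeff_rescale, PowerSeries.coeff_map, PowerSeries.coeff_mk] at h
  rw [mul_comm, ← h]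
  rfl

/-- For positive index, the coefficients of (1-x)/(1-t^r x) are purely geometric. The dependence on
j is then (t^r)^j, and the sum over j is again a specialization, with r + 1 in place of r. The index
m + j is never 0 because m > 0. -/
lemma negSpec_jing (t : K) (r m : ℕ) (hm : 0 < m) (ht : t ≠ 0) (f : SymFun K) :
    negSpec t r (jing t m f) =
      Polynomial.C ((1 - (t ^ r)⁻¹) * t ^ (r * m)) * Polynomial.X ^ m * negSpec t (r + 1) f := by
  rw [jing, pairCoeff_eq_sum _ _ (Nat.lt_succ_self _), map_sum,
    ← negSpec_translate t r f (Nat.lt_succ_self _), mul_sum]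
  refine sum_congr rfl fun j _ => ?_
  rw [map_mul, ← Nat.cast_add, zext_natCast, negSpec_qf]
  have h : ratioCoeff 1 (t ^ r) (m + j) = (1 - (t ^ r)⁻¹) * t ^ (r * m) * (t ^ r) ^ j := by
    rw [ratioCoeff, if_neg (by omega)]
    have : (t ^ r) ^ (m + j) = t ^ r * (t ^ r) ^ (m + j - 1) := by
      rw [← pow_succ']; congr 1; omega
    have h2 : t ^ r ≠ 0 := pow_ne_zero _ ht
    rw [pow_mul, mul_assoc, ← pow_add, this]
    field_simp
  rw [h]
  simp only [Polynomial.C_mul, Polynomial.C_pow, pow_add, mul_pow]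
  ring

lemma negSpec_jingVec {t : K} (ht : t ≠ 0) (L : List ℕ) (hL : ∀ r ∈ L, 0 < r) (r : ℕ) :
    negSpec t r (jingVec t L) = Polynomial.C (t ^ (∑ i ∈ range L.length, (r + i) * L.getD i 0) *
      ∏ i ∈ range L.length, (1 - (t ^ (r + i))⁻¹)) * Polynomial.X ^ L.sum := by
  induction L generalizing r with
  | nil => simp
  | cons m L ih =>
    rw [jingVec_cons, negSpec_jing t r m (hL m List.mem_cons_self) ht,
      ih (fun r hr => hL r (List.mem_cons_of_mem _ hr)), List.length_cons, sum_range_succ',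
      prod_range_succ', List.sum_cons]
    simp only [List.getD_cons_succ, List.getD_cons_zero, add_zero, Polynomial.C_mul, pow_add,
      ← add_assoc, add_right_comm r _ 1]
    ring

/-- Pairing with r_s, the image of q_s under p_n ↦ -p_n, extracts the z^s coefficient of the
constant term after p_n ↦ p_n - z^n. That is the specialization with r = 1. -/
lemma form_rf_jingVec {t : K} (hroot : ∀ n : ℕ, 1 ≤ n → t ^ n ≠ 1) (ht : t ≠ 0) (L : List ℕ)
    (hL : ∀ r ∈ L, 0 < r) :
    form t (rf t L.sum) (jingVec t L) = t ^ (∑ i ∈ range L.length, (1 + i) * L.getD i 0) *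
      ∏ i ∈ range L.length, (1 - (t ^ (1 + i))⁻¹) := by
  have h := form_rf_mul hroot L.sum 1 (jingVec t L)
  rw [mul_one, form_one] at h
  have h2 := congrArg (fun P => P.coeff L.sum) (map_constantCoeff_translate t (jingVec t L))
  simp only [Polynomial.coeff_map, negSpec_jingVec ht L hL] at h2
  rw [h, h2, Polynomial.coeff_C_mul_X_pow, if_pos rfl]

end Specialization

/-! ### Triangularity with respect to the products of the `q_k` -/

section Triangular

variable {K : Type*} [Field K]

/-- `q_{μ_1} q_{μ_2} ⋯`. -/
noncomputable def qMul (t : K) (M : Multiset ℕ) : SymFun K := (M.map (qf t)).prod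

@[simp] lemma qMul_cons (t : K) (r : ℕ) (M : Multiset ℕ) :
    qMul t (r ::ₘ M) = qf t r * qMul t M := by simp [qMul]

@[simp] lemma qMul_zero (t : K) : qMul t 0 = 1 := by simp [qMul]

/-- `∑_i max (μ_i - c, 0)`. -/
def excess (c : ℕ) (M : Multiset ℕ) : ℕ := (M.map fun x => x - c).sum

@[simp] lemma excess_cons (c r : ℕ) (M : Multiset ℕ) :
    excess c (r ::ₘ M) = (r - c) + excess c M := by simp [excess]

@[simp] lemma excess_zero_right (c : ℕ) : excess c 0 = 0 := by simp [excess]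

lemma excess_eq_zero {c : ℕ} {M : Multiset ℕ} (h : ∀ r ∈ M, r ≤ c) : excess c M = 0 := by
  rw [excess, Multiset.sum_eq_zero_iff]
  intro x hx
  obtain ⟨r, hr, rfl⟩ := Multiset.mem_map.1 hx
  have := h r hr
  omega

/-- The strict order on multisets of natural numbers given by `excess`; on partitions of the same
integer it refines the dominance order. -/
def ExcessLT (M M' : Multiset ℕ) : Prop :=
  (∀ c, excess c M ≤ excess c M') ∧ ∃ c, excess c M < excess c M'

lemma ExcessLT.trans {M M' M'' : Multiset ℕ} (h : ExcessLT M M') (h' : ExcessLT M' M'') :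
    ExcessLT M M'' :=
  ⟨fun c => (h.1 c).trans (h'.1 c), h.2.imp fun c hc => hc.trans_le (h'.1 c)⟩

lemma ExcessLT.ne {M M' : Multiset ℕ} (h : ExcessLT M M') : M ≠ M' := by
  rintro rfl
  obtain ⟨c, hc⟩ := h.2
  exact hc.false

lemma sum_take_le (c : ℕ) (L : List ℕ) (k : ℕ) :
    (L.take k).sum ≤ k * c + excess c (L : Multiset ℕ) := by
  induction L generalizing k with
  | nil => simp
  | cons a L ih =>
    rcases k with _ | k
    · simp
    · have := ih k
      rw [List.take_succ_cons, List.sum_cons, ← Multiset.cons_coe, excess_cons, add_mul]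
      omega

/-- For a decreasing list, the bound of `sum_take_le` is attained at c equal to the first part left
out. Partial sums are thus minima of k c + `excess` over c, so comparing excesses implies dominance.
-/
lemma sum_take_eq {L : List ℕ} (hL : L.Pairwise (· ≥ ·)) (k : ℕ) :
    (L.take k).sum = k * L.getD k 0 + excess (L.getD k 0) (L : Multiset ℕ) := by
  induction L generalizing k with
  | nil => simp
  | cons a L ih =>
    have ha : ∀ r ∈ L, r ≤ a := fun r hr => List.rel_of_pairwise_cons hL hr
    rcases k with _ | k
    · have : excess a ((a :: L : List ℕ) : Multiset ℕ) = 0 := by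
        apply excess_eq_zero
        intro r hr
        rcases List.mem_cons.1 (Multiset.mem_coe.1 hr) with rfl | hr
        · exact le_rfl
        · exact ha r hr
      simp [this]
    · have h1 := ih hL.of_cons k
      have h2 : L.getD k 0 ≤ a := by
        rcases lt_or_ge k L.length with hk | hk
        · rw [List.getD_eq_getElem _ _ hk]
          exact ha _ (List.getElem_mem hk)
        · rw [List.getD_eq_default _ _ hk]; omega
      rw [List.take_succ_cons, List.sum_cons, List.getD_cons_succ, ← Multiset.cons_coe,
        excess_cons, add_mul, h1]
      omega

lemma rows_pairwise {n : ℕ} (lam : n.Partition) : (rows lam).Pairwise (· ≥ ·) :=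
  Multiset.pairwise_sort _ _

lemma coe_rows {n : ℕ} (lam : n.Partition) : (rows lam : Multiset ℕ) = lam.parts :=
  Multiset.sort_eq _ _

lemma rows_pos {n : ℕ} (lam : n.Partition) : ∀ r ∈ rows lam, 0 < r := fun r hr =>
  lam.parts_pos (by rw [← coe_rows]; exact hr)

lemma rows_sum {n : ℕ} (lam : n.Partition) : (rows lam).sum = n := by
  rw [← Multiset.sum_coe, coe_rows, lam.parts_sum]

lemma rows_length {n : ℕ} (lam : n.Partition) : (rows lam).length = length lam := by
  rw [← Multiset.coe_card, coe_rows, length]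

lemma rows_injective {n : ℕ} : Function.Injective (rows : n.Partition → List ℕ) := by
  intro a b h
  ext1
  rw [← coe_rows, ← coe_rows, h]

lemma ExcessLT.dominates {n : ℕ} {lam mu : n.Partition} (h : ExcessLT mu.parts lam.parts) :
    Dominates lam mu := by
  intro k
  rw [sum_take_eq (rows_pairwise lam) k]
  refine (sum_take_le ((rows lam).getD k 0) _ k).trans ?_
  rw [coe_rows, coe_rows]
  exact Nat.add_le_add_left (h.1 _) _

lemma translate_coeff_zero (s : K) (f : SymFun K) : (translate s f).coeff 0 = f := by
  have h : (Polynomial.constantCoeff (R := SymFun K)).comp (translate s).toRingHom =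
      RingHom.id _ := by
    apply MvPolynomial.ringHom_ext
    · intro c
      have hC : translate s (C c) = Polynomial.C (C c) := (translate s).commutes c
      simp [hC]
    · intro n
      have : 0 ≠ (n : ℕ) := n.pos.ne
      simp [translate_X, Polynomial.coeff_monomial]
  exact congrArg (fun φ : SymFun K →+* SymFun K => φ f) h

variable [CharZero K]

lemma coeff_translate_neg_qf (t : K) (n a : ℕ) :
    (translate (-1) (qf t n)).coeff a =
      if a ≤ n then ratioCoeff 1 t a • qf t (n - a) else 0 := by
  rw [translate_qf t (-1) 1 t (by simp), Polynomial.finsetSum_coeff]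
  simp only [Polynomial.coeff_C_mul_X_pow]
  rw [Finset.Nat.sum_antidiagonal_eq_sum_range_succ_mk]
  simp [smul_eq_C_mul]

/-- The z^k coefficient of the translation removes k boxes in total from the parts of M, and
removing k boxes lowers any excess by at most k. -/
lemma coeff_translate_qMul (t : K) (M : Multiset ℕ) (k : ℕ) :
    (translate (-1) (qMul t M)).coeff k ∈ Submodule.span K {x | ∃ M' : Multiset ℕ,
      M'.sum + k = M.sum ∧ (∀ c, excess c M ≤ excess c M' + k) ∧ qMul t M' = x} := by
  induction M using Multiset.induction_on generalizing k with
  | empty =>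
    rw [qMul_zero, map_one, Polynomial.coeff_one]
    split_ifs with h
    · subst h
      exact Submodule.subset_span ⟨0, by simp⟩
    · exact zero_mem _
  | cons n M ih =>
    rw [qMul_cons, map_mul, Polynomial.coeff_mul]
    refine Submodule.sum_mem _ fun p hp => ?_
    have hp := mem_antidiagonal.1 hp
    rw [coeff_translate_neg_qf]
    split_ifs with h
    · rw [smul_mul_assoc]
      refine Submodule.smul_mem _ _ ?_
      have := Submodule.mem_map_of_mem (f := LinearMap.mulLeft K (qf t (n - p.1))) (ih p.2)
      rw [Submodule.map_span, LinearMap.mulLeft_apply] at this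
      refine Submodule.span_mono ?_ this
      rintro _ ⟨_, ⟨M', h1, h2, rfl⟩, rfl⟩
      refine ⟨(n - p.1) ::ₘ M', ?_, fun c => ?_, by simp⟩
      · rw [Multiset.sum_cons, Multiset.sum_cons]; omega
      · have := h2 c
        rw [excess_cons, excess_cons]; omega
    · rw [zero_mul]; exact zero_mem _

/-- The term j = 0 of H_r is q_r q_M. In the others, boxes are moved from M to the new part: for c ≤
r the gain in that part makes up for the loss, and for c ≥ r the left excess is 0. Strictness is
seen at c = r. -/
lemma jing_qMul (t : K) {r : ℕ} {L M : Multiset ℕ} (hr : ∀ x ∈ L, x ≤ r)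
    (hs : M.sum = L.sum) (hLM : ∀ c, excess c L ≤ excess c M) :
    jing t r (qMul t M) - qMul t (r ::ₘ M) ∈ Submodule.span K {x | ∃ M' : Multiset ℕ,
      M'.sum = (r ::ₘ L).sum ∧ ExcessLT (r ::ₘ L) M' ∧ qMul t M' = x} := by
  have hr0 : ∀ c, r ≤ c → excess c (r ::ₘ L) = 0 := fun c hc => excess_eq_zero fun x hx => by
    rcases Multiset.mem_cons.1 hx with rfl | hx
    · exact hc
    · exact (hr x hx).trans hc
  rw [jing, pairCoeff_eq_sum _ _ (Nat.lt_succ_self _), sum_range_succ', translate_coeff_zero]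
  simp only [Nat.cast_zero, add_zero, zext_natCast, qMul_cons, add_sub_cancel_right]
  refine Submodule.sum_mem _ fun j _ => ?_
  rw [← Nat.cast_add, zext_natCast]
  have := Submodule.mem_map_of_mem (f := LinearMap.mulLeft K (qf t (r + (j + 1))))
    (coeff_translate_qMul t M (j + 1))
  rw [Submodule.map_span, LinearMap.mulLeft_apply] at this
  refine Submodule.span_mono ?_ this
  rintro _ ⟨_, ⟨M', h1, h2, rfl⟩, rfl⟩
  refine ⟨(r + (j + 1)) ::ₘ M', ?_, ⟨fun c => ?_, r, ?_⟩, by simp⟩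
  · rw [Multiset.sum_cons, Multiset.sum_cons]; omega
  · rcases le_total r c with hc | hc
    · rw [hr0 c hc]; exact Nat.zero_le _
    · have h3 := h2 c
      have h4 := hLM c
      rw [excess_cons, excess_cons]; omega
  · rw [hr0 r le_rfl, excess_cons]; omega

lemma jingVec_sub_qMul (t : K) {L : List ℕ} (hL : L.Pairwise (· ≥ ·)) :
    jingVec t L - qMul t L ∈ Submodule.span K {x | ∃ M' : Multiset ℕ,
      M'.sum = L.sum ∧ ExcessLT L M' ∧ qMul t M' = x} := by
  induction L with
  | nil => simp [zero_mem]
  | cons r L ih =>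
    have hr : ∀ x ∈ (L : Multiset ℕ), x ≤ r := fun x hx =>
      List.rel_of_pairwise_cons hL (Multiset.mem_coe.1 hx)
    have h1 := jing_qMul t hr rfl fun _ => le_rfl
    set f := jingVec t L - qMul t L with hf
    have h2 : jing t r f ∈ Submodule.span K {x | ∃ M' : Multiset ℕ,
        M'.sum = (r ::ₘ (L : Multiset ℕ)).sum ∧ ExcessLT (r ::ₘ (L : Multiset ℕ)) M' ∧
          qMul t M' = x} := by
      -- The weak inequality of excesses in `jing_qMul` is what lets it apply to the correction
      -- terms M' as well as to L itself.
      refine Submodule.span_induction (p := fun f _ => jing t r f ∈ _) ?_ ?_ ?_ ?_ (ih hL.of_cons)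
      · rintro _ ⟨M', h3, h4, rfl⟩
        have h5 := jing_qMul t (M := M') hr (by rw [h3, Multiset.sum_coe]) h4.1
        rw [← sub_add_cancel (jing t r (qMul t M')) (qMul t (r ::ₘ M'))]
        refine add_mem h5 (Submodule.subset_span ⟨_, ?_, ⟨fun c => ?_, ?_⟩, rfl⟩)
        · rw [Multiset.sum_cons, Multiset.sum_cons, h3, Multiset.sum_coe]
        · rw [excess_cons, excess_cons]
          exact Nat.add_le_add_left (h4.1 c) _
        · obtain ⟨c, hc⟩ := h4.2
          refine ⟨c, ?_⟩
          rw [excess_cons, excess_cons]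
          exact Nat.add_lt_add_left hc _
      · rw [jing_zero]; exact zero_mem _
      · intro f g _ _ hf hg
        rw [jing_add]; exact add_mem hf hg
      · intro c f _ hf
        rw [jing_smul]; exact Submodule.smul_mem _ _ hf
    have h3 : jingVec t (r :: L) - qMul t ((r :: L : List ℕ) : Multiset ℕ) =
        jing t r f + (jing t r (qMul t L) - qMul t (r ::ₘ (L : Multiset ℕ))) := by
      rw [← add_sub_assoc, ← jing_add, hf, sub_add_cancel]
      rfl
    rw [h3]
    simpa using add_mem h2 h1

end Triangular

end HallLittlewood

namespace HallLittlewood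

open Finset MvPolynomial

/-! ### Homogeneity and bases of the homogeneous components -/

section Homogeneous

variable {K : Type*} [Field K]

/-- `f` is homogeneous of degree `n`, where `p_k` has degree `k`. -/
def IsHomog (f : SymFun K) (n : ℕ) : Prop :=
  IsWeightedHomogeneous (fun i : ℕ+ => (i : ℕ)) f n

lemma form_eq_zero_of_ne (t : K) {f g : SymFun K} {m n : ℕ} (hf : IsHomog f m) (hg : IsHomog g n)
    (h : m ≠ n) : form t f g = 0 := by
  rw [← innerQT_eq_form, innerQT]
  refine sum_eq_zero fun u hu => ?_
  have h1 := hf (mem_support_iff.1 hu)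
  have h2 : g.coeff u = 0 := hg.coeff_eq_zero u (by rw [h1]; exact h)
  rw [h2, mul_zero, zero_mul]

lemma isHomog_negP {f : SymFun K} {n : ℕ} (hf : IsHomog f n) : IsHomog (negP f) n := by
  refine IsWeightedHomogeneous.induction_on (w := fun i : ℕ+ => (i : ℕ)) (m := n)
    (motive := fun f _ => IsHomog (negP f) n) ?_ ?_ ?_ hf
  · rw [map_zero]; exact isWeightedHomogeneous_zero K _ n
  · intro a b _ _ ha hb
    rw [map_add]; exact IsWeightedHomogeneous.add ha hb
  · intro u c hu
    have h : negP (monomial u c : SymFun K) = monomial u (c * u.prod fun _ k => (-1) ^ k) := by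
      rw [negP, aeval_monomial, algebraMap_eq, monomial_eq, C_mul, mul_assoc]
      congr 1
      simp only [neg_pow (X _ : SymFun K), Finsupp.prod, prod_mul_distrib, map_prod, map_pow,
        map_neg, C_1]
    rw [h]
    exact isWeightedHomogeneous_monomial _ _ _ hu

/-- Inversion of a unitriangular change of families. -/
lemma sub_mem_span_of_unitriangular {ι V : Type*} [Finite ι] [AddCommGroup V] [Module K V]
    {r : ι → ι → Prop} (htrans : ∀ i j k, r i j → r j k → r i k) (hirr : ∀ i, ¬ r i i)
    {x y : ι → V} (h : ∀ i, x i - y i ∈ Submodule.span K (y '' {j | r i j})) (i : ι) :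
    y i - x i ∈ Submodule.span K (x '' {j | r i j}) := by
  have hwf : WellFounded fun i j => r j i := by
    have : IsTrans ι fun i j => r j i := ⟨fun i j k h1 h2 => htrans _ _ _ h2 h1⟩
    have : Std.Irrefl fun i j => r j i := ⟨hirr⟩
    exact Finite.wellFounded_of_trans_of_irrefl _
  induction i using hwf.induction with
  | _ i ih =>
    rw [← neg_sub]
    refine neg_mem ((Submodule.span_le.2 ?_ : _ ≤ _) (h i))
    rintro _ ⟨j, hj, rfl⟩
    rw [← sub_add_cancel (y j) (x j)]
    refine add_mem ?_ (Submodule.subset_span ⟨j, hj, rfl⟩)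
    refine Submodule.span_mono (Set.image_mono ?_) (ih j hj)
    exact fun k hk => htrans i j k hj hk

lemma b_ne_zero {t : K} (hroot : ∀ n : ℕ, 1 ≤ n → t ^ n ≠ 1) {n : ℕ}
    (lam : n.Partition) : b t lam ≠ 0 := bMul_ne_zero hroot _

variable [CharZero K]

/-- The exponential equation reads k q_k = ∑_{i ≥ 1} (1-t^i) p_i q_{k-i}, which gives the degree by
induction. -/
lemma isHomog_qf (t : K) (k : ℕ) : IsHomog (qf t k) k := by
  induction k using Nat.strong_induction_on with
  | _ k ih =>
    rcases eq_or_ne k 0 with rfl | hk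
    · rw [qf_zero]; exact isWeightedHomogeneous_one K _
    · have h := congrArg (PowerSeries.coeff k) (isExp_qf t).2
      rw [coeff_euler, PowerSeries.coeff_mk, PowerSeries.coeff_mul, ← Nat.cast_smul_eq_nsmul K] at h
      have hk' : (k : K) ≠ 0 := by exact_mod_cast hk
      rw [← inv_smul_smul₀ hk' (qf t k), h, smul_eq_C_mul]
      refine IsWeightedHomogeneous.C_mul (IsWeightedHomogeneous.sum _ _ _ fun p hp => ?_) _
      have hp := mem_antidiagonal.1 hp
      rw [coeff_euler, PowerSeries.coeff_mk]
      rcases Nat.eq_zero_or_pos p.1 with h0 | h0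
      · rw [h0, zero_smul, zero_mul]; exact isWeightedHomogeneous_zero K _ k
      · rw [← hp]
        refine IsWeightedHomogeneous.mul ?_ (ih p.2 (by omega))
        have h1 : PowerSeries.coeff p.1 (genSeries fun n : ℕ+ =>
            C ((1 - t ^ (n : ℕ)) / (n : K)) * (X n : SymFun K)) =
            C ((1 - t ^ p.1) / (p.1 : K)) * X ⟨p.1, h0⟩ := by
          have := coeff_genSeries (fun n : ℕ+ =>
            C ((1 - t ^ (n : ℕ)) / (n : K)) * (X n : SymFun K)) ⟨p.1, h0⟩
          simpa using this
        rw [h1, ← Nat.cast_smul_eq_nsmul K, smul_eq_C_mul]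
        exact ((isWeightedHomogeneous_X K _ (⟨p.1, h0⟩ : ℕ+)).C_mul _).C_mul _

lemma isHomog_qMul (t : K) (M : Multiset ℕ) : IsHomog (qMul t M) M.sum := by
  induction M using Multiset.induction_on with
  | empty => rw [qMul_zero]; exact isWeightedHomogeneous_one K _
  | cons n M ih =>
    rw [qMul_cons, Multiset.sum_cons]
    exact IsWeightedHomogeneous.mul (isHomog_qf t n) ih

lemma qMul_filter (t : K) (M : Multiset ℕ) : qMul t (M.filter (· ≠ 0)) = qMul t M := by
  induction M using Multiset.induction_on with
  | empty => simp
  | cons n M ih =>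
    by_cases hn : n = 0
    · subst hn
      rw [show (0 ::ₘ M).filter (· ≠ 0) = M.filter (· ≠ 0) by simp, ih, qMul_cons, qf_zero, one_mul]
    · rw [show (n ::ₘ M).filter (· ≠ 0) = n ::ₘ M.filter (· ≠ 0) by simp [hn],
        qMul_cons, qMul_cons, ih]

lemma excess_filter (c : ℕ) (M : Multiset ℕ) : excess c (M.filter (· ≠ 0)) = excess c M := by
  induction M using Multiset.induction_on with
  | empty => simp
  | cons n M ih =>
    by_cases hn : n = 0
    · subst hn
      rw [show (0 ::ₘ M).filter (· ≠ 0) = M.filter (· ≠ 0) by simp, ih, excess_cons]; simp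
    · rw [show (n ::ₘ M).filter (· ≠ 0) = n ::ₘ M.filter (· ≠ 0) by simp [hn],
        excess_cons, excess_cons, ih]

lemma exists_partition (t : K) {n : ℕ} (M : Multiset ℕ) (hM : M.sum = n) :
    ∃ mu : n.Partition, qMul t mu.parts = qMul t M ∧ ∀ c, excess c mu.parts = excess c M :=
  ⟨Nat.Partition.ofSums n M hM, qMul_filter t M, fun c => excess_filter c M⟩

/-- The vector `Q_λ`. -/
noncomputable def jingQ (t : K) {n : ℕ} (lam : n.Partition) : SymFun K := jingVec t (rows lam)

lemma jingQ_sub_qMul (t : K) {n : ℕ} (lam : n.Partition) :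
    jingQ t lam - qMul t lam.parts ∈ Submodule.span K
      ((fun mu : n.Partition => qMul t mu.parts) '' {mu | ExcessLT lam.parts mu.parts}) := by
  have h := jingVec_sub_qMul t (rows_pairwise lam)
  rw [coe_rows, rows_sum] at h
  refine Submodule.span_mono ?_ h
  rintro _ ⟨M, h1, h2, rfl⟩
  obtain ⟨mu, h3, h4⟩ := exists_partition t M h1
  refine ⟨mu, ?_, h3⟩
  simpa only [Set.mem_ofPred_eq, ExcessLT, h4] using h2

lemma qMul_sub_jingQ (t : K) {n : ℕ} (lam : n.Partition) :
    qMul t lam.parts - jingQ t lam ∈ Submodule.span K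
      (jingQ t '' {mu : n.Partition | ExcessLT lam.parts mu.parts}) :=
  sub_mem_span_of_unitriangular (r := fun lam mu : n.Partition => ExcessLT lam.parts mu.parts)
    (fun _ _ _ h h' => h.trans h') (fun _ h => h.ne rfl) (x := jingQ t)
    (y := fun mu : n.Partition => qMul t mu.parts) (jingQ_sub_qMul t) lam

lemma isHomog_jingQ (t : K) {n : ℕ} (lam : n.Partition) : IsHomog (jingQ t lam) n := by
  have h : ∀ mu : n.Partition, IsHomog (qMul t mu.parts) n := fun mu => by
    have := isHomog_qMul t mu.parts
    rwa [mu.parts_sum] at this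
  rw [← sub_add_cancel (jingQ t lam) (qMul t lam.parts)]
  refine IsWeightedHomogeneous.add ?_ (h lam)
  have h2 : Submodule.span K ((fun mu : n.Partition => qMul t mu.parts) ''
      {mu | ExcessLT lam.parts mu.parts}) ≤
      weightedHomogeneousSubmodule K (fun i : ℕ+ => (i : ℕ)) n := by
    rw [Submodule.span_le]
    rintro _ ⟨mu, _, rfl⟩
    exact h mu
  exact h2 (jingQ_sub_qMul t lam)

variable {t : K} (hroot : ∀ n : ℕ, 1 ≤ n → t ^ n ≠ 1)

include hroot in
lemma form_jingQ {n : ℕ} (lam mu : n.Partition) :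
    form t (jingQ t lam) (jingQ t mu) = if lam = mu then b t lam else 0 := by
  rw [jingQ, jingQ, form_jingVec hroot (rows_pairwise lam) (rows_pairwise mu) (rows_pos lam)
    (rows_pos mu), if_congr rows_injective.eq_iff rfl rfl, coe_rows]
  rfl

include hroot in
-- The same Newton-type recursion is solved for p_n; its coefficient 1-t^n is invertible as t is not
-- a root of unity.
lemma X_mem_span_qMul (n : ℕ+) : (X n : SymFun K) ∈ Submodule.span K
    {x | ∃ M : Multiset ℕ, M.sum = n ∧ qMul t M = x} := by
  induction n using PNat.strongInductionOn with
  | _ n ih =>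
    have h := congrArg (PowerSeries.coeff (n : ℕ)) (isExp_qf t).2
    rw [coeff_euler, PowerSeries.coeff_mk, PowerSeries.coeff_mul,
      Finset.Nat.sum_antidiagonal_eq_sum_range_succ_mk, sum_range_succ, coeff_euler,
      coeff_genSeries, Nat.sub_self, PowerSeries.coeff_mk, qf_zero, mul_one,
      ← Nat.cast_smul_eq_nsmul K, ← Nat.cast_smul_eq_nsmul K, ← smul_eq_C_mul, smul_smul,
      mul_div_cancel₀ _ (show ((n : ℕ) : K) ≠ 0 by exact_mod_cast n.ne_zero)] at h
    have ht : 1 - t ^ (n : ℕ) ≠ 0 := sub_ne_zero.2 (hroot n n.pos).symm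
    rw [← inv_smul_smul₀ ht (X n : SymFun K), eq_sub_of_add_eq' h.symm]
    refine Submodule.smul_mem _ _ (sub_mem (Submodule.smul_mem _ _
      (Submodule.subset_span ⟨{(n : ℕ)}, by simp, by simp [qMul]⟩))
      (Submodule.sum_mem _ fun i hi => ?_))
    rw [mem_range] at hi
    rw [coeff_euler, PowerSeries.coeff_mk]
    rcases Nat.eq_zero_or_pos i with h0 | h0
    · rw [h0, zero_smul, zero_mul]; exact zero_mem _
    · have h1 := coeff_genSeries (fun n : ℕ+ =>
        C ((1 - t ^ (n : ℕ)) / (n : K)) * (X n : SymFun K)) ⟨i, h0⟩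
      rw [PNat.mk_coe] at h1
      rw [h1, ← Nat.cast_smul_eq_nsmul K, smul_mul_assoc, ← smul_eq_C_mul, smul_mul_assoc]
      refine Submodule.smul_mem _ _ (Submodule.smul_mem _ _ ?_)
      have h2 := Submodule.mem_map_of_mem (f := LinearMap.mulRight K (qf t (n - i)))
        (ih ⟨i, h0⟩ hi)
      rw [Submodule.map_span, LinearMap.mulRight_apply] at h2
      refine Submodule.span_mono ?_ h2
      rintro _ ⟨_, ⟨M, h3, rfl⟩, rfl⟩
      refine ⟨(n - i : ℕ) ::ₘ M, ?_, by simp [mul_comm]⟩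
      rw [Multiset.sum_cons, h3, PNat.mk_coe]
      omega

include hroot in
lemma monomial_mem_span_qMul (u : ℕ+ →₀ ℕ) : (monomial u 1 : SymFun K) ∈ Submodule.span K
    {x | ∃ M : Multiset ℕ, M.sum = Finsupp.weight (fun i : ℕ+ => (i : ℕ)) u ∧ qMul t M = x} := by
  induction u using Finsupp.induction_linear with
  | zero => exact Submodule.subset_span ⟨0, by simp, by simp⟩
  | add u v hu hv =>
    rw [← one_mul (1 : K), ← monomial_mul]
    have h := Submodule.mul_mem_mul hu hv
    rw [Submodule.span_mul_span] at h
    refine Submodule.span_mono ?_ h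
    rintro _ ⟨_, ⟨M, h1, rfl⟩, _, ⟨M', h2, rfl⟩, rfl⟩
    exact ⟨M + M', by rw [Multiset.sum_add, h1, h2, map_add], by simp [qMul]⟩
  | single n k =>
    induction k with
    | zero => exact Submodule.subset_span ⟨0, by simp, by simp⟩
    | succ k ih =>
      have h := Submodule.mul_mem_mul ih (X_mem_span_qMul hroot n)
      rw [Submodule.span_mul_span] at h
      rw [X, monomial_mul, one_mul, ← Finsupp.single_add] at h
      refine Submodule.span_mono ?_ h
      rintro _ ⟨_, ⟨M, h1, rfl⟩, _, ⟨M', h2, rfl⟩, rfl⟩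
      refine ⟨M + M', ?_, by simp [qMul]⟩
      rw [Multiset.sum_add, h1, h2, Finsupp.single_add, map_add]
      simp [Finsupp.weight_single]

include hroot in
lemma IsHomog.mem_span_jingQ {f : SymFun K} {n : ℕ} (hf : IsHomog f n) :
    f ∈ Submodule.span K (Set.range (jingQ t : n.Partition → SymFun K)) := by
  have hq : ∀ lam : n.Partition, qMul t lam.parts ∈
      Submodule.span K (Set.range (jingQ t : n.Partition → SymFun K)) := fun lam => by
    rw [← sub_add_cancel (qMul t lam.parts) (jingQ t lam)]
    exact add_mem (Submodule.span_mono (Set.image_subset_range _ _) (qMul_sub_jingQ t lam))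
      (Submodule.subset_span ⟨lam, rfl⟩)
  refine IsWeightedHomogeneous.induction_on (w := fun i : ℕ+ => (i : ℕ)) (m := n)
    (motive := fun f _ => f ∈ Submodule.span K (Set.range (jingQ t : n.Partition → SymFun K)))
    (zero_mem _) (fun a b _ _ ha hb => add_mem ha hb) ?_ hf
  intro u c hu
  rw [← mul_one c, ← smul_eq_mul, ← smul_monomial]
  refine Submodule.smul_mem _ _ ((Submodule.span_le.2 ?_ : _ ≤ _) (monomial_mem_span_qMul hroot u))
  rintro _ ⟨M, hM, rfl⟩
  obtain ⟨mu, h1, _⟩ := exists_partition t M (hM.trans hu)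
  rw [← h1]
  exact hq mu

include hroot in
/-- Parseval's identity for the basis `Q_μ` of a homogeneous component. -/
lemma sum_form_jingQ (f : SymFun K) {g : SymFun K} {n : ℕ} (hg : IsHomog g n) :
    ∑ mu : n.Partition, form t f (jingQ t mu) * form t (jingQ t mu) g / b t mu = form t f g := by
  refine Submodule.span_induction (p := fun g _ => ∑ mu : n.Partition,
    form t f (jingQ t mu) * form t (jingQ t mu) g / b t mu = form t f g) ?_ ?_ ?_ ?_
    (hg.mem_span_jingQ hroot)
  · rintro _ ⟨lam, rfl⟩
    simp only [form_jingQ hroot]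
    rw [sum_eq_single lam]
    · rw [if_pos rfl, mul_div_assoc, div_self (b_ne_zero hroot lam), mul_one]
    · intro mu _ hmu
      rw [if_neg hmu, mul_zero, zero_div]
    · simp
  · simp
  · intro x y _ _ hx hy
    rw [map_add, ← hx, ← hy, ← sum_add_distrib]
    refine sum_congr rfl fun mu _ => ?_
    rw [map_add]; ring
  · intro c x _ hx
    rw [map_smul, ← hx, smul_eq_mul, mul_sum]
    refine sum_congr rfl fun mu _ => ?_
    rw [map_smul, smul_eq_mul]; ring

end Homogeneous

end HallLittlewood

namespace HallLittlewood

open Finset MvPolynomial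

/-! ### Existence and uniqueness of the Hall-Littlewood functions -/

section HallLittlewoodFunctions

variable {K : Type*} [Field K]

lemma derivation_prod {A ι : Type*} [CommRing A] [Algebra K A] [DecidableEq ι]
    (D : Derivation K A A) (s : Finset ι) (f : ι → A) :
    D (∏ i ∈ s, f i) = ∑ i ∈ s, (∏ j ∈ s.erase i, f j) * D (f i) := by
  induction s using Finset.induction_on with
  | empty => simp
  | insert a s ha ih =>
    rw [prod_insert ha, Derivation.leibniz, ih, sum_insert ha, erase_insert ha, smul_eq_mul,
      smul_eq_mul, mul_sum, add_comm]
    congr 1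
    refine sum_congr rfl fun i hi => ?_
    rw [erase_insert_of_ne (ne_of_mem_of_not_mem hi ha).symm, prod_insert
      (fun h => ha (mem_of_mem_erase h)), mul_assoc]

lemma psumNorm_ne_zero [CharZero K] {t : K} (hroot : ∀ n : ℕ, 1 ≤ n → t ^ n ≠ 1)
    (u : ℕ+ →₀ ℕ) : psumNorm t u ≠ 0 := by
  refine prod_ne_zero_iff.2 fun n _ => ?_
  have ht : 1 - t ^ (n : ℕ) ≠ 0 := sub_ne_zero.2 (hroot n n.pos).symm
  have hn : ((n : ℕ) : K) ≠ 0 := by exact_mod_cast n.ne_zero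
  have hk : ((u n).factorial : K) ≠ 0 := by exact_mod_cast Nat.factorial_ne_zero _
  dsimp only
  rw [zero_pow n.ne_zero, sub_zero]
  exact mul_ne_zero (mul_ne_zero (pow_ne_zero _ hn) hk) (pow_ne_zero _ (one_div_ne_zero ht))

/-- The Hall-Littlewood functions `P_λ = b_λ(t)^{-1} Q_λ`. -/
noncomputable def hallP (t : K) (n : ℕ) (lam : n.Partition) : SymFun K :=
  (b t lam)⁻¹ • jingQ t lam

lemma Q_hallP {t : K} (hroot : ∀ n : ℕ, 1 ≤ n → t ^ n ≠ 1) {n : ℕ}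
    (lam : n.Partition) : Q t (hallP t) lam = jingQ t lam := by
  rw [Q, hallP, smul_inv_smul₀ (b_ne_zero hroot lam)]

/-- The strict dominance order. -/
def StrictDom {n : ℕ} (lam mu : n.Partition) : Prop := Dominates lam mu ∧ mu ≠ lam

lemma eq_of_forall_sum_take {L M : List ℕ} (hL : ∀ r ∈ L, 0 < r) (hM : ∀ r ∈ M, 0 < r)
    (h : ∀ k, (L.take k).sum = (M.take k).sum) : L = M := by
  induction L generalizing M with
  | nil =>
    rcases M with _ | ⟨m, M⟩
    · rfl
    · have := h 1
      have := hM m List.mem_cons_self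
      simp at *; omega
  | cons a L ih =>
    rcases M with _ | ⟨m, M⟩
    · have := h 1
      have := hL a List.mem_cons_self
      simp at *; omega
    · have h1 : a = m := by simpa using h 1
      subst h1
      rw [ih (M := M) (fun r hr => hL r (List.mem_cons_of_mem _ hr))
        (fun r hr => hM r (List.mem_cons_of_mem _ hr))]
      intro k
      simpa using h (k + 1)

lemma StrictDom.trans {n : ℕ} {a b c : n.Partition} (h : StrictDom a b) (h' : StrictDom b c) :
    StrictDom a c := by
  refine ⟨fun k => (h'.1 k).trans (h.1 k), ?_⟩
  rintro rfl
  apply h.2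
  apply rows_injective
  exact eq_of_forall_sum_take (rows_pos _) (rows_pos _) fun k => le_antisymm (h.1 k) (h'.1 k)

/-- A symmetric function as the family of its images in finitely many variables. -/
noncomputable def allVars : SymFun K →ₗ[K] (∀ N : ℕ, MvPolynomial (Fin N) K) :=
  LinearMap.pi fun N => (toVars N).toLinearMap

lemma IsHallLittlewood.allVars_sub_mem_span {t : K} {P : ∀ n : ℕ, n.Partition → SymFun K}
    (hP : IsHallLittlewood t P) {n : ℕ} (lam : n.Partition) :
    allVars (P n lam) - (fun N => msymm (Fin N) K lam) ∈ Submodule.span K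
      ((fun (mu : n.Partition) N => msymm (Fin N) K mu) '' {mu | StrictDom lam mu}) := by
  obtain ⟨c, hc, h⟩ := hP.2 n lam
  have h1 : allVars (P n lam) - (fun N => msymm (Fin N) K lam) =
      ∑ mu, c mu • fun N => msymm (Fin N) K mu := by
    funext N
    rw [Pi.sub_apply, Finset.sum_apply]
    change toVars N (P n lam) - _ = _
    rw [h N, add_sub_cancel_left]
    rfl
  rw [h1]
  refine Submodule.sum_mem _ fun mu _ => ?_
  by_cases h0 : c mu = 0
  · rw [h0, zero_smul]; exact zero_mem _
  · exact Submodule.smul_mem _ _ (Submodule.subset_span ⟨mu, hc mu h0, rfl⟩)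

variable [CharZero K]

lemma constantCoeff_qf (t : K) (k : ℕ) : constantCoeff (qf t k) = if k = 0 then 1 else 0 := by
  have h := isExp_map_qf t (constantCoeff (R := K) (σ := ℕ+))
  rw [show (fun n : ℕ+ => constantCoeff (C ((1 - t ^ (n : ℕ)) / (n : K)) * (X n : SymFun K))) = 0 by
    funext n; simp] at h
  simpa [PowerSeries.coeff_one] using congrArg (PowerSeries.coeff k) ((isExp_zero_iff K).1 h)

lemma pderiv_qf (t : K) (n : ℕ+) (k : ℕ) : pderiv n (qf t k) =
    if (n : ℕ) ≤ k then C ((1 - t ^ (n : ℕ)) / (n : K)) * qf t (k - n) else 0 := by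
  set c : SymFun K := C ((1 - t ^ (n : ℕ)) / (n : K)) with hc
  set a : ℕ+ → SymFun K := fun n : ℕ+ => C ((1 - t ^ (n : ℕ)) / (n : K)) * X n with ha
  set F : PowerSeries (SymFun K) := PowerSeries.mk (qf t) with hF
  set S : PowerSeries (SymFun K) := PowerSeries.C c * PowerSeries.X ^ (n : ℕ) with hS
  obtain ⟨h0, h1⟩ := isExp_qf t
  rw [← hF] at h0 h1
  have hSe : euler S = (n : ℕ) • S := by
    ext1 k
    rw [coeff_euler, map_nsmul, hS, PowerSeries.coeff_C_mul_X_pow]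
    split_ifs with h
    · rw [h]
    · simp
  have hL : ∀ i, pderiv n (PowerSeries.coeff i (euler (genSeries a))) =
      PowerSeries.coeff i ((n : ℕ) • S) := by
    intro i
    rw [coeff_euler, map_nsmul, map_nsmul, hS, PowerSeries.coeff_C_mul_X_pow]
    rcases i with _ | i
    · simp [n.ne_zero.symm]
    · have h2 : PowerSeries.coeff (i + 1) (genSeries a) = a i.succPNat :=
        coeff_genSeries a i.succPNat
      rw [h2, ha]
      simp only [Derivation.leibniz, pderiv_C, pderiv_X, smul_eq_mul]
      by_cases h : i + 1 = (n : ℕ)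
      · have hn : n = i.succPNat := PNat.coe_injective h.symm
        subst hn
        simp [hc]
      · have hn : n ≠ i.succPNat := fun h' => h (by rw [h']; rfl)
        rw [Pi.single_eq_of_ne (Ne.symm hn), if_neg h]
        simp
  have key : PowerSeries.mk (fun k => pderiv n (qf t k)) = S * F := by
    refine eq_of_euler_eq K (a := a) (B := ((n : ℕ) • S) * F) ?_ ?_ ?_
    · rw [PowerSeries.coeff_mk, hS, mul_assoc, PowerSeries.coeff_C_mul,
        PowerSeries.coeff_X_pow_mul', if_neg (by simp), mul_zero, qf_zero, ← C_1, pderiv_C]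
    · ext1 k
      rw [coeff_euler, PowerSeries.coeff_mk, ← map_nsmul, map_add, PowerSeries.coeff_mul,
        PowerSeries.coeff_mul, ← sum_add_distrib]
      have h2 := congrArg (PowerSeries.coeff k) h1
      rw [coeff_euler, PowerSeries.coeff_mul, hF, PowerSeries.coeff_mk] at h2
      rw [h2, map_sum]
      refine sum_congr rfl fun p _ => ?_
      rw [Derivation.leibniz, hL, PowerSeries.coeff_mk, PowerSeries.coeff_mk, smul_eq_mul,
        smul_eq_mul]
      ring
    · rw [euler_mul, hSe, h1]; ring
  have h2 := congrArg (PowerSeries.coeff k) key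
  rw [PowerSeries.coeff_mk] at h2
  rw [h2, hS, mul_assoc, PowerSeries.coeff_C_mul, PowerSeries.coeff_X_pow_mul']
  split_ifs
  · rw [hF, PowerSeries.coeff_mk]
  · rw [mul_zero]

variable {t : K} (hroot : ∀ n : ℕ, 1 ≤ n → t ^ n ≠ 1)

include hroot in
/-- The coefficients of a symmetric function in `N` variables are its products with the
monomials in the `q_k`. -/
lemma coeff_toVars {N : ℕ} (f : SymFun K) (al : Fin N →₀ ℕ) :
    (toVars N f).coeff al = form t f (∏ i, qf t (al i)) := by
  induction f using MvPolynomial.induction_on generalizing al with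
  | C c =>
    have h : toVars N (C c : SymFun K) = C c := (toVars N).commutes c
    rw [h, form_C, coeff_C, map_prod]
    simp only [constantCoeff_qf]
    split_ifs with h0
    · subst h0; simp
    · obtain ⟨i, hi⟩ := Finsupp.ne_iff.1 (Ne.symm h0)
      rw [prod_eq_zero (mem_univ i) (by simpa using hi), mul_zero]
  | add f g hf hg => rw [map_add, coeff_add, hf, hg, map_add, LinearMap.add_apply]
  | mul_X f n hf =>
    have hX : toVars N (X n : SymFun K) = ∑ i, monomial (Finsupp.single i (n : ℕ)) 1 := by
      rw [toVars, aeval_X, psum]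
      simp [X_pow_eq_monomial]
    have ht : 1 - t ^ (n : ℕ) ≠ 0 := sub_ne_zero.2 (hroot n n.pos).symm
    have hn : ((n : ℕ) : K) ≠ 0 := by exact_mod_cast n.ne_zero
    -- The sum p_n = ∑ x_i^n on one side matches the Leibniz rule for ∂/∂p_n on ∏ q_{α_i} on the
    -- other, term by term in i.
    rw [map_mul, hX, mul_sum, coeff_sum, mul_comm f, form_X_mul, derivation_prod, map_sum, mul_sum]
    refine sum_congr rfl fun i _ => ?_
    rw [coeff_mul_monomial', pderiv_qf, if_congr Finsupp.single_le_iff rfl rfl]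
    split_ifs with h
    · have h2 : ∏ j, qf t ((al - Finsupp.single i (n : ℕ)) j) =
          (∏ j ∈ univ.erase i, qf t (al j)) * qf t (al i - n) := by
        rw [← mul_prod_erase _ _ (mem_univ i), mul_comm]
        congr 1
        · refine prod_congr rfl fun j hj => ?_
          simp [(ne_of_mem_erase hj).symm]
        · simp
      rw [mul_one, hf, h2, mul_left_comm, ← smul_eq_C_mul, map_smul, smul_eq_mul, ← mul_assoc,
        div_mul_div_cancel₀ ht, div_self hn, one_mul]
    · simp

include hroot in
-- Equality in all finite numbers of variables gives equal pairings with every product q_M. These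
-- products span, and the form is nondegenerate.
lemma eq_of_forall_toVars {f g : SymFun K} (h : ∀ N, toVars N f = toVars N g) : f = g := by
  have h1 : ∀ M : Multiset ℕ, form t (f - g) (qMul t M) = 0 := by
    intro M
    induction M using Quotient.inductionOn with
    | _ L =>
    -- One variable is used per entry of L, with that entry as its exponent.
    have h2 := coeff_toVars hroot (N := L.length) (f - g) (Finsupp.equivFunOnFinite.symm L.get)
    rw [map_sub, h, sub_self, coeff_zero] at h2
    rw [h2]
    congr 1
    simp only [Finsupp.equivFunOnFinite_symm_apply_apply, List.get_eq_getElem, qMul,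
      Multiset.quot_mk_to_coe, Multiset.map_coe, Multiset.prod_coe]
    rw [← List.prod_ofFn]
    congr 1
    exact (List.ofFn_getElem_eq_map L (qf t)).symm
  rw [← sub_eq_zero]
  ext u
  rw [coeff_zero]
  have h3 : form t (f - g) (monomial u 1) = 0 := by
    have h4 : Submodule.span K {x | ∃ M : Multiset ℕ,
        M.sum = Finsupp.weight (fun i : ℕ+ => (i : ℕ)) u ∧ qMul t M = x} ≤
        LinearMap.ker (form t (f - g)) := by
      rw [Submodule.span_le]
      rintro _ ⟨M, _, rfl⟩
      exact h1 M
    exact h4 (monomial_mem_span_qMul hroot u)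
  rw [form_symm, form_monomial, one_mul] at h3
  exact (mul_eq_zero.1 h3).resolve_right (psumNorm_ne_zero hroot u)

include hroot in
/-- The expansion of a homogeneous symmetric function in the monomial symmetric functions. -/
lemma toVars_eq_sum_msymm {f : SymFun K} {n : ℕ} (hf : IsHomog f n) (N : ℕ) :
    toVars N f = ∑ mu : n.Partition, form t f (qMul t mu.parts) • msymm (Fin N) K mu := by
  have h1 : ∀ s : Sym (Fin N) n, qMul t (Nat.Partition.ofSym s).parts =
      ∏ i, qf t (Multiset.toFinsupp (s : Multiset (Fin N)) i) := by
    intro s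
    have : (Nat.Partition.ofSym s).parts =
        (s : Multiset (Fin N)).toFinset.val.map fun i => (s : Multiset (Fin N)).count i := rfl
    rw [this, qMul, Multiset.map_map]
    change ∏ i ∈ (s : Multiset (Fin N)).toFinset, qf t ((s : Multiset (Fin N)).count i) = _
    simp only [Multiset.toFinsupp_apply]
    refine prod_subset (subset_univ _) fun i _ hi => ?_
    rw [Multiset.mem_toFinset] at hi
    rw [Multiset.count_eq_zero_of_notMem hi, qf_zero]
  have h2 : ∀ s : Sym (Fin N) n, ((s : Multiset (Fin N)).map (X : Fin N → MvPolynomial (Fin N) K)).prod =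
      monomial (Multiset.toFinsupp (s : Multiset (Fin N))) 1 := by
    intro s
    rw [monomial_eq, C_1, one_mul, Finsupp.prod, Finset.prod_multiset_map_count]
    simp
  have h3 : ∑ mu : n.Partition, form t f (qMul t mu.parts) • msymm (Fin N) K mu =
      ∑ s : Sym (Fin N) n, form t f (qMul t (Nat.Partition.ofSym s).parts) •
        monomial (Multiset.toFinsupp (s : Multiset (Fin N))) (1 : K) := by
    rw [← Fintype.sum_fiberwise (fun s : Sym (Fin N) n => Nat.Partition.ofSym s)]
    refine sum_congr rfl fun mu _ => ?_
    rw [msymm, smul_sum]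
    refine sum_congr rfl fun s _ => ?_
    rw [s.2]
    congr 1
    exact h2 s.1
  rw [h3]
  ext al
  rw [coeff_toVars hroot, coeff_sum]
  simp only [h1, coeff_smul, coeff_monomial, smul_eq_mul, mul_ite, mul_one, mul_zero]
  by_cases hal : Multiset.card (Finsupp.toMultiset al) = n
  · refine Eq.symm ((sum_eq_single (⟨Finsupp.toMultiset al, hal⟩ : Sym (Fin N) n) ?_ ?_).trans ?_)
    rotate_right
    · simp
    · intro s _ hs
      rw [if_neg]
      rintro rfl
      apply hs
      apply Subtype.ext
      simp
      rfl
    · exact fun h => absurd (mem_univ (α := Sym (Fin N) n) _) h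
  · rw [sum_eq_zero]
    · refine form_eq_zero_of_ne t hf (n := ∑ i, al i) ?_ ?_
      · exact IsWeightedHomogeneous.prod _ _ _ fun i _ => isHomog_qf t (al i)
      · intro h
        apply hal
        rw [h, Finsupp.card_toMultiset, Finsupp.sum_fintype _ _ (by simp)]
        rfl
    · intro s _
      rw [if_neg]
      rintro rfl
      apply hal
      simp

lemma isHomog_hallP (t : K) {n : ℕ} (lam : n.Partition) : IsHomog (hallP t n lam) n := by
  rw [hallP, smul_eq_C_mul]
  exact (isHomog_jingQ t lam).C_mul _

include hroot in
lemma form_hallP {n : ℕ} (lam mu : n.Partition) :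
    form t (hallP t n lam) (jingQ t mu) = if lam = mu then 1 else 0 := by
  rw [hallP, map_smul, LinearMap.smul_apply, form_jingQ hroot, smul_eq_mul]
  split_ifs
  · exact inv_mul_cancel₀ (b_ne_zero hroot lam)
  · exact mul_zero _

include hroot in
lemma form_hallP_hallP (x y : Σ n : ℕ, n.Partition) (h : x ≠ y) :
    form t (hallP t x.1 x.2) (hallP t y.1 y.2) = 0 := by
  obtain ⟨m, lam⟩ := x
  obtain ⟨n, mu⟩ := y
  by_cases hmn : m = n
  · subst hmn
    have hne : lam ≠ mu := fun h' => h (by rw [h'])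
    have h1 : hallP t m mu = (b t mu)⁻¹ • jingQ t mu := rfl
    dsimp only
    rw [h1, map_smul, form_hallP hroot, if_neg hne, smul_zero]
  · exact form_eq_zero_of_ne t (isHomog_hallP t lam) (isHomog_hallP t mu) hmn

include hroot in
-- These pairings are the coefficients of P_λ in the m_μ. The inverse triangularity q_μ = Q_μ +
-- larger terms and the duality of P_λ with Q_μ leave only μ = λ and μ below λ.
lemma form_hallP_qMul {n : ℕ} (lam mu : n.Partition) :
    (lam = mu → form t (hallP t n lam) (qMul t mu.parts) = 1) ∧
    (lam ≠ mu → form t (hallP t n lam) (qMul t mu.parts) ≠ 0 →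
      ExcessLT mu.parts lam.parts) := by
  have h : ∀ x ∈ Submodule.span K (jingQ t '' {nu : n.Partition | ExcessLT mu.parts nu.parts}),
      ¬ ExcessLT mu.parts lam.parts → form t (hallP t n lam) x = 0 := by
    intro x hx hlt
    have : Submodule.span K (jingQ t '' {nu : n.Partition | ExcessLT mu.parts nu.parts}) ≤
        LinearMap.ker (form t (hallP t n lam)) := by
      rw [Submodule.span_le]
      rintro _ ⟨nu, hnu, rfl⟩
      change form t (hallP t n lam) (jingQ t nu) = 0
      rw [form_hallP hroot, if_neg]
      rintro rfl
      exact hlt hnu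
    exact this hx
  have h1 : form t (hallP t n lam) (qMul t mu.parts) =
      (if lam = mu then 1 else 0) +
        form t (hallP t n lam) (qMul t mu.parts - jingQ t mu) := by
    rw [map_sub, form_hallP hroot]; ring
  refine ⟨?_, fun hne h0 => ?_⟩
  · rintro rfl
    rw [h1, if_pos rfl, h _ (qMul_sub_jingQ t lam) fun h' => h'.ne rfl, add_zero]
  · by_contra hlt
    rw [h1, if_neg hne, h _ (qMul_sub_jingQ t mu) hlt, add_zero] at h0
    exact h0 rfl

include hroot in
lemma isHallLittlewood_hallP : IsHallLittlewood t (hallP t) := by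
  refine ⟨fun x y h => form_hallP_hallP hroot x y h, fun n lam => ?_⟩
  classical
  refine ⟨fun mu => if lam = mu then 0 else form t (hallP t n lam) (qMul t mu.parts),
    fun mu hmu => ?_, fun N => ?_⟩
  · dsimp only at hmu
    split_ifs at hmu with h
    · exact absurd rfl hmu
    · exact ⟨((form_hallP_qMul hroot lam mu).2 h hmu).dominates, fun h' => h h'.symm⟩
  · rw [toVars_eq_sum_msymm hroot (isHomog_hallP t lam) N, ← add_sum_erase _ _ (mem_univ lam),
      ← add_sum_erase _ _ (mem_univ lam), (form_hallP_qMul hroot lam lam).1 rfl, one_smul]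
    dsimp only
    rw [if_pos rfl, zero_smul, zero_add]
    congr 1
    refine sum_congr rfl fun mu hmu => ?_
    rw [if_neg (ne_of_mem_erase hmu).symm]

include hroot in
lemma allVars_injective : Function.Injective (allVars : SymFun K →ₗ[K] _) := fun _ _ h =>
  eq_of_forall_toVars hroot fun N => congrFun h N

include hroot in
-- Both families are unitriangular over the m_μ in finitely many variables, hence over each other;
-- injectivity of `allVars` brings the relation back to Λ.
lemma IsHallLittlewood.sub_mem_span {P P' : ∀ n : ℕ, n.Partition → SymFun K}
    (hP : IsHallLittlewood t P) (hP' : IsHallLittlewood t P') {n : ℕ} (lam : n.Partition) :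
    P n lam - P' n lam ∈ Submodule.span K (P' n '' {mu | StrictDom lam mu}) := by
  have h1 := fun lam : n.Partition => sub_mem_span_of_unitriangular
    (r := fun lam mu : n.Partition => StrictDom lam mu)
    (fun _ _ _ h h' => h.trans h') (fun _ h => h.2 rfl) (x := fun lam => allVars (P' n lam))
    (y := fun (mu : n.Partition) N => msymm (Fin N) K mu)
    (fun lam => hP'.allVars_sub_mem_span lam) lam
  have h2 : allVars (P n lam) - allVars (P' n lam) ∈
      Submodule.span K ((fun mu => allVars (P' n mu)) '' {mu | StrictDom lam mu}) := by
    rw [← sub_add_sub_cancel _ (fun N => msymm (Fin N) K lam)]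
    refine add_mem ((Submodule.span_le.2 ?_ : _ ≤ _) (hP.allVars_sub_mem_span lam)) (h1 lam)
    rintro _ ⟨mu, hmu, rfl⟩
    dsimp only
    rw [← sub_add_cancel (fun N => msymm (Fin N) K mu) (allVars (P' n mu))]
    refine add_mem (Submodule.span_mono (Set.image_mono fun nu hnu => ?_) (h1 mu))
      (Submodule.subset_span ⟨mu, hmu, rfl⟩)
    exact StrictDom.trans hmu hnu
  rw [← map_sub, show (fun mu => allVars (P' n mu)) '' {mu : n.Partition | StrictDom lam mu} =
    allVars '' (P' n '' {mu | StrictDom lam mu}) by rw [Set.image_image], ← Submodule.map_span] at h2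
  obtain ⟨x, hx, hx'⟩ := h2
  rwa [← allVars_injective hroot hx']

include hroot in
lemma eq_zero_of_forall_form {f : SymFun K} (h : ∀ g, form t g f = 0) : f = 0 := by
  ext u
  have h1 := h (monomial u 1)
  rw [form_monomial, one_mul] at h1
  exact (mul_eq_zero.1 h1).resolve_right (psumNorm_ne_zero hroot u)

include hroot in
-- The difference d of the two candidates lies in the span of the P_μ with μ < λ. By induction these
-- agree for both families, so d is orthogonal to them; it is orthogonal to the remaining Q_μ
-- because they are orthogonal to that span. Parseval then gives d = 0.
lemma IsHallLittlewood.eq_hallP {P : ∀ n : ℕ, n.Partition → SymFun K}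
    (hP : IsHallLittlewood t P) : P = hallP t := by
  funext n lam
  have hwf : WellFounded fun mu lam : n.Partition => StrictDom lam mu := by
    have : IsTrans n.Partition fun mu lam => StrictDom lam mu := ⟨fun _ _ _ h1 h2 => h2.trans h1⟩
    have : Std.Irrefl fun mu lam : n.Partition => StrictDom lam mu := ⟨fun _ h => h.2 rfl⟩
    exact Finite.wellFounded_of_trans_of_irrefl _
  induction lam using hwf.induction with
  | _ lam ih =>
    have hd := hP.sub_mem_span hroot (isHallLittlewood_hallP hroot) lam
    set d := P n lam - hallP t n lam with hdef
    have hhom : IsHomog d n := by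
      have : Submodule.span K (hallP t n '' {mu | StrictDom lam mu}) ≤
          weightedHomogeneousSubmodule K (fun i : ℕ+ => (i : ℕ)) n := by
        rw [Submodule.span_le]
        rintro _ ⟨mu, _, rfl⟩
        exact isHomog_hallP t mu
      exact this hd
    have hQ : ∀ mu : n.Partition, jingQ t mu = b t mu • hallP t n mu := fun mu => by
      rw [hallP, smul_inv_smul₀ (b_ne_zero hroot mu)]
    have h0 : ∀ mu : n.Partition, form t (jingQ t mu) d = 0 := by
      intro mu
      by_cases hmu : StrictDom lam mu
      · rw [hQ, hdef, map_smul, LinearMap.smul_apply, map_sub]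
        have hne : mu ≠ lam := hmu.2
        have hne' : (⟨n, mu⟩ : Σ n : ℕ, n.Partition) ≠ ⟨n, lam⟩ := fun h' => hne (by simpa using h')
        have h1 : form t (hallP t n mu) (P n lam) = 0 := by
          rw [← ih mu hmu]
          exact hP.1 ⟨n, mu⟩ ⟨n, lam⟩ hne'
        rw [h1, form_hallP_hallP hroot ⟨n, mu⟩ ⟨n, lam⟩ hne', sub_zero, smul_zero]
      · have : Submodule.span K (hallP t n '' {mu | StrictDom lam mu}) ≤
            LinearMap.ker (form t (jingQ t mu)) := by
          rw [Submodule.span_le]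
          rintro _ ⟨nu, hnu, rfl⟩
          change form t (jingQ t mu) (hallP t n nu) = 0
          rw [form_symm, form_hallP hroot, if_neg]
          rintro rfl
          exact hmu hnu
        exact this hd
    rw [← sub_eq_zero]
    refine eq_zero_of_forall_form hroot fun g => ?_
    rw [← sum_form_jingQ hroot g hhom]
    refine sum_eq_zero fun mu _ => ?_
    rw [h0, mul_zero, zero_div]

include hroot in
lemma existsUnique_isHallLittlewood :
    ∃! P : (∀ n : ℕ, n.Partition → SymFun K), IsHallLittlewood t P :=
  ⟨hallP t, isHallLittlewood_hallP hroot, fun _ hP => IsHallLittlewood.eq_hallP hroot hP⟩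

lemma parts_oneRow (s : ℕ) : (oneRow s).parts = if s = 0 then 0 else {s} := by
  split_ifs with h
  · subst h; simp [oneRow]
  · exact Nat.Partition.indiscrete_parts h

lemma jingQ_oneRow (t : K) (s : ℕ) : jingQ t (oneRow s) = qf t s := by
  rw [jingQ, rows, parts_oneRow]
  split_ifs with h
  · subst h; simp
  · rw [Multiset.sort_singleton, jingVec_singleton]

lemma sum_rows_eq {n : ℕ} (lam : n.Partition) :
    ∑ i ∈ range (rows lam).length, (1 + i) * (rows lam).getD i 0 = n + nStat lam := by
  have h : ∑ i ∈ range (rows lam).length, (rows lam).getD i 0 = n := by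
    refine Eq.trans ?_ (rows_sum lam)
    generalize rows lam = L
    induction L with
    | nil => simp
    | cons a L ih => rw [List.length_cons, sum_range_succ']; simpa [add_comm] using ih
  simp only [add_mul, one_mul, sum_add_distrib]
  rw [h, rows_length]
  rfl

include hroot in
lemma form_negP_jingQ (ht : t ≠ 0) {s : ℕ} (lam : s.Partition) :
    form t (negP (jingQ t (oneRow s))) (jingQ t lam) =
      t ^ (s + nStat lam) * ∏ k ∈ Icc 1 (length lam), (1 - (t ^ k)⁻¹) := by
  have h := form_rf_jingVec hroot ht (rows lam) (rows_pos lam)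
  rw [rows_sum, sum_rows_eq, rows_length] at h
  rw [jingQ_oneRow]
  refine h.trans ?_
  congr 1
  rw [← Finset.Ico_add_one_right_eq_Icc, prod_Ico_eq_prod_range, Nat.add_sub_cancel]

end HallLittlewoodFunctions

end HallLittlewood

namespace HallLittlewood

open Finset MvPolynomial

/-! ### The free field realization -/

section FreeField

variable {K : Type*} [Field K]

/-- The substitution `p_n ↦ ∑_i c_i b^{(i)}_{-n}`. -/
noncomputable def emb (c : Fin 2 → K) : SymFun K →ₐ[K] Fock K :=
  aeval fun n : ℕ+ => ∑ i, C (c i) * X (i, n)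

lemma emb_X (c : Fin 2 → K) (n : ℕ+) : emb c (X n) = ∑ i, C (c i) * X (i, n) := by
  simp [emb]

/-- The translation `b^{(i)}_{-n} ↦ b^{(i)}_{-n} - d_i z^n` of the Fock space. -/
noncomputable def fockShift (d : Fin 2 → K) : Fock K →ₐ[K] Polynomial (Fock K) :=
  shift Prod.snd fun p => -d p.1

lemma fockShift_X (d : Fin 2 → K) (p : Fin 2 × ℕ+) :
    fockShift d (X p) = Polynomial.C (X p) + Polynomial.monomial (p.2 : ℕ) (C (-d p.1)) :=
  shift_X _ _ _

lemma fockShift_C (d : Fin 2 → K) (a : K) : fockShift d (C a) = Polynomial.C (C a) :=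
  (fockShift d).commutes a

/-- A shift along d moves the embedded p_n by -(∑ c_i d_i) z^n, so the vertex operator sees an
embedded symmetric function only through this pairing. -/
lemma fockShift_emb (c d : Fin 2 → K) (f : SymFun K) :
    fockShift d (emb c f) = (translate (-∑ i, c i * d i) f).map (emb c).toRingHom := by
  have : (fockShift d).comp (emb c) =
      (Polynomial.mapAlgHom (emb c)).comp (translate (-∑ i, c i * d i)) := by
    apply MvPolynomial.algHom_ext
    intro n
    have hC : emb c (C (-∑ i, c i * d i)) = C (-∑ i, c i * d i) := (emb c).commutes _
    simp only [AlgHom.comp_apply, emb_X, translate_X, map_add,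
      Polynomial.coe_mapAlgHom, Polynomial.map_C, Polynomial.map_monomial,
      map_sum, map_mul, fockShift_C, fockShift_X, RingHom.coe_coe, hC]
    simp only [← Polynomial.C_mul_X_pow_eq_monomial, mul_add, sum_add_distrib, ← mul_assoc,
      ← map_mul, ← sum_mul, ← map_sum, mul_neg, sum_neg_distrib]
  exact congrArg (fun φ : SymFun K →ₐ[K] Polynomial (Fock K) => φ f) this

lemma translate_zero (f : SymFun K) : translate 0 f = Polynomial.C f := by
  have : translate (0 : K) = (Polynomial.CAlgHom : SymFun K →ₐ[SymFun K] _).restrictScalars K := by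
    apply MvPolynomial.algHom_ext
    intro n
    rw [translate_X]
    simp
  exact congrArg (fun φ : SymFun K →ₐ[K] Polynomial (SymFun K) => φ f) this

lemma fockShift_emb_of_eq_zero {c d : Fin 2 → K} (h : ∑ i, c i * d i = 0) (f : SymFun K) :
    fockShift d (emb c f) = Polynomial.C (emb c f) := by
  rw [fockShift_emb, h, neg_zero, translate_zero, Polynomial.map_C]
  rfl

/-- The coefficient of `z^m` in the vertex operator
`exp (∑ (1 - t^n)/n z^n ∑_i c_i b^{(i)}_{-n}) exp (-∑ z^{-n} ∑_i d_i ∂/∂b^{(i)}_{-n})`. -/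
noncomputable def fockJing (t : K) (c d : Fin 2 → K) (m : ℤ) (f : Fock K) : Fock K :=
  pairCoeff (zext fun k => emb c (qf t k)) m (fockShift d f)

/-- When the pairing is 1, the operator acts on the copy of Λ along c as H itself, and factors
invariant under the shift pass through as scalars. -/
lemma fockJing_emb_mul (t : K) {c d : Fin 2 → K} (h : ∑ i, c i * d i = 1) (m : ℤ) (f : SymFun K)
    {g : Fock K} (hg : fockShift d g = Polynomial.C g) :
    fockJing t c d m (emb c f * g) = emb c (jing t m f) * g := by
  rw [fockJing, map_mul, hg, fockShift_emb, h, mul_comm, pairCoeff_C_mul, mul_comm]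
  congr 1
  have := pairCoeff_map (emb c).toRingHom (zext (qf t)) m (translate (-1) f)
  refine Eq.trans ?_ this
  congr 1
  funext n
  exact (map_zext (emb c).toRingHom (qf t) n).symm

/-- The specialization of the Fock space which kills the second boson. -/
noncomputable def evalFst : Fock K →ₐ[K] SymFun K :=
  aeval fun p : Fin 2 × ℕ+ => if p.1 = 0 then X p.2 else 0

lemma evalFst_emb (c : Fin 2 → K) (f : SymFun K) :
    evalFst (emb c f) = aeval (fun n : ℕ+ => C (c 0) * (X n : SymFun K)) f := by
  have : evalFst.comp (emb c) = aeval fun n : ℕ+ => C (c 0) * (X n : SymFun K) := by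
    apply MvPolynomial.algHom_ext
    intro n
    rw [AlgHom.comp_apply, emb_X, Fin.sum_univ_two]
    simp [evalFst]
  exact congrArg (fun φ : SymFun K →ₐ[K] SymFun K => φ f) this

lemma evalFst_emb_one (f : SymFun K) : evalFst (emb ![1, 0] f) = f := by
  rw [evalFst_emb]
  simp

lemma evalFst_emb_neg_one (f : SymFun K) : evalFst (emb ![-1, 1] f) = negP f := by
  rw [evalFst_emb]
  simp [negP]

lemma evalFst_emb_zero (f : SymFun K) : evalFst (emb ![0, 1] f) = C (constantCoeff f) := by
  rw [evalFst_emb]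
  simpa using aeval_zero' (S₁ := SymFun K) f

lemma constantCoeff_evalFst (f : Fock K) : constantCoeff (evalFst f) = constantCoeff f := by
  have : (constantCoeff.comp (evalFst : Fock K →ₐ[K] SymFun K).toRingHom) = constantCoeff := by
    apply MvPolynomial.ringHom_ext
    · intro a
      have hC : evalFst (C a : Fock K) = C a := evalFst.commutes a
      simp [hC]
    · intro p
      simp only [evalFst, AlgHom.toRingHom_eq_coe, RingHom.comp_apply, RingHom.coe_coe, aeval_X]
      split_ifs <;> simp
  exact congrArg (fun φ : Fock K →+* K => φ f) this

/-- Here only the first boson is created or annihilated, so the second may be set to 0 beforehand.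
-/
lemma evalFst_fockJing (t : K) (m : ℤ) (f : Fock K) :
    evalFst (fockJing t ![1, 0] ![1, 0] m f) = jing t m (evalFst f) := by
  have h : (fockShift ![1, 0] f).map (evalFst : Fock K →ₐ[K] SymFun K).toRingHom =
      translate (-1) (evalFst f) := by
    have : (Polynomial.mapAlgHom (evalFst : Fock K →ₐ[K] SymFun K)).comp (fockShift ![1, 0]) =
        (translate (-1)).comp evalFst := by
      apply MvPolynomial.algHom_ext
      rintro ⟨i, n⟩
      have hC : ∀ a : K, evalFst (C a) = C a := fun a => evalFst.commutes a
      fin_cases i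
      · simp [fockShift_X, evalFst, translate_X]
      · simp [fockShift_X, evalFst]
    exact congrArg (fun φ : Fock K →ₐ[K] Polynomial (SymFun K) => φ f) this
  have h2 := pairCoeff_map (evalFst : Fock K →ₐ[K] SymFun K).toRingHom
    (zext fun k => emb ![1, 0] (qf t k)) m (fockShift ![1, 0] f)
  rw [h] at h2
  refine h2.symm.trans ?_
  rw [jing]
  congr 1
  funext n
  rw [map_zext]
  congr 1
  funext k
  exact evalFst_emb_one _

variable [CharZero K]

lemma expCoeff_mulLeft_emb (t : K) (c : Fin 2 → K) (k : ℕ) (f : Fock K) :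
    expCoeff (fun n => LinearMap.mulLeft K (C ((1 - t ^ (n : ℕ)) / (n : K)) * emb c (X n))) k f =
      emb c (qf t k) * f := by
  rw [expCoeff_eq_expSum, expSum_mulLeft, LinearMap.mulLeft_apply]
  congr 1
  have h1 := isExp_expSum (K := K)
    (a := fun n : ℕ+ => C ((1 - t ^ (n : ℕ)) / (n : K)) * emb c (X n)) fun _ _ => Commute.all _ _
  have h2 := isExp_map_qf t (emb c).toRingHom
  have h3 : (fun n : ℕ+ => (emb c).toRingHom (C ((1 - t ^ (n : ℕ)) / (n : K)) * X n)) =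
      fun n : ℕ+ => C ((1 - t ^ (n : ℕ)) / (n : K)) * emb c (X n) := by
    funext n
    have hC : ∀ a : K, emb c (C a) = C a := fun a => (emb c).commutes a
    simp [hC]
  rw [h3] at h2
  simpa using congrArg (PowerSeries.coeff k) (h1.unique K h2)

lemma mode_eq_fockJing (t : K) (c d : Fin 2 → K) {al be : ℕ+ → Module.End K (Fock K)}
    (hal : ∀ n : ℕ+, al n = LinearMap.mulLeft K (C ((1 - t ^ (n : ℕ)) / (n : K)) * emb c (X n)))
    (hbe : ∀ n : ℕ+, be n = -∑ i, d i • (pderiv (i, n)).toLinearMap) (m : ℤ) (f : Fock K) :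
    mode al be m f = fockJing t c d (-m) f := by
  refine mode_eq_pairCoeff (fun k f => ?_) (fun k f => ?_) m f
  · rw [funext hal, expCoeff_mulLeft_emb]
  · have : be = dirDerivEnd Prod.snd fun p => -d p.1 := by
      funext n
      rw [hbe]
      have hD : -(d 0 • pderiv (0, n) + d 1 • pderiv (1, n)) =
          dirDeriv (Prod.snd : Fin 2 × ℕ+ → ℕ+) (fun p => -d p.1) n := by
        apply MvPolynomial.derivation_ext
        rintro ⟨j, n'⟩
        rw [dirDeriv_X]
        by_cases h : n' = n <;> fin_cases j <;>
          simp [pderiv_X, h, smul_eq_C_mul]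
      rw [dirDerivEnd, ← hD, Fin.sum_univ_two]
      rfl
    rw [this, expCoeff_eq_expSum, expSum_dirDeriv]
    rfl

variable {t : K} (hroot : ∀ n : ℕ, 1 ≤ n → t ^ n ≠ 1)

omit [CharZero K] in
lemma smul_cre (a : K) (i : Fin 2) (n : ℕ+) :
    a • cre i n = LinearMap.mulLeft K (C a * X (i, n) : Fock K) := by
  ext f
  simp [cre, smul_eq_C_mul]

include hroot in
lemma cPlus_smul_ann (i : Fin 2) (n : ℕ+) :
    cPlus t n • ann t i n = (pderiv (i, n)).toLinearMap := by
  have h1 : (1 - t ^ (n : ℕ)) ≠ 0 := sub_ne_zero.2 (hroot n n.pos).symm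
  have h2 : (n : K) ≠ 0 := by exact_mod_cast n.pos.ne'
  rw [cPlus, ann, smul_smul, div_mul_div_comm, mul_comm, div_self (mul_ne_zero h2 h1), one_smul]

include hroot in
lemma Lam1_eq (u₁ : K) (m : ℤ) (f : Fock K) :
    Lam1 t u₁ m f = u₁ • fockJing t⁻¹ ![1, 0] ![1, 0] (-m) f := by
  rw [Lam1, mode_eq_fockJing t⁻¹ ![1, 0] ![1, 0]]
  · intro n
    rw [smul_cre, emb_X, cMinus, inv_pow]
    simp
  · intro n
    simp [cPlus_smul_ann hroot]

include hroot in
lemma Lam2_eq (u₂ : K) (m : ℤ) (f : Fock K) :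
    Lam2 t u₂ m f = u₂ • fockJing t⁻¹ ![-1, 1] ![0, 1] (-m) f := by
  rw [Lam2, mode_eq_fockJing t⁻¹ ![-1, 1] ![0, 1]]
  · intro n
    rw [smul_cre, smul_cre, emb_X, cMinus, inv_pow]
    refine LinearMap.ext fun f => ?_
    simp only [Fin.sum_univ_two, LinearMap.add_apply, LinearMap.neg_apply,
      LinearMap.mulLeft_apply, Matrix.cons_val_zero, Matrix.cons_val_one, map_neg, map_one]
    ring
  · intro n
    simp [cPlus_smul_ann hroot]

include hroot in
lemma X2_eq (u₁ u₂ : K) (m : ℤ) (f : Fock K) :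
    X2 t u₁ u₂ m f = (u₁ * u₂) • fockJing t⁻¹ ![0, 1] ![1, 1] (-m) f := by
  rw [X2, mode_eq_fockJing t⁻¹ ![0, 1] ![1, 1]]
  · intro n
    rw [smul_cre, emb_X, cMinus, inv_pow]
    simp
  · intro n
    simp [cPlus_smul_ann hroot, add_comm]

include hroot in
-- For strictly negative modes only Λ̃² contributes. Its directions (-1,1) and (0,1) pair to 1, so
-- it acts as H at parameter t⁻¹.
lemma foldr_X1 (u₁ u₂ : K) (L : List ℕ) (hL : ∀ r ∈ L, 0 < r) :
    L.foldr (fun (r : ℕ) f => X1 t u₁ u₂ (-(r : ℤ)) f) 1 =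
      emb ![-1, 1] (jingVec t⁻¹ L) * C (u₂ ^ L.length) := by
  induction L with
  | nil => simp
  | cons r L ih =>
    have hr := hL r (by simp)
    rw [List.foldr_cons, ih fun x hx => hL x (by simp [hx]), X1, if_neg (by omega),
      if_pos (by omega), zero_add, Lam2_eq hroot, neg_neg,
      fockJing_emb_mul t⁻¹ (by simp) _ _ (fockShift_C _ _), jingVec_cons, List.length_cons,
      smul_eq_C_mul, pow_succ, C_mul]
    ring

omit [CharZero K] in
lemma fockShift_mul_eq_C {d : Fin 2 → K} {f g : Fock K} (hf : fockShift d f = Polynomial.C f)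
    (hg : fockShift d g = Polynomial.C g) : fockShift d (f * g) = Polynomial.C (f * g) := by
  rw [map_mul, hf, hg, Polynomial.C_mul]

include hroot in
-- The annihilation direction (1,1) pairs to 1 with (0,1) and to 0 with (-1,1). The vector built by
-- the X̃¹ modes therefore plays the role of the inert factor g.
lemma foldr_X2 (u₁ u₂ : K) (L : List ℕ) {g : Fock K}
    (hg : fockShift ![1, 1] g = Polynomial.C g) :
    L.foldr (fun (r : ℕ) f => X2 t u₁ u₂ (-(r : ℤ)) f) g =
      emb ![0, 1] (jingVec t⁻¹ L) * (C ((u₁ * u₂) ^ L.length) * g) := by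
  induction L with
  | nil => simp
  | cons r L ih =>
    rw [List.foldr_cons, ih, X2_eq hroot, neg_neg, fockJing_emb_mul t⁻¹ (by simp) _ _
      (fockShift_mul_eq_C (fockShift_C _ _) hg), jingVec_cons, List.length_cons, smul_eq_C_mul,
      pow_succ, C_mul (a := (u₁ * u₂) ^ _)]
    ring

/-- The iterated action `⋯ H_{-r₂} H_{-r₁} f` of lowering modes. -/
noncomputable def jingLower (t : K) (L : List ℕ) (f : SymFun K) : SymFun K :=
  L.foldl (fun f (r : ℕ) => jing t (-(r : ℤ)) f) f

include hroot in
lemma foldl_X2 (u₁ u₂ : K) (L : List ℕ) (f : SymFun K) {g : Fock K}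
    (hg : fockShift ![1, 1] g = Polynomial.C g) :
    L.foldl (fun f (r : ℕ) => X2 t u₁ u₂ (r : ℤ) f) (emb ![0, 1] f * g) =
      emb ![0, 1] (jingLower t⁻¹ L f) * (C ((u₁ * u₂) ^ L.length) * g) := by
  induction L generalizing f g with
  | nil => simp [jingLower]
  | cons r L ih =>
    rw [List.foldl_cons, X2_eq hroot, fockJing_emb_mul t⁻¹ (by simp) _ _ hg, smul_eq_C_mul,
      mul_left_comm, ih _ (fockShift_mul_eq_C (fockShift_C _ _) hg), jingLower, jingLower,
      List.foldl_cons, List.length_cons, pow_succ, C_mul (a := (u₁ * u₂) ^ _)]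
    ring

include hroot in
-- For strictly positive modes only Λ̃¹ contributes, and it involves the first boson alone. Killing
-- the second boson turns the direction (-1,1) into p_n ↦ -p_n and (0,1) into the constant term.
lemma evalFst_foldl_X1 (u₁ u₂ : K) (L : List ℕ) (hL : ∀ r ∈ L, 0 < r) (f : Fock K) :
    evalFst (L.foldl (fun f (r : ℕ) => X1 t u₁ u₂ (r : ℤ) f) f) =
      u₁ ^ L.length • jingLower t⁻¹ L (evalFst f) := by
  have hs : ∀ (M : List ℕ) (a : K) (h : SymFun K),
      jingLower t⁻¹ M (a • h) = a • jingLower t⁻¹ M h := by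
    intro M a h
    induction M generalizing h with
    | nil => rfl
    | cons r M ih => rw [jingLower, List.foldl_cons, jing_smul, ← jingLower, ih]; rfl
  induction L generalizing f with
  | nil => simp [jingLower]
  | cons r L ih =>
    have hr := hL r (by simp)
    rw [List.foldl_cons, ih fun x hx => hL x (by simp [hx]), X1, if_pos (by omega),
      if_neg (by omega), add_zero, Lam1_eq hroot, map_smul, evalFst_fockJing, hs, smul_smul,
      ← pow_succ]
    rfl

omit [CharZero K] in
lemma constantCoeff_negP (f : SymFun K) : constantCoeff (negP f) = constantCoeff f := by
  rw [← form_one 0, ← form_negP, map_one, form_one]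

include hroot in
-- Since H_{-r} conjugated by the sign change is the adjoint of H_r, the lowering modes are moved
-- one by one to the other side of the form.
lemma constantCoeff_jingLower (L : List ℕ) (f : SymFun K) :
    constantCoeff (jingLower t L f) = form t (jingVec t L) (negP f) := by
  induction L generalizing f with
  | nil => rw [jingVec_nil, form_one, constantCoeff_negP]; rfl
  | cons r L ih =>
    rw [jingVec_cons, form_jing hroot, jingAdj_eq, negP_negP, ← ih]
    rfl

omit [CharZero K] in
lemma inv_pow_ne_one (h : ∀ n : ℕ, 1 ≤ n → t ^ n ≠ 1) (n : ℕ) (hn : 1 ≤ n) : t⁻¹ ^ n ≠ 1 := by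
  rw [inv_pow, Ne, inv_eq_one]
  exact h n hn

include hroot in
lemma shapovalovEntry_eq (u₁ u₂ : K) {r s : ℕ} (x : Bipartition r) (y : Bipartition s) :
    shapovalovEntry t u₁ u₂ x y =
      u₁ ^ length x.2.1 * (u₁ * u₂) ^ length x.2.2 *
        (form t⁻¹ (jingQ t⁻¹ x.2.1) (jingQ t⁻¹ y.2.1) *
          form t⁻¹ (jingQ t⁻¹ x.2.2) (negP (jingQ t⁻¹ y.2.2))) *
        (u₂ ^ length y.2.1 * (u₁ * u₂) ^ length y.2.2) := by
  have hroot' := inv_pow_ne_one hroot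
  have hg : fockShift ![1, 1] (emb ![-1, 1] (jingVec t⁻¹ (rows y.2.1)) *
      C (u₂ ^ (rows y.2.1).length)) = Polynomial.C _ :=
    fockShift_mul_eq_C (fockShift_emb_of_eq_zero (by simp) _) (fockShift_C _ _)
  rw [shapovalovEntry, bra, ket, foldr_X1 hroot _ _ _ (rows_pos _), foldr_X2 hroot _ _ _ hg,
    foldl_X2 hroot _ _ _ _ (fockShift_mul_eq_C (fockShift_C _ _) hg), ← constantCoeff_evalFst,
    evalFst_foldl_X1 hroot _ _ _ (rows_pos _)]
  have hC : ∀ a : K, evalFst (C a) = C a := fun a => evalFst.commutes a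
  simp only [map_mul, evalFst_emb_zero, evalFst_emb_neg_one, hC, rows_length]
  rw [constantCoeff_jingLower hroot', smul_eq_C_mul, map_mul, constantCoeff_C,
    constantCoeff_jingLower hroot']
  have hN : ∀ a : K, negP (C a) = C a := fun a => (negP : SymFun K →ₐ[K] SymFun K).commutes a
  simp only [map_mul, hN, negP_negP, ← smul_eq_C_mul, map_smul, smul_eq_mul]
  rw [mul_comm (jingVec _ _), ← smul_eq_C_mul, map_smul, smul_eq_mul]
  unfold jingQ
  ring

end FreeField

end HallLittlewood

namespace HallLittlewood

open Finset MvPolynomial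

/-! ### The Shapovalov matrix and its inverse -/

section Shapovalov

variable {K : Type*} [Field K]

/-- The product `⟨Q_{x₁}, Q_{y₁}⟩ ⟨Q_{x₂}(p_n), Q_{y₂}(-p_n)⟩`. -/
noncomputable def pairForm (t : K) {r s : ℕ} (x : Bipartition r) (y : Bipartition s) : K :=
  form t (jingQ t x.2.1) (jingQ t y.2.1) * form t (jingQ t x.2.2) (negP (jingQ t y.2.2))

/-- `b_{x₁}(t) b_{x₂}(t)`. -/
noncomputable def pairB (t : K) {s : ℕ} (x : Bipartition s) : K := b t x.2.1 * b t x.2.2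

variable [CharZero K] {t : K} (hroot : ∀ n : ℕ, 1 ≤ n → t ^ n ≠ 1)

lemma pairForm_eq_zero (t : K) {r s : ℕ} (x : Bipartition r) (y : Bipartition s)
    (h : x.1.1 ≠ y.1.1) : pairForm t x y = 0 := by
  by_cases h1 : x.1.1.1 = y.1.1.1
  · have h2 : x.1.1.2 ≠ y.1.1.2 := fun h2 => h (Prod.ext h1 h2)
    rw [pairForm, form_eq_zero_of_ne t (isHomog_jingQ t _) (isHomog_negP (isHomog_jingQ t _)) h2,
      mul_zero]
  · rw [pairForm, form_eq_zero_of_ne t (isHomog_jingQ t _) (isHomog_jingQ t _) h1, zero_mul]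

include hroot in
-- The sum factors over the two components. In the second, the two sign changes can be moved
-- together by self-adjointness and cancel; Parseval in each factor leaves the orthogonality
-- relation of the Q_λ.
lemma sum_pairForm {s : ℕ} (x y : Bipartition s) :
    ∑ z : Bipartition s, pairForm t x z * pairForm t z y / pairB t z =
      if x = y then pairB t y else 0 := by
  have hsum : ∑ z : Bipartition s, pairForm t x z * pairForm t z y / pairB t z =
      form t (jingQ t x.2.1) (jingQ t y.2.1) * form t (jingQ t x.2.2) (jingQ t y.2.2) := by
    -- Only pairs z with the same component sizes as y contribute, by homogeneity.
    rw [Fintype.sum_sigma, Fintype.sum_eq_single y.1, Fintype.sum_prod_type,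
      ← sum_form_jingQ hroot _ (isHomog_jingQ t y.2.1), ← negP_negP (jingQ t x.2.2), form_negP,
      ← sum_form_jingQ hroot _ (isHomog_negP (isHomog_jingQ t y.2.2)), sum_mul_sum]
    · refine sum_congr rfl fun al _ => sum_congr rfl fun be _ => ?_
      simp only [pairForm, pairB, form_negP]
      rw [mul_mul_mul_comm, mul_div_mul_comm]
    · intro ij hij
      refine sum_eq_zero fun z _ => ?_
      rw [pairForm_eq_zero t _ y fun h => hij (Subtype.ext h), mul_zero, zero_div]
  rw [hsum]
  obtain ⟨kl, a, c⟩ := x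
  obtain ⟨ij, a', c'⟩ := y
  by_cases h : kl = ij
  · subst h
    simp only [form_jingQ hroot, pairB]
    by_cases h1 : a = a' <;> by_cases h2 : c = c' <;> simp [h1, h2]
  · have h1 : kl.1.1 ≠ ij.1.1 := by
      intro h1
      apply h
      have h2 := mem_antidiagonal.1 kl.2
      have h3 := mem_antidiagonal.1 ij.2
      exact Subtype.ext (Prod.ext h1 (by omega))
    rw [form_eq_zero_of_ne t (isHomog_jingQ t _) (isHomog_jingQ t _) h1, zero_mul, if_neg]
    exact fun h2 => h (congrArg Sigma.fst h2)

/-- The inverse of the Shapovalov matrix. -/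
noncomputable def shapovalovInv (t u₁ u₂ : K) (s : ℕ) :
    Matrix (Bipartition s) (Bipartition s) K :=
  Matrix.of fun x y => (u₂ ^ length x.2.1 * (u₁ * u₂) ^ length x.2.2)⁻¹ *
    (pairForm t⁻¹ x y / (pairB t⁻¹ x * pairB t⁻¹ y)) *
    (u₁ ^ length y.2.1 * (u₁ * u₂) ^ length y.2.2)⁻¹

omit [CharZero K] in
lemma pairB_ne_zero {t : K} (hroot : ∀ n : ℕ, 1 ≤ n → t ^ n ≠ 1) {s : ℕ} (x : Bipartition s) :
    pairB t x ≠ 0 := mul_ne_zero (b_ne_zero hroot _) (b_ne_zero hroot _)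

include hroot in
lemma shapovalov_mul_shapovalovInv {u₁ u₂ : K} (hu₁ : u₁ ≠ 0) (hu₂ : u₂ ≠ 0) (s : ℕ) :
    shapovalov t u₁ u₂ s * shapovalovInv t u₁ u₂ s = 1 := by
  have hroot' := inv_pow_ne_one hroot
  ext x y
  have hx : u₁ ^ length x.2.1 * (u₁ * u₂) ^ length x.2.2 ≠ 0 := by positivity
  have hterm : ∀ z : Bipartition s, shapovalov t u₁ u₂ s x z * shapovalovInv t u₁ u₂ s z y =
      (u₁ ^ length x.2.1 * (u₁ * u₂) ^ length x.2.2) *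
        (pairForm t⁻¹ x z * pairForm t⁻¹ z y / pairB t⁻¹ z) *
        (pairB t⁻¹ y * (u₁ ^ length y.2.1 * (u₁ * u₂) ^ length y.2.2))⁻¹ := by
    intro z
    have hz : u₂ ^ length z.2.1 * (u₁ * u₂) ^ length z.2.2 ≠ 0 := by positivity
    rw [shapovalov, Matrix.of_apply, shapovalovEntry_eq hroot, shapovalovInv, Matrix.of_apply,
      ← pairForm, mul_assoc _ (_ * _ : K), ← mul_assoc _ _ (_⁻¹ : K), mul_inv_cancel_left₀ hz]
    rw [div_eq_mul_inv, div_eq_mul_inv, mul_inv, mul_inv]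
    ring
  rw [Matrix.mul_apply, sum_congr rfl fun z _ => hterm z, ← sum_mul, ← mul_sum,
    sum_pairForm hroot', Matrix.one_apply]
  split_ifs with h
  · subst h
    rw [mul_comm (_ * _ : K) (pairB _ _), mul_inv_cancel₀ (mul_ne_zero (pairB_ne_zero hroot' x) hx)]
  · rw [mul_zero, zero_mul]

include hroot in
lemma isUnit_det_shapovalov {u₁ u₂ : K} (hu₁ : u₁ ≠ 0) (hu₂ : u₂ ≠ 0) (s : ℕ) :
    IsUnit (shapovalov t u₁ u₂ s).det :=
  Matrix.isUnit_det_of_right_inverse (shapovalov_mul_shapovalovInv hroot hu₁ hu₂ s)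

include hroot in
lemma inv_shapovalov {u₁ u₂ : K} (hu₁ : u₁ ≠ 0) (hu₂ : u₂ ≠ 0) (s : ℕ) :
    (shapovalov t u₁ u₂ s)⁻¹ = shapovalovInv t u₁ u₂ s :=
  Matrix.inv_eq_right_inv (shapovalov_mul_shapovalovInv hroot hu₁ hu₂ s)

include hroot in
lemma shapovalovEntry_eq_zero (u₁ u₂ : K) {r s : ℕ} (x : Bipartition r) (y : Bipartition s)
    (h : r ≠ s) : shapovalovEntry t u₁ u₂ x y = 0 := by
  rw [shapovalovEntry_eq hroot, ← pairForm, pairForm_eq_zero, mul_zero, zero_mul]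
  intro h1
  have h2 := mem_antidiagonal.1 x.1.2
  have h3 := mem_antidiagonal.1 y.1.2
  rw [h1] at h2
  omega

lemma shapovalovInv_emptyPair (u₁ u₂ : K) {s : ℕ} (lam mu : s.Partition) :
    shapovalovInv t u₁ u₂ s (emptyPair lam) (emptyPair mu) =
      ((u₁ * u₂) ^ (length lam + length mu))⁻¹ *
        form t⁻¹ (jingQ t⁻¹ lam) (negP (jingQ t⁻¹ mu)) / (b t⁻¹ lam * b t⁻¹ mu) := by
  have h1 : jingQ t⁻¹ (Nat.Partition.indiscrete 0) = 1 := (jingQ_oneRow t⁻¹ 0).trans (qf_zero _)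
  have h2 : length (Nat.Partition.indiscrete 0) = 0 := by simp [length]
  have h3 : b t⁻¹ (Nat.Partition.indiscrete 0) = 1 := by simp [b]
  rw [shapovalovInv, Matrix.of_apply]
  simp only [pairForm, pairB, emptyPair, h1, h2, h3, form_one, map_one, pow_zero, one_mul]
  rw [pow_add, mul_inv]
  ring

include hroot in
lemma form_negP_jingQ_inv (ht : t ≠ 0) {s : ℕ} (lam : s.Partition) :
    form t⁻¹ (negP (jingQ t⁻¹ (oneRow s))) (jingQ t⁻¹ lam) =
      (t ^ (s + nStat lam))⁻¹ * ∏ k ∈ Icc 1 (length lam), (1 - t ^ k) := by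
  rw [form_negP_jingQ (inv_pow_ne_one hroot) (inv_ne_zero ht)]
  simp only [inv_pow, inv_inv]

end Shapovalov

end HallLittlewood

/-! ### The main theorem -/

theorem mainTheorem10 {K : Type*} [Field K] [CharZero K] (t u₁ u₂ : K) (ht : t ≠ 0)
    (hroot : ∀ n : ℕ, 1 ≤ n → t ^ n ≠ 1) (hu₁ : u₁ ≠ 0) (hu₂ : u₂ ≠ 0) :
    -- the Hall-Littlewood functions exist and are unique
    (∃! P : (∀ n : ℕ, n.Partition → HallLittlewood.SymFun K),
      HallLittlewood.IsHallLittlewood t P) ∧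
    -- the pairing of `Q_(s)(-p_n; t)` with `Q_λ(p_n; t)`
    (∀ P : (∀ n : ℕ, n.Partition → HallLittlewood.SymFun K),
      HallLittlewood.IsHallLittlewood t P →
      ∀ (s : ℕ) (lam : s.Partition),
        HallLittlewood.innerQT 0 t
            (HallLittlewood.negP (HallLittlewood.Q t P (HallLittlewood.oneRow s)))
            (HallLittlewood.Q t P lam) =
          t ^ (s + HallLittlewood.nStat lam) *
            ∏ k ∈ Finset.Icc 1 (HallLittlewood.length lam), (1 - (t ^ k)⁻¹)) ∧
    -- the Shapovalov matrix is block diagonal with respect to the total size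
    (∀ (r s : ℕ) (x : HallLittlewood.Bipartition r) (y : HallLittlewood.Bipartition s),
      r ≠ s → HallLittlewood.shapovalovEntry t u₁ u₂ x y = 0) ∧
    -- its blocks are invertible, and the entries of the inverse at `(∅, λ)`, `(∅, (s))`
    (∀ s : ℕ,
      IsUnit (HallLittlewood.shapovalov t u₁ u₂ s).det ∧
      ∀ lam : s.Partition,
        (HallLittlewood.shapovalov t u₁ u₂ s)⁻¹
            (HallLittlewood.emptyPair lam)
            (HallLittlewood.emptyPair (HallLittlewood.oneRow s)) =
          ((u₁ * u₂) ^ (HallLittlewood.length lam +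
              HallLittlewood.length (HallLittlewood.oneRow s)))⁻¹ *
            (t ^ (s + HallLittlewood.nStat lam))⁻¹ *
            (∏ k ∈ Finset.Icc 1 (HallLittlewood.length lam), (1 - t ^ k)) /
            (HallLittlewood.b t⁻¹ lam * HallLittlewood.b t⁻¹ (HallLittlewood.oneRow s)) ∧
        (HallLittlewood.shapovalov t u₁ u₂ s)⁻¹
            (HallLittlewood.emptyPair (HallLittlewood.oneRow s))
            (HallLittlewood.emptyPair lam) =
          ((u₁ * u₂) ^ (HallLittlewood.length lam +
              HallLittlewood.length (HallLittlewood.oneRow s)))⁻¹ *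
            (t ^ (s + HallLittlewood.nStat lam))⁻¹ *
            (∏ k ∈ Finset.Icc 1 (HallLittlewood.length lam), (1 - t ^ k)) /
            (HallLittlewood.b t⁻¹ lam * HallLittlewood.b t⁻¹ (HallLittlewood.oneRow s))) := by
  refine ⟨HallLittlewood.existsUnique_isHallLittlewood hroot, fun P hP s lam => ?_,
    fun r s x y h => HallLittlewood.shapovalovEntry_eq_zero hroot u₁ u₂ x y h, fun s =>
    ⟨HallLittlewood.isUnit_det_shapovalov hroot hu₁ hu₂ s, fun lam => ?_⟩⟩
  · rw [HallLittlewood.IsHallLittlewood.eq_hallP hroot hP, HallLittlewood.Q_hallP hroot,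
      HallLittlewood.Q_hallP hroot, HallLittlewood.innerQT_eq_form,
      HallLittlewood.form_negP_jingQ hroot ht]
  -- Both entries reduce to one pairing: the first by symmetry of the form, the second by
  -- self-adjointness of p_n ↦ -p_n.
  · have hentry := HallLittlewood.form_negP_jingQ_inv hroot ht lam
    rw [HallLittlewood.inv_shapovalov hroot hu₁ hu₂, HallLittlewood.shapovalovInv_emptyPair,
      HallLittlewood.shapovalovInv_emptyPair, HallLittlewood.form_symm, hentry,
      ← HallLittlewood.form_negP, hentry]
    refine ⟨by rw [mul_assoc], ?_⟩
    rw [add_comm (HallLittlewood.length _), mul_comm (HallLittlewood.b _ _), mul_assoc]
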